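/- **Setting.** Let $k\ge 1$, $\ell\ge 1$, let $V_1,\dots,V_k$ be sets and $v^0_i\in V_i$ initial values. The data type $\mathcal O_T$ has state space $\prod_i V_i$, initial state $(v^0_1,\dots,v^0_k)$, invocations $READ(I)$ ($\emptyset\ne I\subseteq[k]$), which returns $(v_i)_{i\in I}$ and leaves the state unchanged, and $WRITE((u_i)_{i\in I})$ ($\emptyset\neq I\subseteq[k]$, $u_i\in V_i$), which returns $ok$ and replaces $v_i$ by $u_i$ for $i\in I$. **Algorithm A** is the composition of I/O automata for writers $w_1,\dots,w_\ell$ (which invoke WRITEs), one reader $r$ (which invokes READs), servers $s_1,\dots,s_k$ ($s_i$ stores object $i$), and reliable, asynchronous, possibly reordering channels between the processes, including channels between the writers and the reader. Each process is single-threaded: it handles each input atomically and emits its outputs in order. Keys are pairs $\kappa=(z,w)$, with initial key $\kappa^0=(0,w_0)$ for a place holder $w_0$. * *Writer $w$*, with counter $z$, initially $0$: on $WRITE((u_i)_{i\in I})$ it increments $z$, forms the key $\kappa=(z,w)$ from the new value, sends (write-value, $(\kappa,u_i)$) to $s_i$ for each $i\in I$, and awaits acknowledgements from all of them. It then sends (inform-reader,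 $(\kappa,(b_1,\dots,b_k))$) to $r$, where $b_i=1$ iff $i\in I$, awaits the acknowledgement of $r$, and responds $ok$. * *Reader $r$*, with a list $List$, initially $[(\kappa^0,(1,\dots,1))]$: on $READ(I)$ it sends, for each $i\in I$, (read-value, $\kappa_i$) to $s_i$, where $\kappa_i$ is the key of the last entry of $List$ with $b_i=1$. It awaits a value $v_i$ from $s_i$ for each $i\in I$, and returns $(v_i)_{i\in I}$. On (inform-reader, $(\kappa,b)$) from $w$ it appends $(\kappa,b)$ to $List$ and sends (acknowledge, $|List|$) to $w$. * *Server $s_i$*, with a set $Vals$, initially $\{(\kappa^0,v^0_i)\}$: on (write-value, $(\kappa,v)$) from $w$ it adds $(\kappa,v)$ to $Vals$ and acknowledges. On (read-value, $\kappa$) from $r$ it sends to $r$ a value $v$ with $(\kappa,v)\in Vals$. An execution is *well-formed* if every client invokes a transaction only after all its earlier ones have completed. It is *fair* if every process keeps emitting its pending outputs and every message sent is eventually received. **Theorem.** Every well-formed fair (finite or infinite) execution of Algorithm A has the following properties. * **(S)** It is strictly serializable with respect to $\mathcal O_T$: every response answers an invoked transaction, and one can choose a set of transactions containing all complete ones,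 and for each of them a serialization point after its invocation and (if it is complete) before its response, such that executing the chosen transactions one after the other in the order of these points on $\mathcal O_T$ yields the responses of the execution. * **(N)** Whenever a server has received a read-value request, it sends a value to the reader without any further input: this happens in every fair continuation of that server automaton alone, from its state just after the receipt, without input actions. * **(O)** In every complete $READ(I)$, for each $i\in I$, the reader and $s_i$ exchange exactly one request and one answer, the answer carries exactly one value of object $i$, and this is the value returned. No messages are exchanged with $s_i$ for $i\notin I$. * **(W)** Every READ and every WRITE invoked completes, whatever transactions are concurrent with it. Moreover, transactions can be invoked at any time: after any finite prefix of a well-formed execution, any client with no transaction in progress can next invoke any transaction of its kind, and the result extends to a well-formed fair execution. Finally, Algorithm A is wait-free: in every well-formed execution that is fair towards a client $p$, the reader, the servers and the channels, every transaction invoked at $p$ completes, even if the other writers are arbitrarily slow or stop taking steps. -/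

import Mathlib

universe u

namespace SNOW

/-! ## I/O automata -/

/-- An I/O automaton over a universe `Act` of actions: states, start states, a signature of
pairwise disjoint input, output and internal actions, a transition relation in which every input
action is enabled in every state, and a partition of the locally controlled (output and internal)
actions into tasks. -/
structure IOAutomaton (Act : Type u) where
  State : Type u
  start : Set State
  input : Set Act
  output : Set Act
  internal : Set Act
  trans : State → Act → State → Prop
  Task : Type u
  task : Task → Set Act
  disjoint_input_output : Disjoint input output
  disjoint_input_internal : Disjoint input internal
  disjoint_output_internal : Disjoint output internal
  trans_sig : ∀ s a s', trans s a s' → a ∈ input ∪ output ∪ internal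
  input_enabled : ∀ s, ∀ a ∈ input, ∃ s', trans s a s'
  task_cover : (⋃ t, task t) = output ∪ internal
  task_disjoint : ∀ t t', t ≠ t' → Disjoint (task t) (task t')

namespace IOAutomaton

variable {Act : Type u}

/-- All actions of the signature. -/
def sig (A : IOAutomaton Act) : Set Act := A.input ∪ A.output ∪ A.internal

/-- Compatibility of a family of automata: no two share an output action, and an internal action
of one is not an action of another. -/
def Compatible {ι : Type u} (A : ι → IOAutomaton Act) : Prop :=
  ∀ i j, i ≠ j → Disjoint (A i).output (A j).output ∧ Disjoint (A i).internal (A j).sig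

/-- Composition of a compatible family: all components that have an action in their signature
perform it together, all others keep their state. -/
def compose {ι : Type u} (A : ι → IOAutomaton Act) (hA : Compatible A) : IOAutomaton Act where
  State := ∀ i, (A i).State
  start := {s | ∀ i, s i ∈ (A i).start}
  input := (⋃ i, (A i).input) \ ⋃ i, (A i).output
  output := ⋃ i, (A i).output
  internal := ⋃ i, (A i).internal
  trans s a s' := (∃ i, a ∈ (A i).sig) ∧
    ∀ i, (a ∈ (A i).sig → (A i).trans (s i) a (s' i)) ∧ (a ∉ (A i).sig → s' i = s i)
  Task := Σ i, (A i).Task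
  task t := (A t.1).task t.2
  disjoint_input_output := Set.disjoint_sdiff_left
  disjoint_input_internal := by
    rw [Set.disjoint_left]
    rintro a ⟨ha, -⟩ hb
    obtain ⟨i, hi⟩ := Set.mem_iUnion.1 ha
    obtain ⟨j, hj⟩ := Set.mem_iUnion.1 hb
    by_cases h : j = i
    · subst h
      exact Set.disjoint_left.1 (A j).disjoint_input_internal hi hj
    · exact Set.disjoint_left.1 (hA j i h).2 hj (Or.inl (Or.inl hi))
  disjoint_output_internal := by
    rw [Set.disjoint_left]
    intro a ha hb
    obtain ⟨i, hi⟩ := Set.mem_iUnion.1 ha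
    obtain ⟨j, hj⟩ := Set.mem_iUnion.1 hb
    by_cases h : j = i
    · subst h
      exact Set.disjoint_left.1 (A j).disjoint_output_internal hi hj
    · exact Set.disjoint_left.1 (hA j i h).2 hj (Or.inl (Or.inr hi))
  trans_sig := by
    rintro s a s' ⟨⟨i, hi⟩, -⟩
    by_cases ho : a ∈ ⋃ i, (A i).output
    · exact Or.inl (Or.inr ho)
    · rcases hi with (hi | hi) | hi
      · exact Or.inl (Or.inl ⟨Set.mem_iUnion.2 ⟨i, hi⟩, ho⟩)
      · exact absurd (Set.mem_iUnion.2 ⟨i, hi⟩) ho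
      · exact Or.inr (Set.mem_iUnion.2 ⟨i, hi⟩)
  input_enabled := by
    classical
    rintro s a ⟨ha, hb⟩
    have key : ∀ i, ∃ t, (a ∈ (A i).sig → (A i).trans (s i) a t) ∧ (a ∉ (A i).sig → t = s i) := by
      intro i
      by_cases h : a ∈ (A i).sig
      · have hin : a ∈ (A i).input := by
          rcases h with (h | h) | h
          · exact h
          · exact absurd (Set.mem_iUnion.2 ⟨i, h⟩) hb
          · obtain ⟨j, hj⟩ := Set.mem_iUnion.1 ha
            by_cases hij : i = j
            · subst hij; exact hj
            · exact absurd (Or.inl (Or.inl hj)) (Set.disjoint_left.1 (hA i j hij).2 h)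
        obtain ⟨t, ht⟩ := (A i).input_enabled (s i) a hin
        exact ⟨t, fun _ => ht, fun h' => absurd h h'⟩
      · exact ⟨s i, fun h' => absurd h' h, fun _ => rfl⟩
    choose t ht using key
    obtain ⟨j, hj⟩ := Set.mem_iUnion.1 ha
    exact ⟨t, ⟨j, Or.inl (Or.inl hj)⟩, ht⟩
  task_cover := by
    ext a
    have h : ∀ i, (∃ t, a ∈ (A i).task t) ↔ a ∈ (A i).output ∪ (A i).internal := by
      intro i
      rw [← (A i).task_cover, Set.mem_iUnion]
    simp only [Set.mem_iUnion, Set.mem_union, Sigma.exists, h, exists_or]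
  task_disjoint := by
    rintro ⟨i, t⟩ ⟨j, t'⟩ hne
    have hl : ∀ (i : ι) (t : (A i).Task) (a : Act), a ∈ (A i).task t →
        a ∈ (A i).output ∪ (A i).internal := by
      intro i t a ha
      rw [← (A i).task_cover]
      exact Set.mem_iUnion.2 ⟨t, ha⟩
    by_cases h : i = j
    · subst h
      exact (A i).task_disjoint t t' (fun h => hne (by rw [h]))
    · rw [Set.disjoint_left]
      intro a ha ha'
      rcases hl i t a ha with h1 | h1 <;> rcases hl j t' a ha' with h2 | h2
      · exact Set.disjoint_left.1 (hA i j h).1 h1 h2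
      · exact Set.disjoint_left.1 (hA j i (Ne.symm h)).2 h2 (Or.inl (Or.inr h1))
      · exact Set.disjoint_left.1 (hA i j h).2 h1 (Or.inl (Or.inr h2))
      · exact Set.disjoint_left.1 (hA i j h).2 h1 (Or.inr h2)

/-- A finite or infinite execution fragment `state 0, act 0, state 1, act 1, ...`.  The value
`act n = none` means that the fragment has ended before its step `n`; from then on there are no
further actions and the (final) state is repeated. -/
structure Fragment (A : IOAutomaton Act) where
  state : ℕ → A.State
  act : ℕ → Option Act
  step : ∀ n a, act n = some a → A.trans (state n) a (state (n + 1))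
  ended : ∀ n, act n = none → act (n + 1) = none ∧ state (n + 1) = state n

/-- An execution is a fragment that begins in a start state. -/
def Fragment.IsExecution {A : IOAutomaton Act} (α : A.Fragment) : Prop := α.state 0 ∈ A.start

/-- Some action of the task `t` is enabled in the state `s`. -/
def TaskEnabled (A : IOAutomaton Act) (t : A.Task) (s : A.State) : Prop :=
  ∃ a ∈ A.task t, ∃ s', A.trans s a s'

/-- Fairness towards the tasks in `T`: an infinite fragment contains, for each such task,
infinitely many of its actions or infinitely many states in which it is not enabled; in the final
state of a finite fragment no such task is enabled. (The final state of a finite fragment is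
repeated forever, so that one formula covers both cases.) -/
def Fragment.FairOn {A : IOAutomaton Act} (α : A.Fragment) (T : Set A.Task) : Prop :=
  ∀ t ∈ T, ∀ n, ∃ m, n ≤ m ∧
    ((∃ a ∈ A.task t, α.act m = some a) ∨ ¬ A.TaskEnabled t (α.state m))

/-- A fair fragment is fair towards all tasks. -/
def Fragment.Fair {A : IOAutomaton Act} (α : A.Fragment) : Prop := α.FairOn Set.univ

end IOAutomaton

/-! ## The data type `O_T` with `k` objects, object `i` holding values in `V i` -/

/-- Invocations: `READ` of a nonempty set of objects, and `WRITE` of values to the nonempty set of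
those objects `i` for which `u i` is not `none`. -/
inductive Inv {k : ℕ} (V : Fin k → Type u) : Type u
  | read (I : Finset (Fin k)) (hI : I.Nonempty)
  | write (u : ∀ i, Option (V i)) (hu : ∃ i, (u i).isSome)

/-- Responses: the tuple of the values of the objects read (`none` at the objects not read),
or `ok`. -/
inductive Resp {k : ℕ} (V : Fin k → Type u) : Type u
  | vals (y : ∀ i, Option (V i))
  | ok

/-- The sequential specification `f : invocations × V → responses × V`. -/
def dataType {k : ℕ} {V : Fin k → Type u} :
    Inv V → (∀ i, V i) → Resp V × (∀ i, V i)
  | .read I _, x => (.vals (fun i => if i ∈ I then some (x i) else none), x)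
  | .write u _, x => (.ok, fun i => (u i).getD (x i))

/-! ## Processes, messages, actions -/

/-- The processes: `l` writers, one reader, and one server for each of the `k` objects. -/
inductive Proc (k l : ℕ) : Type
  | writer (w : Fin l)
  | reader
  | server (i : Fin k)
  deriving DecidableEq

/-- Keys are pairs of a number and a writer id; `none` is the place holder id `w₀`. -/
abbrev Key (l : ℕ) : Type := ℕ × Option (Fin l)

/-- The key `κ⁰ = (0, w₀)`. -/
def key0 (l : ℕ) : Key l := (0, none)

/-- The messages of the algorithm. -/
inductive Msg {k : ℕ} (V : Fin k → Type u) (l : ℕ) : Type u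
  /-- (write-value, `(κ, v)`), from a writer to the server of object `i` -/
  | writeValue (κ : Key l) (i : Fin k) (v : V i)
  /-- acknowledge, from a server to a writer -/
  | ack
  /-- (inform-reader, `(κ, (b₁, …, b_k))`), from a writer to the reader -/
  | informReader (κ : Key l) (b : Fin k → Bool)
  /-- (acknowledge, `t`), from the reader to a writer -/
  | ackTag (t : ℕ)
  /-- (read-value, `κ`), from the reader to a server -/
  | readValue (κ : Key l)
  /-- one value `v` of object `i`, from the server of object `i` to the reader -/
  | value (i : Fin k) (v : V i)

/-- The actions: invocation and response of transactions at a client, and `send(m)_{p,q}`,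
`recv(m)_{p,q}` for a message `m` from process `p` to process `q`. -/
inductive Act {k : ℕ} (V : Fin k → Type u) (l : ℕ) : Type u
  | inv (p : Proc k l) (x : Inv V)
  | resp (p : Proc k l) (y : Resp V)
  | send (p q : Proc k l) (m : Msg V l)
  | recv (p q : Proc k l) (m : Msg V l)

/-- Writers invoke `WRITE`s only, the reader invokes `READ`s only, servers invoke nothing. -/
def MayInvoke {k l : ℕ} {V : Fin k → Type u} : Proc k l → Inv V → Prop
  | .writer _, .write _ _ => True
  | .reader, .read _ _ => True
  | _, _ => False

/-- What a process receives: an invocation from the environment or a message from `q`. -/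
inductive Input {k : ℕ} (V : Fin k → Type u) (l : ℕ) : Type u
  | inv (x : Inv V)
  | recv (q : Proc k l) (m : Msg V l)

/-- What a process emits: a message to `q` or a response to the environment. -/
inductive Output {k : ℕ} (V : Fin k → Type u) (l : ℕ) : Type u
  | send (q : Proc k l) (m : Msg V l)
  | resp (y : Resp V)

/-- The local program of a process: `next s e` is the set of possible results, new local variables
and list of outputs that have to be emitted in this order, of handling the input `e`. -/
structure Program {k : ℕ} (V : Fin k → Type u) (l : ℕ) where
  Vars : Type u
  init : Vars
  next : Vars → Input V l → Set (Vars × List (Output V l))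
  next_nonempty : ∀ s e, (next s e).Nonempty

/-- The automaton of process `p` running a program in a single-threaded manner: its state consists
of the local variables and the queue of outputs not yet emitted; an input runs its handler, an
output action emits the head of the queue. All its output actions form one task. -/
def Program.automaton {k l : ℕ} {V : Fin k → Type u} (P : Program V l) (p : Proc k l) :
    IOAutomaton (Act V l) where
  State := P.Vars × List (Output V l)
  start := {(P.init, [])}
  input := {a | (∃ x, MayInvoke p x ∧ a = .inv p x) ∨ ∃ q m, a = .recv q p m}
  output := {a | (∃ q m, a = .send p q m) ∨ ∃ y, a = .resp p y}
  internal := ∅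
  trans s a s' :=
    (∃ x, MayInvoke p x ∧ a = .inv p x ∧ ∃ r ∈ P.next s.1 (.inv x), s' = (r.1, s.2 ++ r.2)) ∨
    (∃ q m, a = .recv q p m ∧ ∃ r ∈ P.next s.1 (.recv q m), s' = (r.1, s.2 ++ r.2)) ∨
    (∃ q m, a = .send p q m ∧ s'.1 = s.1 ∧ s.2 = .send q m :: s'.2) ∨
    (∃ y, a = .resp p y ∧ s'.1 = s.1 ∧ s.2 = .resp y :: s'.2)
  Task := PUnit
  task _ := {a | (∃ q m, a = .send p q m) ∨ ∃ y, a = .resp p y}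
  disjoint_input_output := by
    rw [Set.disjoint_left]
    rintro a (⟨x, -, rfl⟩ | ⟨q, m, rfl⟩) (⟨q', m', h⟩ | ⟨y, h⟩) <;> cases h
  disjoint_input_internal := Set.disjoint_empty _
  disjoint_output_internal := Set.disjoint_empty _
  trans_sig := by
    rintro s a s' (⟨x, hx, h, -⟩ | ⟨q, m, h, -⟩ | ⟨q, m, h, -⟩ | ⟨y, h, -⟩)
    · exact Or.inl (Or.inl (Or.inl ⟨x, hx, h⟩))
    · exact Or.inl (Or.inl (Or.inr ⟨q, m, h⟩))
    · exact Or.inl (Or.inr (Or.inl ⟨q, m, h⟩))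
    · exact Or.inl (Or.inr (Or.inr ⟨y, h⟩))
  input_enabled := by
    rintro s a (⟨x, hx, h⟩ | ⟨q, m, h⟩)
    · obtain ⟨r, hr⟩ := P.next_nonempty s.1 (.inv x)
      exact ⟨_, Or.inl ⟨x, hx, h, r, hr, rfl⟩⟩
    · obtain ⟨r, hr⟩ := P.next_nonempty s.1 (.recv q m)
      exact ⟨_, Or.inr (Or.inl ⟨q, m, h, r, hr, rfl⟩)⟩
  task_cover := by
    rw [Set.iUnion_const, Set.union_empty]
  task_disjoint := fun _ _ h => absurd rfl h

/-- The reliable asynchronous channel from `p` to `q`, which may reorder messages. Its state is the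
multiset of messages in transit; every message is a task of its own, so that in a fair execution
each message that has been sent is eventually received. -/
def channel {k l : ℕ} (V : Fin k → Type u) (p q : Proc k l) : IOAutomaton (Act V l) where
  State := Multiset (Msg V l)
  start := {0}
  input := {a | ∃ m, a = .send p q m}
  output := {a | ∃ m, a = .recv p q m}
  internal := ∅
  trans s a s' :=
    (∃ m, a = .send p q m ∧ s' = m ::ₘ s) ∨ (∃ m, a = .recv p q m ∧ s = m ::ₘ s')
  Task := Msg V l
  task m := {.recv p q m}
  disjoint_input_output := by
    rw [Set.disjoint_left]
    rintro a ⟨m, rfl⟩ ⟨m', h⟩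
    cases h
  disjoint_input_internal := Set.disjoint_empty _
  disjoint_output_internal := Set.disjoint_empty _
  trans_sig := by
    rintro s a s' (⟨m, h, -⟩ | ⟨m, h, -⟩)
    · exact Or.inl (Or.inl ⟨m, h⟩)
    · exact Or.inl (Or.inr ⟨m, h⟩)
  input_enabled := by
    rintro s a ⟨m, h⟩
    exact ⟨_, Or.inl ⟨m, h, rfl⟩⟩
  task_cover := by
    ext a
    simp [eq_comm]
  task_disjoint := by
    intro m m' h
    rw [Set.disjoint_singleton]
    intro h'
    cases h'
    exact h rfl

/-! ## Algorithm A -/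

section AlgorithmA

variable {k : ℕ} (V : Fin k → Type u) (l : ℕ)

/-- The phase of a writer. In the phase *write-value* it keeps the key, the arguments of the
`WRITE`, and the set of servers whose acknowledgement it awaits. -/
inductive WriterPhase : Type u
  | idle
  | writeValue (κ : Key l) (u : ∀ i, Option (V i)) (unacked : Finset (Fin k))
  | informReader

/-- The writer's variables: the counter `z` and its phase. -/
structure WriterVars : Type u where
  z : ℕ
  phase : WriterPhase V l

/-- The reader's variables: `list`, and, during a `READ` of the objects `I`, the set `I` together
with the values received so far. -/
structure ReaderVars : Type u where
  list : List (Key l × (Fin k → Bool))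
  phase : Option (Finset (Fin k) × (∀ i, Option (V i)))

/-- The variable `Vals` of the server of object `i`. -/
structure ServerVars (i : Fin k) : Type u where
  vals : Set (Key l × V i)

variable {V l}

/-- Steps of writer `w`. On `WRITE(u)`: create the key `κ = (z + 1, w)`, increment `z`, send
(write-value, `(κ, v_i)`) to each server concerned. On the last missing acknowledgement: send
(inform-reader, `(κ, b)`) to the reader. On the reader's acknowledgement: respond `ok`. All other
inputs, in particular invocations while a `WRITE` is in progress, have no effect. -/
def writerNext (w : Fin l) (s : WriterVars V l) :
    Input V l → WriterVars V l × List (Output V l)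
  | .inv (.write u _) =>
    match s.phase with
    | .idle =>
      (⟨s.z + 1, .writeValue (s.z + 1, some w) u (Finset.univ.filter fun i => (u i).isSome)⟩,
        (List.finRange k).filterMap fun i =>
          (u i).map fun v => .send (.server i) (.writeValue (s.z + 1, some w) i v))
    | _ => (s, [])
  | .recv (.server i) .ack =>
    match s.phase with
    | .writeValue κ u unacked =>
      if unacked.erase i = ∅ then
        (⟨s.z, .informReader⟩, [.send .reader (.informReader κ fun j => (u j).isSome)])
      else (⟨s.z, .writeValue κ u (unacked.erase i)⟩, [])
    | _ => (s, [])
  | .recv .reader (.ackTag _) =>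
    match s.phase with
    | .informReader => (⟨s.z, .idle⟩, [.resp .ok])
    | _ => (s, [])
  | _ => (s, [])

/-- The key of the last entry `(κ, (b₁, …, b_k))` of the list with `b_i = 1`. (The default is never
used: the first entry of the reader's list is `(κ⁰, (1, …, 1))`.) -/
def latestKey (L : List (Key l × (Fin k → Bool))) (i : Fin k) : Key l :=
  ((L.filter fun e => e.2 i).getLastD (key0 l, fun _ => true)).1

/-- Steps of the reader. On `READ(I)`: for each `i ∈ I` send (read-value, `κ_i`) to the server of
object `i`, where `κ_i` is the latest key in the list for object `i`. On a value from a server: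
record it, and once all values have been received respond with them. On (inform-reader, `(κ, b)`)
from a writer: append `(κ, b)` to the list and acknowledge with the length of the list. All other
inputs have no effect. -/
def readerNext (s : ReaderVars V l) : Input V l → ReaderVars V l × List (Output V l)
  | .inv (.read I _) =>
    match s.phase with
    | none =>
      (⟨s.list, some (I, fun _ => none)⟩,
        ((List.finRange k).filter fun i => i ∈ I).map fun i =>
          .send (.server i) (.readValue (latestKey s.list i)))
    | some _ => (s, [])
  | .recv (.server i) (.value j v) =>
    match s.phase with
    | some (I, y) =>
      if j = i ∧ i ∈ I then
        if ∀ a ∈ I, (Function.update y j (some v) a).isSome then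
          (⟨s.list, none⟩, [.resp (.vals (Function.update y j (some v)))])
        else (⟨s.list, some (I, Function.update y j (some v))⟩, [])
      else (s, [])
    | none => (s, [])
  | .recv (.writer w) (.informReader κ b) =>
    (⟨s.list ++ [(κ, b)], s.phase⟩, [.send (.writer w) (.ackTag (s.list.length + 1))])
  | _ => (s, [])

/-- Steps of the server of object `i`. On (write-value, `(κ, v)`) from a writer: add `(κ, v)` to
`Vals` and acknowledge. On (read-value, `κ`) from the reader: send some `v` with `(κ, v) ∈ Vals`
to the reader; if there is none, nothing is sent. All other inputs have no effect. -/
def serverNext (i : Fin k) (s : ServerVars V l i) :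
    Input V l → Set (ServerVars V l i × List (Output V l))
  | .recv (.writer w) (.writeValue κ j v) =>
    if h : j = i then {(⟨insert (κ, h ▸ v) s.vals⟩, [.send (.writer w) .ack])} else {(s, [])}
  | .recv .reader (.readValue κ) =>
    {r | (∃ v, (κ, v) ∈ s.vals ∧ r = (s, [.send .reader (.value i v)])) ∨
      ((∀ v, (κ, v) ∉ s.vals) ∧ r = (s, []))}
  | _ => {(s, [])}

/-- The program of each process; `v₀ i` is the initial value of object `i`. -/
def program (v₀ : ∀ i, V i) : Proc k l → Program V l
  | .writer w =>
    { Vars := WriterVars V l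
      init := ⟨0, .idle⟩
      next := fun s e => {writerNext w s e}
      next_nonempty := fun _ _ => Set.singleton_nonempty _ }
  | .reader =>
    { Vars := ReaderVars V l
      init := ⟨[(key0 l, fun _ => true)], none⟩
      next := fun s e => {readerNext s e}
      next_nonempty := fun _ _ => Set.singleton_nonempty _ }
  | .server i =>
    { Vars := ServerVars V l i
      init := ⟨{(key0 l, v₀ i)}⟩
      next := serverNext i
      next_nonempty := by
        intro s e
        unfold serverNext
        split
        · split <;> exact Set.singleton_nonempty _
        · rename_i κ
          by_cases h : ∃ v, (κ, v) ∈ s.vals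
          · obtain ⟨v, hv⟩ := h
            exact ⟨_, Or.inl ⟨v, hv, rfl⟩⟩
          · exact ⟨_, Or.inr ⟨fun v hv => h ⟨v, hv⟩, rfl⟩⟩
        · exact Set.singleton_nonempty _ }

/-- The components of the system: the processes, and a channel for every ordered pair of
processes; in particular there are channels between the writers and the reader. -/
inductive Comp (k l : ℕ) : Type u
  | proc (p : Proc k l)
  | chan (p q : Proc k l)

/-- The automaton of each component. -/
def component (v₀ : ∀ i, V i) : Comp.{u} k l → IOAutomaton (Act V l)
  | .proc p => (program v₀ p).automaton p
  | .chan p q => channel V p q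

theorem component_compatible (v₀ : ∀ i, V i) :
    IOAutomaton.Compatible (component (l := l) v₀) := by
  intro c c' hne
  constructor
  · rw [Set.disjoint_left]
    cases c <;> cases c' <;> intro a h h'
    · rcases h with ⟨q, m, rfl⟩ | ⟨y, rfl⟩ <;> rcases h' with ⟨q', m', h'⟩ | ⟨y', h'⟩ <;>
        cases h' <;> exact hne rfl
    · rcases h with ⟨q, m, rfl⟩ | ⟨y, rfl⟩ <;> obtain ⟨m', h'⟩ := h' <;> cases h'
    · rcases h' with ⟨q, m, rfl⟩ | ⟨y, rfl⟩ <;> obtain ⟨m', h⟩ := h <;> cases h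
    · obtain ⟨m, rfl⟩ := h
      obtain ⟨m', h'⟩ := h'
      cases h'
      exact hne rfl
  · cases c <;> exact Set.empty_disjoint _

variable (l) in
/-- Algorithm A: the composition of all writers, the reader, all servers and all channels. -/
def algorithmA (v₀ : ∀ i, V i) : IOAutomaton (Act V l) :=
  IOAutomaton.compose (component (l := l) v₀) (component_compatible v₀)

end AlgorithmA

/-! ## Properties of executions. An execution is given by its finite or infinite sequence of
actions `act`; transactions are identified with the positions of their invocations. -/

section Properties

variable {k l : ℕ} {V : Fin k → Type u}

/-- The event `m` is the response of the transaction invoked by the event `n`: it is the first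
response at the same client after `n`. -/
def IsResponse (act : ℕ → Option (Act V l)) (n m : ℕ) : Prop :=
  ∃ p x y, act n = some (.inv p x) ∧ act m = some (.resp p y) ∧ n < m ∧
    ∀ j, n < j → j < m → ∀ y', act j ≠ some (.resp p y')

/-- Well-formedness: a client invokes a transaction only after all its previous ones have
completed. -/
def WellFormed (act : ℕ → Option (Act V l)) : Prop :=
  ∀ n n' p x x', n < n' → act n = some (.inv p x) → act n' = some (.inv p x') →
    ∃ m, m < n' ∧ IsResponse act n m

/-- All transactions invoked at process `p` complete. -/
def CompletesAt (p : Proc k l) (act : ℕ → Option (Act V l)) : Prop :=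
  ∀ n x, act n = some (.inv p x) → ∃ m, IsResponse act n m

/-- Strict serializability with respect to the data type with initial values `v₀`. Every response
answers a transaction, and there are a finite or infinite sequence `order` of transactions,
containing all complete and possibly some incomplete ones, each once, and for each of them a
serialization point, located in the execution between the event `pt n` and the event `pt n + 1`,
which lies after the invocation and, if the transaction is complete, before the response, such
that `order` lists the transactions by their serialization points, and executing them one after
the other in this order on the data type produces the responses of the execution. -/
def StrictlySerializable (v₀ : ∀ i, V i) (act : ℕ → Option (Act V l)) : Prop :=
  (∀ m p y, act m = some (.resp p y) → ∃ n, IsResponse act n m) ∧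
  ∃ (order : ℕ → Option ℕ) (pt : ℕ → ℕ) (val : ℕ → ∀ i, V i),
    (∀ a, order a = none → order (a + 1) = none) ∧
    (∀ a b n, order a = some n → order b = some n → a = b) ∧
    (∀ a n, order a = some n → ∃ p x, act n = some (.inv p x)) ∧
    (∀ n m, IsResponse act n m → ∃ a, order a = some n) ∧
    (∀ a n, order a = some n → n ≤ pt n ∧ ∀ m, IsResponse act n m → pt n < m) ∧
    (∀ a b n n', a < b → order a = some n → order b = some n' → pt n ≤ pt n') ∧
    val 0 = v₀ ∧
    (∀ a n p x, order a = some n → act n = some (.inv p x) →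
      (dataType x (val a)).2 = val (a + 1) ∧
      ∀ m y, IsResponse act n m → act m = some (.resp p y) → y = (dataType x (val a)).1)

/-- The event is the sending or the receipt of a message between the reader and the server of
object `i`, in either direction. -/
def IsReaderServerEvent (i : Fin k) (a : Option (Act V l)) : Prop :=
  ∃ m, a = some (.send .reader (.server i) m) ∨ a = some (.recv .reader (.server i) m) ∨
    a = some (.send (.server i) .reader m) ∨ a = some (.recv (.server i) .reader m)

/-- One response per read. In every complete `READ(I)`, returning the tuple `y`, the read of each
`i ∈ I` consists of exactly one round: one read request is sent to the server of object `i` and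
received there, then one message with exactly one value of object `i` is sent back and received,
and this value is the one returned; no other message between the reader and this server is sent or
received during the `READ`. No message at all is exchanged with the servers of the other
objects. -/
def OneResponse (act : ℕ → Option (Act V l)) : Prop :=
  ∀ n m I hI, act n = some (.inv .reader (.read I hI)) → IsResponse act n m →
    ∃ y, act m = some (.resp .reader (.vals y)) ∧
      ∀ i,
        (i ∈ I → ∃ (e₁ e₂ e₃ e₄ : ℕ) (κ : Key l) (v : V i),
          n < e₁ ∧ e₁ < e₂ ∧ e₂ < e₃ ∧ e₃ < e₄ ∧ e₄ < m ∧
          act e₁ = some (.send .reader (.server i) (.readValue κ)) ∧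
          act e₂ = some (.recv .reader (.server i) (.readValue κ)) ∧
          act e₃ = some (.send (.server i) .reader (.value i v)) ∧
          act e₄ = some (.recv (.server i) .reader (.value i v)) ∧
          y i = some v ∧
          ∀ e, n < e → e < m → IsReaderServerEvent i (act e) →
            e = e₁ ∨ e = e₂ ∨ e = e₃ ∨ e = e₄) ∧
        (i ∉ I → y i = none ∧ ∀ e, n < e → e < m → ¬ IsReaderServerEvent i (act e))

/-- Non-blocking reads. Whenever the server of an object has received a read request, it answers
without any further input: in every fair continuation `γ` of the server automaton on its own that
starts in the server's state just after the receipt and contains no input action, the server sends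
a value to the reader. -/
def NonBlocking {v₀ : ∀ i, V i} (α : (algorithmA l v₀).Fragment) : Prop :=
  ∀ (i : Fin k) (n : ℕ) (κ : Key l),
    α.act n = some (.recv .reader (.server i) (.readValue κ)) →
    ∀ γ : (component (l := l) v₀ (.proc (.server i))).Fragment,
      γ.state 0 = α.state (n + 1) (.proc (.server i)) → γ.Fair →
      (∀ j a, γ.act j = some a → a ∉ (component (l := l) v₀ (.proc (.server i))).input) →
      ∃ j v, γ.act j = some (.send (.server i) .reader (.value i v))

variable (l) in
/-- Transactions can be invoked at any point: after any finite part (the first `N` steps) of any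
well-formed execution, however many transactions are in progress at other clients, each client
without a transaction in progress can invoke any transaction `x` of its kind, and the result can be
continued to a well-formed and fair execution. -/
def InvocableAnytime (v₀ : ∀ i, V i) : Prop :=
  ∀ α : (algorithmA l v₀).Fragment, α.IsExecution → WellFormed α.act →
    ∀ (N : ℕ) (p : Proc k l) (x : Inv V), MayInvoke p x →
      (∀ j, j < N → (α.act j).isSome) →
      (∀ n x', n < N → α.act n = some (.inv p x') → ∃ m, m < N ∧ IsResponse α.act n m) →
      ∃ α' : (algorithmA l v₀).Fragment, α'.IsExecution ∧ WellFormed α'.act ∧ α'.Fair ∧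
        (∀ j, j < N → α'.act j = α.act j) ∧ (∀ j, j ≤ N → α'.state j = α.state j) ∧
        α'.act N = some (.inv p x)

variable (l) in
/-- Wait-freedom: in a well-formed execution that is fair towards the client `p`, the reader, the
servers and the channels, every transaction invoked at `p` completes, no matter how slow the other
writers are, and even if they stop taking steps altogether. -/
def WaitFree (v₀ : ∀ i, V i) : Prop :=
  ∀ α : (algorithmA l v₀).Fragment, α.IsExecution → WellFormed α.act →
    ∀ p : Proc k l,
      α.FairOn {t | ∀ w, t.1 = .proc (.writer w) → .writer w = p} → CompletesAt p α.act

end Properties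

end SNOW

namespace SNOW

namespace IOAutomaton

/-! The order of the transactions is decided at the reader, a single sequential process. A READ
takes effect at its invocation, a WRITE when the reader receives its inform-reader message and
appends its key to the list. Both points lie between invocation and response, since a WRITE responds
only after the acknowledgement of the reader. Let `cur` be the values produced by the WRITEs that
have taken effect so far. The last key in the list for object `i` then designates `cur i`. A writer
informs the reader only after all servers concerned have acknowledged, so this value is stored
before the reader can ask for it. Servers never delete anything, and a key (counter and writer id)
never gets two values at the same object, so the answer to a request is available at once and is
determined. Hence a READ returns the values at its invocation, in one round, and no server has to
wait.

The argument is made formal by history variables (`Ghost`) and an inductive `Invariant`, preserved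
by every step (`Invariant.step`). For messages it says that a client and a target have at most one
message between them, at one of four stages of a request-reply exchange (`LinkActive`).
Serializability follows by listing the events at which transactions take effect in increasing order
(`effect_injective`, `dataType_of_effect`, `strictlySerializable`). The invariant also determines
the events recorded between the reader and each server (`hist_of_busy`, `oneResponse`).

For liveness, fairness carries the single message of a pending exchange from stage to stage
(`replied`), and each reply lowers the number of missing ones. No client waits for another writer,
which is wait-freedom (`waitFree`). To extend a prefix to a fair execution, the system is run
without further invocations. Each step then lowers `weight` (`weight_lt`), so the run stops in a
state in which nothing is enabled, and such a run is fair (`exists_fair_fragment`,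
`invocableAnytime`). -/

theorem compose_enabled {Act : Type u} {ι : Type u} {A : ι → IOAutomaton Act} (hA : Compatible A)
    {s : ∀ i, (A i).State} {i : ι} {a : Act} (ha : a ∈ (A i).output)
    (h : ∃ t, (A i).trans (s i) a t) : ∃ s', (compose A hA).trans s a s' := by
  classical
  have key : ∀ j, ∃ t, (a ∈ (A j).sig → (A j).trans (s j) a t) ∧ (a ∉ (A j).sig → t = s j) := by
    intro j
    by_cases hj : a ∈ (A j).sig
    · by_cases hij : i = j
      · subst hij
        obtain ⟨t, ht⟩ := h
        exact ⟨t, fun _ => ht, fun h' => absurd hj h'⟩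
      -- By compatibility, an output of component `i` can only be an input of any other component,
      -- and inputs are always enabled.
      · have hin : a ∈ (A j).input := by
          rcases hj with (hj | hj) | hj
          · exact hj
          · exact absurd hj (Set.disjoint_left.1 (hA i j hij).1 ha)
          · exact absurd (Or.inl (Or.inr ha)) (Set.disjoint_left.1 (hA j i (Ne.symm hij)).2 hj)
        obtain ⟨t, ht⟩ := (A j).input_enabled (s j) a hin
        exact ⟨t, fun _ => ht, fun h' => absurd hj h'⟩
    · exact ⟨s j, fun h' => absurd h' hj, fun _ => rfl⟩
  choose t ht using key
  exact ⟨t, ⟨i, Or.inl (Or.inr ha)⟩, ht⟩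

end IOAutomaton

/-! ### Transitions of the composed system in terms of single processes and channels -/

section Steps

variable {k l : ℕ} {V : Fin k → Type u} {v₀ : ∀ i, V i}

/-- The local variables of process `p`. -/
def vars (s : (algorithmA l v₀).State) (p : Proc k l) : (program (l := l) v₀ p).Vars :=
  (s (.proc p)).1

/-- The queue of outputs of process `p`. -/
def que (s : (algorithmA l v₀).State) (p : Proc k l) : List (Output V l) :=
  (s (.proc p)).2

/-- The messages in transit from `p` to `q`. -/
def ch (s : (algorithmA l v₀).State) (p q : Proc k l) : Multiset (Msg V l) :=
  s (.chan p q)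

/-- The variables of writer `w`. -/
def wv (s : (algorithmA l v₀).State) (w : Fin l) : WriterVars V l := vars s (.writer w)

/-- The variables of the reader. -/
def rv (s : (algorithmA l v₀).State) : ReaderVars V l := vars s .reader

/-- The set `Vals` of the server of object `i`. -/
def stored (s : (algorithmA l v₀).State) (i : Fin k) : Set (Key l × V i) :=
  (vars s (.server i) : ServerVars V l i).vals

/-- The messages to `q` in a queue of outputs. -/
def msgsTo (q : Proc k l) (Q : List (Output V l)) : List (Msg V l) :=
  Q.filterMap fun o => match o with
    | .send q' m => if q' = q then some m else none
    | .resp _ => none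

/-- The responses in a queue of outputs. -/
def respsOf (Q : List (Output V l)) : List (Resp V) :=
  Q.filterMap fun o => match o with
    | .send _ _ => none
    | .resp y => some y

/-- The messages to `q` in the queue of `p`. -/
def out (s : (algorithmA l v₀).State) (p q : Proc k l) : List (Msg V l) := msgsTo q (que s p)

/-- The responses in the queue of `p`. -/
def rsp (s : (algorithmA l v₀).State) (p : Proc k l) : List (Resp V) := respsOf (que s p)

@[simp] theorem msgsTo_nil (q : Proc k l) : msgsTo (V := V) q [] = [] := rfl
@[simp] theorem respsOf_nil : respsOf (V := V) (l := l) [] = [] := rfl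

theorem msgsTo_append (q : Proc k l) (Q Q' : List (Output V l)) :
    msgsTo q (Q ++ Q') = msgsTo q Q ++ msgsTo q Q' := List.filterMap_append

theorem respsOf_append (Q Q' : List (Output V l)) :
    respsOf (Q ++ Q') = respsOf Q ++ respsOf Q' := List.filterMap_append

@[simp] theorem msgsTo_send_self (q : Proc k l) (m) (Q : List (Output V l)) :
    msgsTo q (.send q m :: Q) = m :: msgsTo q Q := by
  simp [msgsTo]

@[simp] theorem msgsTo_send_ne {q q' : Proc k l} (h : q ≠ q') (m) (Q : List (Output V l)) :
    msgsTo q' (.send q m :: Q) = msgsTo q' Q := by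
  simp [msgsTo, h]

@[simp] theorem msgsTo_resp (q : Proc k l) (y) (Q : List (Output V l)) :
    msgsTo q (.resp y :: Q) = msgsTo q Q := by
  simp [msgsTo]

@[simp] theorem respsOf_send (q : Proc k l) (m) (Q : List (Output V l)) :
    respsOf (.send q m :: Q) = respsOf Q := by
  simp [respsOf]

@[simp] theorem respsOf_resp (y) (Q : List (Output V l)) :
    respsOf (.resp y :: Q) = y :: respsOf Q := by
  simp [respsOf]

theorem mem_msgsTo {q : Proc k l} {m : Msg V l} {Q : List (Output V l)} :
    m ∈ msgsTo q Q ↔ .send q m ∈ Q := by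
  simp only [msgsTo, List.mem_filterMap]
  constructor
  · rintro ⟨o, ho, h⟩
    cases o with
    | send q' m' =>
      simp only [Option.ite_none_right_eq_some, Option.some.injEq] at h
      obtain ⟨rfl, rfl⟩ := h
      exact ho
    | resp y => simp at h
  · intro h
    exact ⟨_, h, by simp⟩

theorem mem_respsOf {y : Resp V} {Q : List (Output V l)} :
    y ∈ respsOf Q ↔ .resp y ∈ Q := by
  simp only [respsOf, List.mem_filterMap]
  constructor
  · rintro ⟨o, ho, h⟩
    cases o with
    | send q' m' => simp at h
    | resp y =>
      simp only [Option.some.injEq] at h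
      subst h
      exact ho
  · intro h
    exact ⟨_, h, by simp⟩

variable {s s' : (algorithmA l v₀).State}

/-- The effect of a handler at `p` with input `e`. -/
structure Handles (s s' : (algorithmA l v₀).State) (p : Proc k l) (e : Input V l)
    (L : List (Output V l)) : Prop where
  next : (vars s' p, L) ∈ (program v₀ p).next (vars s p) e
  que_self : que s' p = que s p ++ L
  vars_ne : ∀ p', p' ≠ p → vars s' p' = vars s p'
  que_ne : ∀ p', p' ≠ p → que s' p' = que s p'

theorem Handles.out_self {p : Proc k l} {e L} (h : Handles s s' p e L) (q) :
    out s' p q = out s p q ++ msgsTo q L := by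
  rw [out, h.que_self, msgsTo_append]; rfl

theorem Handles.out_ne {p : Proc k l} {e L} (h : Handles s s' p e L) {p'} (hp : p' ≠ p) (q) :
    out s' p' q = out s p' q := by
  rw [out, h.que_ne p' hp]; rfl

theorem Handles.rsp_self {p : Proc k l} {e L} (h : Handles s s' p e L) :
    rsp s' p = rsp s p ++ respsOf L := by
  rw [rsp, h.que_self, respsOf_append]; rfl

theorem Handles.rsp_ne {p : Proc k l} {e L} (h : Handles s s' p e L) {p'} (hp : p' ≠ p) :
    rsp s' p' = rsp s p' := by
  rw [rsp, h.que_ne p' hp]; rfl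

/-- The emission of the head `o` of the queue of `p`. -/
structure Emits (s s' : (algorithmA l v₀).State) (p : Proc k l) (o : Output V l) : Prop where
  que_self : que s p = o :: que s' p
  vars_eq : ∀ p', vars s' p' = vars s p'
  que_ne : ∀ p', p' ≠ p → que s' p' = que s p'

/-- All channels but the one from `p` to `q` keep their contents. -/
def ChFrame (s s' : (algorithmA l v₀).State) (p q : Proc k l) : Prop :=
  ∀ p' q', (p', q') ≠ (p, q) → ch s' p' q' = ch s p' q'

/-- Only process `p` and the channel from `p` to `q` have this action in their signature; the
composition freezes all other components. -/
theorem trans_send {p q : Proc k l} {m} (h : (algorithmA l v₀).trans s (.send p q m) s') :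
    Emits s s' p (.send q m) ∧ ch s' p q = m ::ₘ ch s p q ∧ ChFrame s s' p q := by
  have hp := (h.2 (.proc p)).1 (Or.inl (Or.inr (Or.inl ⟨q, m, rfl⟩)))
  have hc := (h.2 (.chan p q)).1 (Or.inl (Or.inl ⟨m, rfl⟩))
  have hne : ∀ p', p' ≠ p → s' (.proc p') = s (.proc p') := by
    intro p' hp'
    refine (h.2 (.proc p')).2 ?_
    rintro (((⟨x, -, h⟩ | ⟨q, m, h⟩) | ⟨q, m, h⟩ | ⟨y, h⟩) | h) <;> cases h
    exact hp' rfl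
  have hp2 : (s' (.proc p)).1 = (s (.proc p)).1 ∧
      (s (.proc p)).2 = .send q m :: (s' (.proc p)).2 := by
    rcases hp with ⟨x, -, h, -⟩ | ⟨q, m, h, -⟩ | ⟨q, m, h, h1, h2⟩ | ⟨y, h, -⟩ <;> cases h
    exact ⟨h1, h2⟩
  refine ⟨⟨hp2.2, ?_, ?_⟩, ?_, ?_⟩
  · intro p'
    by_cases hp' : p' = p
    · subst hp'; exact hp2.1
    · simp only [vars, hne p' hp']
  · intro p' hp'
    simp only [que, hne p' hp']
  · rcases hc with ⟨m, h, h1⟩ | ⟨m, h, h1⟩ <;> cases h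
    exact h1
  · intro p' q' hpq
    refine (h.2 (.chan p' q')).2 ?_
    rintro ((⟨m, h⟩ | ⟨m, h⟩) | h) <;> cases h
    exact hpq rfl

theorem trans_resp {p : Proc k l} {y} (h : (algorithmA l v₀).trans s (.resp p y) s') :
    Emits s s' p (.resp y) ∧ ch s' = ch s := by
  have hp := (h.2 (.proc p)).1 (Or.inl (Or.inr (Or.inr ⟨y, rfl⟩)))
  have hne : ∀ p', p' ≠ p → s' (.proc p') = s (.proc p') := by
    intro p' hp'
    refine (h.2 (.proc p')).2 ?_
    rintro (((⟨x, -, h⟩ | ⟨q, m, h⟩) | ⟨q, m, h⟩ | ⟨y, h⟩) | h) <;> cases h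
    exact hp' rfl
  have hp2 : (s' (.proc p)).1 = (s (.proc p)).1 ∧
      (s (.proc p)).2 = .resp y :: (s' (.proc p)).2 := by
    rcases hp with ⟨x, -, h, -⟩ | ⟨q, m, h, -⟩ | ⟨q, m, h, -⟩ | ⟨y, h, h1, h2⟩ <;> cases h
    exact ⟨h1, h2⟩
  refine ⟨⟨hp2.2, ?_, ?_⟩, ?_⟩
  · intro p'
    by_cases hp' : p' = p
    · subst hp'; exact hp2.1
    · simp only [vars, hne p' hp']
  · intro p' hp'
    simp only [que, hne p' hp']
  · funext p' q'
    refine (h.2 (.chan p' q')).2 ?_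
    rintro ((⟨m, h⟩ | ⟨m, h⟩) | h) <;> cases h

theorem trans_recv {p q : Proc k l} {m} (h : (algorithmA l v₀).trans s (.recv p q m) s') :
    ∃ L, Handles s s' q (.recv p m) L ∧ ch s p q = m ::ₘ ch s' p q ∧ ChFrame s s' p q := by
  have hp := (h.2 (.proc q)).1 (Or.inl (Or.inl (Or.inr ⟨p, m, rfl⟩)))
  have hc := (h.2 (.chan p q)).1 (Or.inl (Or.inr ⟨m, rfl⟩))
  have hne : ∀ p', p' ≠ q → s' (.proc p') = s (.proc p') := by
    intro p' hp'
    refine (h.2 (.proc p')).2 ?_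
    rintro (((⟨x, -, h⟩ | ⟨q, m, h⟩) | ⟨q, m, h⟩ | ⟨y, h⟩) | h) <;> cases h
    exact hp' rfl
  have hp2 : ∃ r ∈ (program v₀ q).next (s (.proc q)).1 (.recv p m),
      s' (.proc q) = (r.1, (s (.proc q)).2 ++ r.2) := by
    rcases hp with ⟨x, -, h, -⟩ | ⟨q, m, h, h1⟩ | ⟨q, m, h, -⟩ | ⟨y, h, -⟩ <;> cases h
    exact h1
  obtain ⟨⟨r, L⟩, hr, hs⟩ := hp2
  refine ⟨L, ⟨?_, ?_, ?_, ?_⟩, ?_, ?_⟩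
  · simpa only [vars, hs] using hr
  · simp only [que, hs]
  · intro p' hp'
    simp only [vars, hne p' hp']
  · intro p' hp'
    simp only [que, hne p' hp']
  · rcases hc with ⟨m, h, h1⟩ | ⟨m, h, h1⟩ <;> cases h
    exact h1
  · intro p' q' hpq
    refine (h.2 (.chan p' q')).2 ?_
    rintro ((⟨m, h⟩ | ⟨m, h⟩) | h) <;> cases h
    exact hpq rfl

theorem trans_inv {p : Proc k l} {x} (h : (algorithmA l v₀).trans s (.inv p x) s') :
    MayInvoke p x ∧ (∃ L, Handles s s' p (.inv x) L) ∧ ch s' = ch s := by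
  -- An invocation that violates `MayInvoke` lies in no signature, so the composition cannot perform
  -- it.
  have hx : MayInvoke p x := by
    obtain ⟨c, hc⟩ := h.1
    cases c with
    | proc p' =>
      rcases hc with ((⟨x, hx, h⟩ | ⟨q, m, h⟩) | ⟨q, m, h⟩ | ⟨y, h⟩) | h <;> cases h
      exact hx
    | chan p' q' => rcases hc with (⟨m, h⟩ | ⟨m, h⟩) | h <;> cases h
  have hp := (h.2 (.proc p)).1 (Or.inl (Or.inl (Or.inl ⟨x, hx, rfl⟩)))
  have hne : ∀ p', p' ≠ p → s' (.proc p') = s (.proc p') := by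
    intro p' hp'
    refine (h.2 (.proc p')).2 ?_
    rintro (((⟨x, -, h⟩ | ⟨q, m, h⟩) | ⟨q, m, h⟩ | ⟨y, h⟩) | h) <;> cases h
    exact hp' rfl
  have hp2 : ∃ r ∈ (program v₀ p).next (s (.proc p)).1 (.inv x),
      s' (.proc p) = (r.1, (s (.proc p)).2 ++ r.2) := by
    rcases hp with ⟨x, -, h, h1⟩ | ⟨q, m, h, -⟩ | ⟨q, m, h, -⟩ | ⟨y, h, -⟩ <;> cases h
    exact h1
  obtain ⟨⟨r, L⟩, hr, hs⟩ := hp2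
  refine ⟨hx, ⟨L, ?_, ?_, ?_, ?_⟩, ?_⟩
  · simpa only [vars, hs] using hr
  · simp only [que, hs]
  · intro p' hp'
    simp only [vars, hne p' hp']
  · intro p' hp'
    simp only [que, hne p' hp']
  · funext p' q'
    refine (h.2 (.chan p' q')).2 ?_
    rintro ((⟨m, h⟩ | ⟨m, h⟩) | h) <;> cases h

theorem Emits.out_send {p q : Proc k l} {m} (h : Emits s s' p (.send q m)) :
    out s p q = m :: out s' p q := by
  rw [out, h.que_self, msgsTo_send_self]; rfl

theorem Emits.out_send_ne {p q q' p' : Proc k l} {m} (h : Emits s s' p (.send q m))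
    (hne : (p', q') ≠ (p, q)) : out s' p' q' = out s p' q' := by
  by_cases hp : p' = p
  · subst hp
    rw [out, out, h.que_self, msgsTo_send_ne]
    rintro rfl
    exact hne rfl
  · rw [out, out, h.que_ne p' hp]

theorem Emits.rsp_send {p q : Proc k l} {m} (h : Emits s s' p (.send q m)) (p') :
    rsp s' p' = rsp s p' := by
  by_cases hp : p' = p
  · subst hp
    rw [rsp, rsp, h.que_self, respsOf_send]
  · rw [rsp, rsp, h.que_ne p' hp]

theorem Emits.out_resp {p : Proc k l} {y} (h : Emits s s' p (.resp y)) (p' q') :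
    out s' p' q' = out s p' q' := by
  by_cases hp : p' = p
  · subst hp
    rw [out, out, h.que_self, msgsTo_resp]
  · rw [out, out, h.que_ne p' hp]

theorem Emits.rsp_resp {p : Proc k l} {y} (h : Emits s s' p (.resp y)) :
    rsp s p = y :: rsp s' p := by
  rw [rsp, h.que_self, respsOf_resp]; rfl

theorem Emits.rsp_ne {p : Proc k l} {o} (h : Emits s s' p o) {p'} (hp : p' ≠ p) :
    rsp s' p' = rsp s p' := by
  rw [rsp, rsp, h.que_ne p' hp]

end Steps

/-! ### Request-reply exchanges with a single message -/

section Link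

variable {M : Type u}

/-- No message of a request-reply exchange is pending. -/
def LinkIdle (A : List M) (B : Multiset M) (C : List M) (D : Multiset M) : Prop :=
  A = [] ∧ B = 0 ∧ C = [] ∧ D = 0

/-- A request-reply exchange is in progress: there is one message, which is in the queue of the
client, in the channel to the target, in the queue of the target or in the channel back. -/
def LinkActive (P : ℕ → M → Prop) (A : List M) (B : Multiset M) (C : List M) (D : Multiset M) :
    Prop :=
  (∃ m, P 0 m ∧ A = [m] ∧ B = 0 ∧ C = [] ∧ D = 0) ∨
  (∃ m, P 1 m ∧ A = [] ∧ B = {m} ∧ C = [] ∧ D = 0) ∨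
  (∃ m, P 2 m ∧ A = [] ∧ B = 0 ∧ C = [m] ∧ D = 0) ∨
  (∃ m, P 3 m ∧ A = [] ∧ B = 0 ∧ C = [] ∧ D = {m})

variable {P P' : ℕ → M → Prop} {A C : List M} {B D : Multiset M} {m : M}

theorem cons_eq_singleton {a b : M} {B : Multiset M} : a ::ₘ B = {b} ↔ a = b ∧ B = 0 := by
  rw [← Multiset.cons_zero, Multiset.cons_eq_cons]
  simp

theorem LinkActive.mono (h : LinkActive P A B C D) (hP : ∀ t m, P t m → P' t m) :
    LinkActive P' A B C D := by
  rcases h with ⟨m, h, h'⟩ | ⟨m, h, h'⟩ | ⟨m, h, h'⟩ | ⟨m, h, h'⟩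
  · exact Or.inl ⟨m, hP _ _ h, h'⟩
  · exact Or.inr (Or.inl ⟨m, hP _ _ h, h'⟩)
  · exact Or.inr (Or.inr (Or.inl ⟨m, hP _ _ h, h'⟩))
  · exact Or.inr (Or.inr (Or.inr ⟨m, hP _ _ h, h'⟩))

/-- The place of a message determines the stage of its exchange, because every other place is empty.
This lemma and the next three therefore describe how sends and receipts move an exchange from stage
0 to 1, out of 1, from 2 to 3, and out of 3. -/
theorem LinkActive.send_request (h : LinkActive P (m :: A) B C D) (hP : P 0 m → P' 1 m) :
    LinkActive P' A (m ::ₘ B) C D := by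
  rcases h with ⟨m, h, hA, hB, h'⟩ | ⟨m, h, hA, h'⟩ | ⟨m, h, hA, h'⟩ | ⟨m, h, hA, h'⟩ <;> cases hA
  exact Or.inr (Or.inl ⟨m, hP h, rfl, by simp [hB], h'⟩)

theorem LinkActive.recv_request (h : LinkActive P A (m ::ₘ B) C D) :
    P 1 m ∧ A = [] ∧ B = 0 ∧ C = [] ∧ D = 0 := by
  rcases h with ⟨m, h, hA, hB, h'⟩ | ⟨m, h, hA, hB, h'⟩ | ⟨m, h, hA, hB, h'⟩ | ⟨m, h, hA, hB, h'⟩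
  · simp at hB
  · obtain ⟨rfl, hB'⟩ := cons_eq_singleton.1 hB
    exact ⟨h, hA, hB', h'⟩
  · simp at hB
  · simp at hB

theorem LinkActive.send_reply (h : LinkActive P A B (m :: C) D) (hP : P 2 m → P' 3 m) :
    LinkActive P' A B C (m ::ₘ D) := by
  rcases h with ⟨m, h, hA, hB, hC, h'⟩ | ⟨m, h, hA, hB, hC, h'⟩ | ⟨m, h, hA, hB, hC, h'⟩ |
    ⟨m, h, hA, hB, hC, h'⟩ <;> cases hC
  exact Or.inr (Or.inr (Or.inr ⟨m, hP h, hA, hB, rfl, by simp [h']⟩))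

theorem LinkActive.recv_reply (h : LinkActive P A B C (m ::ₘ D)) :
    P 3 m ∧ LinkIdle A B C D := by
  rcases h with ⟨m, h, hA, hB, hC, h'⟩ | ⟨m, h, hA, hB, hC, h'⟩ | ⟨m, h, hA, hB, hC, h'⟩ |
    ⟨m, h, hA, hB, hC, h'⟩
  · simp at h'
  · simp at h'
  · simp at h'
  · obtain ⟨rfl, hD⟩ := cons_eq_singleton.1 h'
    exact ⟨h, hA, hB, hC, hD⟩

end Link

/-! ### History variables, the invariant, and its preservation by sends and responses -/

section Ghost

variable {k l : ℕ} {V : Fin k → Type u} {v₀ : ∀ i, V i}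

/-- History variables: the transaction in progress at each client (with the position of its
invocation), the position at which it took effect, the current values of the objects, their values
at the last invocation of a `READ`, and the messages exchanged by the reader with each process
since then. -/
structure Ghost {k : ℕ} (V : Fin k → Type u) (l : ℕ) where
  busy : Proc k l → Option (ℕ × Inv V)
  done : Proc k l → Option ℕ
  cur : ∀ i, V i
  snap : ∀ i, V i
  hist : Proc k l → List (ℕ × Act V l)

/-- Append the event `e` of the channel from `p` to `q` to the history of the reader. -/
def record (h : Proc k l → List (ℕ × Act V l)) (p q : Proc k l) (e : ℕ × Act V l) :
    Proc k l → List (ℕ × Act V l) :=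
  if p = .reader then Function.update h q (h q ++ [e])
  else if q = .reader then Function.update h p (h p ++ [e]) else h

/-- Update of the history variables by the event `n`. -/
def gstep (g : Ghost V l) (n : ℕ) : Act V l → Ghost V l
  | .inv p x =>
    { busy := Function.update g.busy p (some (n, x))
      done := Function.update g.done p none
      cur := g.cur
      -- The READ takes effect here; the values it has to return are frozen.
      snap := if p = .reader then g.cur else g.snap
      hist := if p = .reader then fun _ => [] else g.hist }
  | .resp p _ => { g with busy := Function.update g.busy p none }
  | .send p q m => { g with hist := record g.hist p q (n, .send p q m) }
  -- The WRITE takes effect here, at the moment at which the reader appends its key to the list.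
  | .recv (.writer w) .reader (.informReader _ _) =>
    { g with
      done := Function.update g.done (.writer w) (some n)
      cur := match g.busy (.writer w) with
        | some (_, x) => (dataType x g.cur).2
        | none => g.cur }
  | .recv p q m => { g with hist := record g.hist p q (n, .recv p q m) }

/-- The four events of a round of the reader with the server of object `i`. -/
def round (i : Fin k) (κ : Key l) (v : V i) : List (Act V l) :=
  [.send .reader (.server i) (.readValue κ), .recv .reader (.server i) (.readValue κ),
    .send (.server i) .reader (.value i v), .recv (.server i) .reader (.value i v)]

/-- The messages exchanged with the server of object `i` since the last `READ` began. -/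
def Ghost.rounds (g : Ghost V l) (i : Fin k) : List (Act V l) :=
  (g.hist (.server i)).map Prod.snd

/-- The key of the last `WRITE` of writer `w`. -/
def wkey (s : (algorithmA l v₀).State) (w : Fin l) : Key l := ((wv s w).z, some w)

/-- Client `p` sends requests to `q`. -/
inductive IsLink : Proc k l → Proc k l → Prop
  | writer_server (w i) : IsLink (.writer w) (.server i)
  | writer_reader (w) : IsLink (.writer w) .reader
  | reader_server (i) : IsLink .reader (.server i)

/-- The specification of the message of an exchange in its stages `t = 0, 1, 2, 3`. -/
def Tok (s : (algorithmA l v₀).State) (g : Ghost V l) :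
    Proc k l → Proc k l → ℕ → Msg V l → Prop
  | .writer w, .server i, t, m => ∃ n u hu v, g.busy (.writer w) = some (n, .write u hu) ∧
      u i = some v ∧ (t < 2 → m = .writeValue (wkey s w) i v) ∧
      (2 ≤ t → m = .ack ∧ (wkey s w, v) ∈ stored s i)
  -- The receipt by the reader separates stages 1 and 2, so `done` is unset before it and set after
  -- it. This is why no WRITE takes effect twice.
  | .writer w, .reader, t, m => ∃ n u hu, g.busy (.writer w) = some (n, .write u hu) ∧
      (t < 2 → m = .informReader (wkey s w) (fun j => (u j).isSome) ∧
        g.done (.writer w) = none) ∧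
      (2 ≤ t → (∃ j, m = .ackTag j) ∧ g.done (.writer w) ≠ none)
  -- In stage `t` exactly the first `t` of the four events of the round have occurred.
  | .reader, .server i, t, m => ∃ κ, g.rounds i = (round i κ (g.snap i)).take t ∧
      (κ, g.snap i) ∈ stored s i ∧
      (t < 2 → m = .readValue κ) ∧ (2 ≤ t → m = .value i (g.snap i))
  | _, _, _, _ => False

/-- The servers whose acknowledgement a writer awaits. -/
def unacked : WriterPhase V l → Finset (Fin k)
  | .writeValue _ _ S => S
  | _ => ∅

/-- The client awaits a reply of the target. -/
def Pending (s : (algorithmA l v₀).State) : Proc k l → Proc k l → Prop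
  | .writer w, .server i => i ∈ unacked (wv s w).phase
  | .writer w, .reader => (wv s w).phase = .informReader
  | .reader, .server i => ∃ I y, (rv s).phase = some (I, y) ∧ i ∈ I ∧ y i = none
  | _, _ => False

/-- What is known of an exchange that is not in progress. -/
def Settled (g : Ghost V l) : Proc k l → Proc k l → Prop
  | .reader, .server i => ∀ n I hI, g.busy .reader = some (n, .read I hI) →
      (i ∈ I → ∃ κ, g.rounds i = round i κ (g.snap i)) ∧ (i ∉ I → g.rounds i = [])
  | _, _ => True

/-- The invariant of the exchange between client `p` and target `q`. -/
structure LinkInv (s : (algorithmA l v₀).State) (g : Ghost V l) (p q : Proc k l) : Prop where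
  active : Pending s p q →
    LinkActive (Tok s g p q) (out s p q) (ch s p q) (out s q p) (ch s q p)
  idle : ¬ Pending s p q → LinkIdle (out s p q) (ch s p q) (out s q p) (ch s q p)
  settled : ¬ Pending s p q → Settled g p q

/-- The control states of a writer. -/
inductive WriterCtl (S : ∀ i, Set (Key l × V i)) (κ : Key l) :
    WriterPhase V l → Option (ℕ × Inv V) → List (Resp V) → Option ℕ → Prop
  | idle d : WriterCtl S κ .idle none [] d
  | writing (n u hu R) : R.Nonempty → (∀ i v, u i = some v → i ∉ R → (κ, v) ∈ S i) →
      WriterCtl S κ (.writeValue κ u R) (some (n, .write u hu)) [] none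
  -- All values are stored before the reader is informed. `d` is arbitrary because the reader may or
  -- may not have received the message yet; once the writer is responding, it has.
  | informing (n u hu d) : (∀ i v, u i = some v → (κ, v) ∈ S i) →
      WriterCtl S κ .informReader (some (n, .write u hu)) [] d
  | responding (n u hu d) : d ≠ none → WriterCtl S κ .idle (some (n, .write u hu)) [.ok] d

/-- The control states of the reader. -/
inductive ReaderCtl (x : ∀ i, V i) :
    Option (Finset (Fin k) × (∀ i, Option (V i))) → Option (ℕ × Inv V) → List (Resp V) → Prop
  | idle : ReaderCtl x none none []
  | reading (n I hI y) : (∃ i ∈ I, y i = none) →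
      (∀ i, y i = none ∨ i ∈ I ∧ y i = some (x i)) →
      ReaderCtl x (some (I, y)) (some (n, .read I hI)) []
  | responding (n I hI) :
      ReaderCtl x none (some (n, .read I hI)) [.vals fun i => if i ∈ I then some (x i) else none]

/-- The invariant of Algorithm A. -/
structure Invariant (s : (algorithmA l v₀).State) (g : Ghost V l) : Prop where
  link : ∀ p q, IsLink p q → LinkInv s g p q
  writer : ∀ w, WriterCtl (stored s) (wkey s w) (wv s w).phase (g.busy (.writer w))
    (rsp s (.writer w)) (g.done (.writer w))
  reader : ReaderCtl g.snap (rv s).phase (g.busy .reader) (rsp s .reader)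
  -- `list` says that the keys a READ would request now lead to the current values. `unique` makes
  -- the choice of a server among the values of a key irrelevant. `bound` makes the next key of each
  -- writer fresh, and `own` is what keeps `unique` inductive while a WRITE is being stored.
  list : ∀ i, (latestKey (rv s).list i, g.cur i) ∈ stored s i
  unique : ∀ i κ v v', (κ, v) ∈ stored s i → (κ, v') ∈ stored s i → v = v'
  bound : ∀ i z w v, ((z, some w), v) ∈ stored s i → z ≤ (wv s w).z
  own : ∀ w n u hu, g.busy (.writer w) = some (n, .write u hu) →
    ∀ i v, (wkey s w, v) ∈ stored s i → u i = some v

variable {s s' : (algorithmA l v₀).State} {g g' : Ghost V l}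

/-- An exchange depends only on its own queues and channels and on a few variables of its client.
The sets `stored` need only grow, since the invariant of an exchange merely asserts membership in
them. -/
theorem LinkInv.frame {p q : Proc k l} (h : LinkInv s g p q) (hl : IsLink p q)
    (hA : out s' p q = out s p q) (hB : ch s' p q = ch s p q)
    (hC : out s' q p = out s q p) (hD : ch s' q p = ch s q p)
    (hP : Pending s' p q ↔ Pending s p q)
    (hz : ∀ w, p = .writer w → (wv s' w).z = (wv s w).z)
    (hb : g'.busy p = g.busy p) (hd : q = .reader → g'.done p = g.done p)
    (hs : ∀ i, stored s i ⊆ stored s' i)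
    (hr : p = .reader → g'.snap = g.snap ∧ g'.hist q = g.hist q) : LinkInv s' g' p q := by
  constructor
  · intro hp
    rw [hA, hB, hC, hD]
    refine (h.active (hP.1 hp)).mono fun t m => ?_
    cases hl with
    | writer_server w i =>
      have hk : wkey s' w = wkey s w := by rw [wkey, hz w rfl]; rfl
      rintro ⟨n, u, hu, v, h1, h2, h3, h4⟩
      exact ⟨n, u, hu, v, by rw [hb, h1], h2, by rwa [hk],
        by rw [hk]; exact fun ht => ⟨(h4 ht).1, hs i (h4 ht).2⟩⟩
    | writer_reader w =>
      have hk : wkey s' w = wkey s w := by rw [wkey, hz w rfl]; rfl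
      rintro ⟨n, u, hu, h1, h2, h3⟩
      exact ⟨n, u, hu, by rw [hb, h1], by rwa [hk, hd rfl], by rwa [hd rfl]⟩
    | reader_server i =>
      obtain ⟨h1, h2⟩ := hr rfl
      rintro ⟨κ, h3, h4, h5⟩
      refine ⟨κ, ?_, ?_, ?_⟩
      · rw [Ghost.rounds, h2, h1]; exact h3
      · rw [h1]; exact hs i h4
      · rw [h1]; exact h5
  · intro hp
    rw [hA, hB, hC, hD]
    exact h.idle (mt hP.2 hp)
  · intro hp
    have := h.settled (mt hP.2 hp)
    cases hl with
    | writer_server w i => trivial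
    | writer_reader w => trivial
    | reader_server i =>
      obtain ⟨h1, h2⟩ := hr rfl
      simp only [Settled, Ghost.rounds] at this ⊢
      rwa [h1, h2, hb]

theorem pending_congr {p q : Proc k l} (h : vars s' p = vars s p) :
    Pending s' p q ↔ Pending s p q := by
  cases p <;> cases q <;> simp only [Pending, wv, rv, h]

theorem wv_congr {w : Fin l} (h : vars s' (.writer w) = vars s (.writer w)) :
    wv s' w = wv s w := h

theorem stored_congr {i : Fin k} (h : vars s' (.server i) = vars s (.server i)) :
    stored s' i = stored s i := by rw [stored, h]; rfl

theorem WriterCtl.mono {S S' : ∀ i, Set (Key l × V i)} {κ : Key l} {φ b r d}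
    (h : WriterCtl S κ φ b r d) (hS : ∀ i, S i ⊆ S' i) : WriterCtl S' κ φ b r d := by
  cases h with
  | idle d => exact .idle d
  | writing n u hu R h1 h2 => exact .writing n u hu R h1 fun i v h3 h4 => hS i (h2 i v h3 h4)
  | informing n u hu d h1 => exact .informing n u hu d fun i v h3 => hS i (h1 i v h3)
  | responding n u hu d h => exact .responding n u hu d h

theorem WriterCtl.of_cons {S : ∀ i, Set (Key l × V i)} {κ : Key l} {φ b y r d}
    (h : WriterCtl S κ φ b (y :: r) d) : φ = .idle ∧ r = [] ∧ y = .ok ∧ d ≠ none ∧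
      ∃ n u hu, b = some (n, .write u hu) := by
  cases h with
  | responding n u hu d h => exact ⟨rfl, rfl, rfl, h, n, u, hu, rfl⟩

theorem WriterCtl.of_none {S : ∀ i, Set (Key l × V i)} {κ : Key l} {φ r d}
    (h : WriterCtl S κ φ none r d) : φ = .idle ∧ r = [] := by
  cases h
  exact ⟨rfl, rfl⟩

theorem WriterCtl.of_writeValue {S : ∀ i, Set (Key l × V i)} {κ κ' : Key l} {b r d u R}
    (h : WriterCtl S κ (.writeValue κ' u R) b r d) : κ' = κ ∧ r = [] ∧ d = none ∧ R.Nonempty ∧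
      (∃ n hu, b = some (n, .write u hu)) ∧ ∀ i v, u i = some v → i ∉ R → (κ, v) ∈ S i := by
  cases h with
  | writing n u hu R h1 h2 => exact ⟨rfl, rfl, rfl, h1, ⟨n, hu, rfl⟩, h2⟩

theorem WriterCtl.of_informReader {S : ∀ i, Set (Key l × V i)} {κ : Key l} {b r d}
    (h : WriterCtl S κ .informReader b r d) : r = [] ∧
      ∃ n u hu, b = some (n, .write u hu) ∧ ∀ i v, u i = some v → (κ, v) ∈ S i := by
  cases h with
  | informing n u hu d h => exact ⟨rfl, n, u, hu, rfl, h⟩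

theorem ReaderCtl.of_cons {x : ∀ i, V i} {φ b y r} (h : ReaderCtl x φ b (y :: r)) :
    φ = none ∧ r = [] ∧ ∃ n I hI, b = some (n, .read I hI) ∧
      y = .vals fun i => if i ∈ I then some (x i) else none := by
  cases h with
  | responding n I hI => exact ⟨rfl, rfl, n, I, hI, rfl, rfl⟩

theorem ReaderCtl.of_none {x : ∀ i, V i} {φ r} (h : ReaderCtl x φ none r) :
    φ = none ∧ r = [] := by
  cases h
  exact ⟨rfl, rfl⟩

theorem ReaderCtl.of_some {x : ∀ i, V i} {I y b r} (h : ReaderCtl x (some (I, y)) b r) :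
    r = [] ∧ (∃ i ∈ I, y i = none) ∧ (∀ i, y i = none ∨ i ∈ I ∧ y i = some (x i)) ∧
      ∃ n hI, b = some (n, .read I hI) := by
  cases h with
  | reading n I hI y h1 h2 => exact ⟨rfl, h1, h2, n, hI, rfl⟩

theorem IsLink.not_symm {p q : Proc k l} (h : IsLink p q) : ¬ IsLink q p := by
  intro h'
  cases h <;> cases h'

/-- No ordered pair of processes serves both for requests and for replies, so a channel determines
the role of its messages. -/
theorem IsLink.asymm {p q p' q' : Proc k l} (h : IsLink p q) (h' : IsLink p' q') :
    (q, p) ≠ (p', q') := by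
  rintro h''
  cases h''
  exact h.not_symm h'

/-- The part of the invariant that is not about messages in transit depends only on the local
variables, the responses, and some history variables. -/
theorem Invariant.frame (h : Invariant s g) (hlink : ∀ p q, IsLink p q → LinkInv s' g' p q)
    (hv : ∀ p, vars s' p = vars s p) (hr : ∀ p, rsp s' p = rsp s p)
    (hb : g'.busy = g.busy) (hd : g'.done = g.done) (hc : g'.cur = g.cur)
    (hs : g'.snap = g.snap) : Invariant s' g' := by
  have hw : ∀ w, wv s' w = wv s w := fun w => hv (.writer w)
  have hrd : rv s' = rv s := hv .reader
  have hst : stored s' = stored s := funext fun i => stored_congr (hv (.server i))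
  have hk : ∀ w, wkey s' w = wkey s w := fun w => by rw [wkey, hw]; rfl
  refine ⟨hlink, fun w => ?_, ?_, ?_, ?_, ?_, ?_⟩
  · rw [hst, hk, hw, hb, hr, hd]; exact h.writer w
  · rw [hs, hrd, hb, hr]; exact h.reader
  · rw [hrd, hc, hst]; exact h.list
  · rw [hst]; exact h.unique
  · simp only [hst, hw]; exact h.bound
  · simp only [hst, hk, hb]; exact h.own

theorem record_ne {h : Proc k l → List (ℕ × Act V l)} {p q q' : Proc k l} {e : ℕ × Act V l}
    (h1 : (p, q) ≠ (.reader, q')) (h2 : (p, q) ≠ (q', .reader)) : record h p q e q' = h q' := by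
  unfold record
  split_ifs with hp hq
  · subst hp
    exact Function.update_of_ne (fun hh => h1 (by rw [hh])) _ _
  · subst hq
    exact Function.update_of_ne (fun hh => h2 (by rw [hh])) _ _
  · rfl

/-- Emitting a message advances at most one exchange, from stage 0 to 1 or from 2 to 3, and leaves
local variables and pending responses alone. -/
theorem Invariant.send {p q : Proc k l} {m : Msg V l} {n : ℕ} (h : Invariant s g)
    (ht : (algorithmA l v₀).trans s (.send p q m) s') :
    Invariant s' (gstep g n (.send p q m)) := by
  obtain ⟨he, hch, hcf⟩ := trans_send ht
  refine h.frame ?_ he.vars_eq he.rsp_send rfl rfl rfl rfl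
  intro p' q' hl
  have hst : ∀ i, stored s' i = stored s i := fun i => stored_congr (he.vars_eq (.server i))
  have hk : ∀ w, wkey s' w = wkey s w := fun w => by rw [wkey, wv_congr (he.vars_eq _)]; rfl
  have hP := pending_congr (q := q') (he.vars_eq p')
  by_cases h1 : (p', q') = (p, q)
  · cases h1
    have h2 : (q, p) ≠ (p, q) := hl.asymm hl
    have hp : Pending s p q := by
      by_contra hp
      have := ((h.link p q hl).idle hp).1
      rw [he.out_send] at this
      cases this
    have ha := (h.link p q hl).active hp
    rw [he.out_send, ← he.out_send_ne h2, ← hcf q p h2] at ha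
    refine ⟨fun _ => ?_, fun h' => absurd (hP.2 hp) h', fun h' => absurd (hP.2 hp) h'⟩
    rw [hch]
    refine ha.send_request ?_
    cases hl with
    | writer_server w i =>
      rintro ⟨n, u, hu, v, h1, h2, h3, h4⟩
      exact ⟨n, u, hu, v, h1, h2, by simpa [hk] using h3, by simp⟩
    | writer_reader w =>
      rintro ⟨n, u, hu, h1, h2, h3⟩
      exact ⟨n, u, hu, h1, by simpa [hk, gstep] using h2, by simp⟩
    | reader_server i =>
      rintro ⟨κ, h3, h4, h5, h6⟩
      have h5 := h5 (by norm_num)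
      subst h5
      refine ⟨κ, ?_, by rw [hst]; exact h4, fun _ => rfl, by simp⟩
      -- The recorded event extends `take 0` of the round to `take 1`.
      simpa [Ghost.rounds, gstep, record, round] using h3
  by_cases h2 : (q', p') = (p, q)
  · cases h2
    have h2 : (q, p) ≠ (p, q) := h1
    have hp : Pending s q p := by
      by_contra hp
      have := ((h.link q p hl).idle hp).2.2.1
      rw [he.out_send] at this
      cases this
    have ha := (h.link q p hl).active hp
    rw [he.out_send, ← he.out_send_ne h2, ← hcf q p h2] at ha
    refine ⟨fun _ => ?_, fun h' => absurd (hP.2 hp) h', fun h' => absurd (hP.2 hp) h'⟩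
    rw [hch]
    refine ha.send_reply ?_
    cases hl with
    | writer_server w i =>
      rintro ⟨n, u, hu, v, h1, h2, h3, h4⟩
      exact ⟨n, u, hu, v, h1, h2, by simp, by simpa [hk, hst] using h4⟩
    | writer_reader w =>
      rintro ⟨n, u, hu, h1, h2, h3⟩
      exact ⟨n, u, hu, h1, by simp, by simpa [gstep] using h3⟩
    | reader_server i =>
      rintro ⟨κ, h3, h4, h5, h6⟩
      have h6 := h6 (by norm_num)
      subst h6
      refine ⟨κ, ?_, by rw [hst]; exact h4, by simp, fun _ => rfl⟩
      simp only [Ghost.rounds, gstep, record, round] at h3 ⊢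
      simp [h3]
  · refine (h.link p' q' hl).frame hl (he.out_send_ne h1) (hcf _ _ h1) (he.out_send_ne h2)
      (hcf _ _ h2) hP (fun w hw => by rw [wv_congr (he.vars_eq _)]) rfl (fun _ => rfl)
      (fun i => (hst i).ge) ?_
    rintro rfl
    exact ⟨rfl, record_ne (Ne.symm h1) (Ne.symm h2)⟩

theorem Invariant.resp {p : Proc k l} {y : Resp V} {n : ℕ} (h : Invariant s g)
    (ht : (algorithmA l v₀).trans s (.resp p y) s') :
    Invariant s' (gstep g n (.resp p y)) := by
  obtain ⟨he, hch⟩ := trans_resp ht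
  have hst : stored s' = stored s := funext fun i => stored_congr (he.vars_eq (.server i))
  have hk : ∀ w, wkey s' w = wkey s w := fun w => by rw [wkey, wv_congr (he.vars_eq _)]; rfl
  have hw : ∀ w, wv s' w = wv s w := fun w => he.vars_eq (.writer w)
  have hrd : rv s' = rv s := he.vars_eq .reader
  refine ⟨fun p' q' hl => ?_, fun w => ?_, ?_, ?_, ?_, ?_, ?_⟩
  · have hP := pending_congr (q := q') (he.vars_eq p')
    by_cases hp : p' = p
    · subst hp
      -- A queued response puts the client in its control state `responding`, in which it awaits no
      -- reply.
      have hp : ¬ Pending s p' q' := by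
        intro hp
        cases hl with
        | writer_server w i =>
          have h1 := h.writer w
          rw [he.rsp_resp] at h1
          simp only [Pending] at hp
          rw [h1.of_cons.1] at hp
          simp [unacked] at hp
        | writer_reader w =>
          have h1 := h.writer w
          rw [he.rsp_resp] at h1
          simp only [Pending] at hp
          cases hp.symm.trans h1.of_cons.1
        | reader_server i =>
          have h1 := h.reader
          rw [he.rsp_resp] at h1
          obtain ⟨I, y, hp, -⟩ := hp
          cases hp.symm.trans h1.of_cons.1
      refine ⟨fun hp' => absurd (hP.1 hp') hp, fun _ => ?_, fun _ => ?_⟩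
      · have := (h.link p' q' hl).idle hp
        rwa [← he.out_resp, ← he.out_resp, ← hch] at this
      · cases hl with
        | reader_server i =>
          intro n I hI hb
          simp [gstep] at hb
        | _ => trivial
    · exact (h.link p' q' hl).frame hl (he.out_resp _ _) (by rw [hch]) (he.out_resp _ _)
        (by rw [hch]) hP (fun w hw => by rw [wv_congr (he.vars_eq _)])
        (Function.update_of_ne hp _ _) (fun _ => rfl) (fun i => by rw [hst]) (fun _ => ⟨rfl, rfl⟩)
  · have h1 := h.writer w
    rw [hst, hk, hw]
    by_cases hp : .writer w = p
    · subst hp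
      rw [he.rsp_resp] at h1
      simp only [gstep, Function.update_self]
      rw [h1.of_cons.1, h1.of_cons.2.1]
      exact .idle _
    · simp only [gstep, Function.update_of_ne hp]
      rwa [he.rsp_ne hp]
  · have h1 := h.reader
    rw [hrd]
    by_cases hp : .reader = p
    · subst hp
      rw [he.rsp_resp] at h1
      simp only [gstep, Function.update_self]
      rw [h1.of_cons.1, h1.of_cons.2.1]
      exact .idle
    · simp only [gstep, Function.update_of_ne hp]
      rwa [he.rsp_ne hp]
  · rw [hrd, hst]; exact h.list
  · rw [hst]; exact h.unique
  · simp only [hst, hw]; exact h.bound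
  · simp only [hst, hk]
    intro w n u hu hb
    refine h.own w n u hu ?_
    by_cases hp : .writer w = p
    · subst hp
      simp [gstep] at hb
    · simpa only [gstep, Function.update_of_ne hp] using hb

end Ghost

/-! ### Preservation of the invariant by receipts and invocations -/

section Recv

variable {k l : ℕ} {V : Fin k → Type u} {v₀ : ∀ i, V i}
variable {s s' : (algorithmA l v₀).State} {g g' : Ghost V l}

theorem Handles.writer {w : Fin l} {e : Input V l} {L} (h : Handles s s' (.writer w) e L) :
    (wv s' w, L) = writerNext w (wv s w) e := h.next

theorem Handles.reader {e : Input V l} {L} (h : Handles s s' .reader e L) :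
    (rv s', L) = readerNext (rv s) e := h.next

theorem Handles.server {i : Fin k} {e : Input V l} {L} (h : Handles s s' (.server i) e L) :
    ((vars s' (.server i) : ServerVars V l i), L) ∈
      serverNext i (vars s (.server i) : ServerVars V l i) e := h.next

theorem IsLink.not_server {p q : Proc k l} (h : IsLink p q) (i : Fin k) : p ≠ .server i := by
  cases h <;> simp

theorem IsLink.not_writer {p q : Proc k l} (h : IsLink p q) (w : Fin l) : q ≠ .writer w := by
  cases h <;> simp

/-- Frame rule for a handler at `r`: by `hL1` and `hL2` its outputs do not enter this exchange, and
the conditions on local variables are only needed where `r` is the process that owns them. -/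
theorem LinkInv.handles_frame {p q r : Proc k l} {e L} (h : LinkInv s g p q) (hl : IsLink p q)
    (hh : Handles s s' r e L) (hB : ch s' p q = ch s p q) (hD : ch s' q p = ch s q p)
    (hL1 : p = r → msgsTo q L = []) (hL2 : q = r → msgsTo p L = [])
    (hP : p = r → (Pending s' p q ↔ Pending s p q))
    (hz : ∀ w, p = .writer w → r = .writer w → (wv s' w).z = (wv s w).z)
    (hb : g'.busy p = g.busy p) (hd : q = .reader → g'.done p = g.done p)
    (hs : ∀ i, r = .server i → stored s i ⊆ stored s' i)
    (hr : p = .reader → g'.snap = g.snap ∧ g'.hist q = g.hist q) : LinkInv s' g' p q := by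
  refine h.frame hl ?_ hB ?_ hD ?_ ?_ hb hd ?_ hr
  · by_cases hp : p = r
    · subst hp
      rw [hh.out_self, hL1 rfl, List.append_nil]
    · exact hh.out_ne hp _
  · by_cases hp : q = r
    · subst hp
      rw [hh.out_self, hL2 rfl, List.append_nil]
    · exact hh.out_ne hp _
  · by_cases hp : p = r
    · exact hP hp
    · exact pending_congr (hh.vars_ne p hp)
  · intro w hw
    by_cases hp : p = r
    · exact hz w hw (hp ▸ hw)
    · subst hw
      rw [wv_congr (hh.vars_ne _ hp)]
  · intro i
    by_cases hp : r = .server i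
    · exact hs i hp
    · rw [stored_congr (hh.vars_ne _ (Ne.symm hp))]

theorem LinkInv.pending_of_request {p q : Proc k l} {m B} (h : LinkInv s g p q)
    (hch : ch s p q = m ::ₘ B) : Pending s p q := by
  by_contra hp
  have := (h.idle hp).2.1
  simp [hch] at this

theorem LinkInv.pending_of_reply {p q : Proc k l} {m B} (h : LinkInv s g p q)
    (hch : ch s q p = m ::ₘ B) : Pending s p q := by
  by_contra hp
  have := (h.idle hp).2.2.2
  simp [hch] at this

/-- Handlers ignore messages between processes that have no exchange, so besides the history only
this channel changes. -/
theorem Invariant.recv_irrelevant {p q : Proc k l} {m : Msg V l} {n : ℕ} (h : Invariant s g)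
    (ht : (algorithmA l v₀).trans s (.recv p q m) s') (h1 : ¬ IsLink p q) (h2 : ¬ IsLink q p) :
    Invariant s' (gstep g n (.recv p q m)) := by
  obtain ⟨L, hh, hch, hcf⟩ := trans_recv ht
  have hg : gstep g n (.recv p q m) = { g with hist := record g.hist p q (n, .recv p q m) } := by
    cases p with
    | writer w =>
      cases q with
      | reader => exact absurd (.writer_reader w) h1
      | _ => rfl
    | _ => rfl
  have hv : vars s' q = vars s q ∧ L = [] := by
    have := hh.next
    cases p with
    | writer w =>
      cases q with
      | writer w' => cases m <;> exact Prod.mk.inj this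
      | reader => exact absurd (.writer_reader w) h1
      | server i => exact absurd (.writer_server w i) h1
    | reader =>
      cases q with
      | writer w => exact absurd (.writer_reader w) h2
      | reader => cases m <;> exact Prod.mk.inj this
      | server i => exact absurd (.reader_server i) h1
    | server i =>
      cases q with
      | writer w => exact absurd (.writer_server w i) h2
      | reader => exact absurd (.reader_server i) h2
      | server j => cases m <;> exact Prod.mk.inj this
  obtain ⟨hv, rfl⟩ := hv
  have hvars : ∀ p', vars s' p' = vars s p' := by
    intro p'
    by_cases hp : p' = q
    · subst hp; exact hv
    · exact hh.vars_ne p' hp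
  rw [hg]
  refine h.frame ?_ hvars ?_ rfl rfl rfl rfl
  · intro p' q' hl
    have h3 : (p', q') ≠ (p, q) := by rintro h; cases h; exact h1 hl
    have h4 : (q', p') ≠ (p, q) := by rintro h; cases h; exact h2 hl
    refine (h.link p' q' hl).handles_frame hl hh (hcf _ _ h3) (hcf _ _ h4) (fun _ => rfl)
      (fun _ => rfl) (fun _ => pending_congr (hvars p'))
      (fun w _ _ => by rw [wv_congr (hvars _)]) rfl (fun _ => rfl)
      (fun i _ => by rw [stored_congr (hvars _)]) ?_
    rintro rfl
    exact ⟨rfl, record_ne (Ne.symm h3) (Ne.symm h4)⟩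
  · intro p'
    by_cases hp : p' = q
    · subst hp; simp [hh.rsp_self]
    · exact hh.rsp_ne hp

/-- The only new pair carries the current key of `w` and the value of its WRITE in progress. That an
acknowledgement is queued is needed for liveness. -/
theorem Invariant.recv_writeValue {w : Fin l} {i : Fin k} {m : Msg V l} {n : ℕ}
    (h : Invariant s g) (ht : (algorithmA l v₀).trans s (.recv (.writer w) (.server i) m) s') :
    Invariant s' (gstep g n (.recv (.writer w) (.server i) m)) ∧
      out s' (.server i) (.writer w) ≠ [] := by
  obtain ⟨L, hh, hch, hcf⟩ := trans_recv ht
  have hl : IsLink (.writer w : Proc k l) (.server i) := .writer_server w i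
  have hp := (h.link _ _ hl).pending_of_request hch
  have ha := (h.link _ _ hl).active hp
  rw [hch] at ha
  obtain ⟨⟨n', u, hu, v, hb, hui, hm, -⟩, hA, hB, hC, hD⟩ := ha.recv_request
  have hm := hm (by norm_num)
  subst hm
  have hg : gstep g n (.recv (.writer w) (.server i) (.writeValue (wkey s w) i v)) = g := by
    simp [gstep, record]
  rw [hg]
  obtain ⟨hst, rfl⟩ : stored s' i = insert (wkey s w, v) (stored s i) ∧
      L = [.send (.writer w) .ack] := by
    have := hh.server
    simp only [serverNext, dite_true] at this
    obtain ⟨h1, h2⟩ := Prod.mk.inj this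
    exact ⟨by rw [stored, h1]; rfl, h2⟩
  have hst_ne : ∀ j, j ≠ i → stored s' j = stored s j := fun j hj =>
    stored_congr (hh.vars_ne _ (by simpa using hj))
  have hsub : ∀ j, stored s j ⊆ stored s' j := by
    intro j
    by_cases hj : j = i
    · subst hj; rw [hst]; exact Set.subset_insert _ _
    · rw [hst_ne j hj]
  have hmem : ∀ j κ v', (κ, v') ∈ stored s' j → (κ, v') ∈ stored s j ∨
      κ = wkey s w ∧ u j = some v' := by
    intro j κ v' hv'
    by_cases hj : j = i
    · subst hj
      rw [hst] at hv'
      rcases hv' with hv' | hv'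
      · cases hv'; exact Or.inr ⟨rfl, hui⟩
      · exact Or.inl hv'
    · rw [hst_ne j hj] at hv'
      exact Or.inl hv'
  have hw : ∀ w', wv s' w' = wv s w' := fun w' => hh.vars_ne (.writer w') (by simp)
  have hk : ∀ w', wkey s' w' = wkey s w' := fun w' => by rw [wkey, hw]; rfl
  have hrd : rv s' = rv s := hh.vars_ne .reader (by simp)
  refine ⟨⟨fun p' q' hl' => ?_, fun w' => ?_, ?_, ?_, ?_, ?_, ?_⟩, ?_⟩
  · have h2 : (q', p') ≠ (.writer w, .server i) := fun hne => hl.asymm hl' (by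
      cases hne; rfl)
    have hps := hl'.not_server i
    by_cases h1 : (p', q') = (.writer w, .server i)
    · cases h1
      have hP := (pending_congr (q := .server i) (hh.vars_ne _ hps)).2 hp
      refine ⟨fun _ => ?_, fun h' => absurd hP h', fun h' => absurd hP h'⟩
      rw [hh.out_ne hps, hh.out_self, hcf _ _ h2]
      refine Or.inr (Or.inr (Or.inl ⟨.ack, ?_, hA, hB, by simp [hC], hD⟩))
      refine ⟨n', u, hu, v, hb, hui, by norm_num, fun _ => ⟨rfl, ?_⟩⟩
      rw [hk, hst]
      exact Set.mem_insert _ _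
    · refine (h.link p' q' hl').handles_frame hl' hh (hcf _ _ h1) (hcf _ _ h2)
        (fun h' => absurd h' hps) ?_ (fun h' => absurd h' hps) (fun w' _ h' => by cases h')
        rfl (fun _ => rfl) (fun j _ => hsub j) (fun _ => ⟨rfl, rfl⟩)
      rintro rfl
      rw [msgsTo_send_ne, msgsTo_nil]
      rintro rfl
      exact h1 rfl
  · rw [hk, hw, hh.rsp_ne (by simp)]
    exact (h.writer w').mono hsub
  · rw [hrd, hh.rsp_ne (by simp)]
    exact h.reader
  · rw [hrd]
    exact fun j => hsub j (h.list j)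
  -- If one of the pairs is new, its key is the current key of `w`, and `own` forces any value
  -- stored under this key at object `j` to be the one that the WRITE assigns to `j`.
  · intro j κ v₁ v₂ h1 h2
    rcases hmem j κ v₁ h1 with h1 | ⟨h1, h3⟩ <;> rcases hmem j κ v₂ h2 with h2 | ⟨h2, h4⟩
    · exact h.unique j κ _ _ h1 h2
    · subst h2
      have := h.own w n' u hu hb j v₁ h1
      simpa [h4] using this.symm
    · subst h1
      have := h.own w n' u hu hb j v₂ h2
      simpa [h3] using this
    · simpa [h3] using h4
  · intro j z w' v' hv'
    rw [hw]
    rcases hmem j _ v' hv' with h1 | ⟨h1, -⟩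
    · exact h.bound j z w' v' h1
    · cases h1; exact le_rfl
  · intro w' n₁ u₁ hu₁ hb₁ j v' hv'
    rw [hk] at hv'
    rcases hmem j _ v' hv' with h1 | ⟨h1, h3⟩
    · exact h.own w' n₁ u₁ hu₁ hb₁ j v' h1
    -- Keys contain the writer id, so the new pair concerns no other writer.
    · have : w' = w := by simpa [wkey] using congrArg Prod.snd h1
      subst this
      rw [hb] at hb₁
      cases hb₁
      exact h3
  · have := hh.out_self (.writer w)
    rw [hC] at this
    rw [this]
    simp

theorem latestKey_append (L : List (Key l × (Fin k → Bool))) (κ : Key l) (b : Fin k → Bool)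
    (i : Fin k) : latestKey (L ++ [(κ, b)]) i = if b i then κ else latestKey L i := by
  unfold latestKey
  rw [List.filter_append]
  by_cases hb : b i <;> simp [hb]

/-- This is where a WRITE takes effect: the list of the reader and `cur` change in the same step, so
`list` survives. -/
theorem Invariant.recv_informReader {w : Fin l} {m : Msg V l} {n : ℕ}
    (h : Invariant s g) (ht : (algorithmA l v₀).trans s (.recv (.writer w) .reader m) s') :
    Invariant s' (gstep g n (.recv (.writer w) .reader m)) ∧ out s' .reader (.writer w) ≠ [] := by
  obtain ⟨L, hh, hch, hcf⟩ := trans_recv ht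
  have hl : IsLink (.writer w : Proc k l) .reader := .writer_reader w
  have hp := (h.link _ _ hl).pending_of_request hch
  have ha := (h.link _ _ hl).active hp
  rw [hch] at ha
  obtain ⟨⟨n', u, hu, hb, hm, -⟩, hA, hB, hC, hD⟩ := ha.recv_request
  obtain ⟨hm, hdone⟩ := hm (by norm_num)
  subst hm
  have hnext := hh.reader
  simp only [readerNext, Prod.mk.injEq] at hnext
  obtain ⟨hrv, rfl⟩ := hnext
  have hst : ∀ j, stored s' j = stored s j := fun j => stored_congr (hh.vars_ne _ (by simp))
  have hst' : stored s' = stored s := funext hst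
  have hw : ∀ w', wv s' w' = wv s w' := fun w' => hh.vars_ne (.writer w') (by simp)
  have hk : ∀ w', wkey s' w' = wkey s w' := fun w' => by rw [wkey, hw]; rfl
  have hcur : (gstep g n (.recv (.writer w) .reader (.informReader (wkey s w)
      fun j => (u j).isSome))).cur = fun i => (u i).getD (g.cur i) := by
    simp only [gstep, hb]; rfl
  -- The writer has reached phase `informReader`, hence every server concerned has stored its value.
  have hall : ∀ i v, u i = some v → (wkey s w, v) ∈ stored s i := by
    have h1 := h.writer w
    have hp' : (wv s w).phase = .informReader := hp
    rw [hp'] at h1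
    obtain ⟨-, n₁, u₁, hu₁, hb₁, h1⟩ := h1.of_informReader
    rw [hb] at hb₁
    cases hb₁
    exact h1
  refine ⟨⟨fun p' q' hl' => ?_, fun w' => ?_, ?_, ?_, ?_, ?_, ?_⟩, ?_⟩
  · have h2 : (q', p') ≠ (.writer w, .reader) := fun hne => hl.asymm hl' (by
      cases hne; rfl)
    by_cases h1 : (p', q') = (.writer w, .reader)
    · cases h1
      have hP := (pending_congr (q := .reader) (hh.vars_ne (.writer w) (by simp))).2 hp
      refine ⟨fun _ => ?_, fun h' => absurd hP h', fun h' => absurd hP h'⟩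
      rw [hh.out_ne (by simp), hh.out_self, hcf _ _ h2]
      refine Or.inr (Or.inr (Or.inl ⟨_, ?_, hA, hB, by rw [hC]; simp; rfl, hD⟩))
      exact ⟨n', u, hu, hb, by norm_num, fun _ => ⟨⟨_, rfl⟩, by simp [gstep]⟩⟩
    · refine (h.link p' q' hl').handles_frame hl' hh (hcf _ _ h1) (hcf _ _ h2)
        ?_ ?_ ?_ (fun w' _ h' => by cases h') rfl ?_ (fun j _ => (hst j).ge) (fun _ => ⟨rfl, rfl⟩)
      · rintro rfl
        rw [msgsTo_send_ne (hl'.not_writer w).symm, msgsTo_nil]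
      · rintro rfl
        rw [msgsTo_send_ne, msgsTo_nil]
        rintro rfl
        exact h1 rfl
      · rintro rfl
        cases hl' with
        | reader_server i => simp only [Pending, hrv]
      · rintro rfl
        refine Function.update_of_ne ?_ _ _
        rintro rfl
        exact h1 rfl
  · rw [hk, hw, hh.rsp_ne (by simp), hst']
    by_cases hww : w' = w
    · subst hww
      have hp' : (wv s w').phase = .informReader := hp
      have h1 := h.writer w'
      rw [hp'] at h1 ⊢
      rw [h1.of_informReader.1]
      change WriterCtl _ _ _ (g.busy _) _ _
      rw [hb]
      exact .informing n' u hu _ hall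
    · have : (gstep g n (.recv (.writer w) .reader (.informReader (wkey s w)
          fun j => (u j).isSome))).done (.writer w') = g.done (.writer w') :=
        Function.update_of_ne (by simpa using hww) _ _
      rw [this]
      exact h.writer w'
  · have := hh.rsp_self
    simp only [respsOf_send, respsOf_nil, List.append_nil] at this
    rw [this, hrv]
    exact h.reader
  -- For a written object the appended entry is the latest and its value is stored by `hall`; the
  -- other objects keep both key and current value.
  · intro i
    rw [hcur, hst, hrv, latestKey_append]
    rcases hui : u i with _ | v
    · simpa [hui] using h.list i
    · simpa [hui] using hall i v hui
  · rw [hst']; exact h.unique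
  · simp only [hst, hw]; exact h.bound
  · simp only [hst, hk]; exact h.own
  · rw [hh.out_self, hC]
    simp

/-- The requested key is known to lead to the snapshot value at this server, so the server never
finds its set empty-handed; by `unique` it has no other value to choose. -/
theorem Invariant.recv_readValue {i : Fin k} {m : Msg V l} {n : ℕ}
    (h : Invariant s g) (ht : (algorithmA l v₀).trans s (.recv .reader (.server i) m) s') :
    Invariant s' (gstep g n (.recv .reader (.server i) m)) ∧
      que s' (.server i) = que s (.server i) ++ [.send .reader (.value i (g.snap i))] := by
  obtain ⟨L, hh, hch, hcf⟩ := trans_recv ht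
  have hl : IsLink (.reader : Proc k l) (.server i) := .reader_server i
  have hp := (h.link _ _ hl).pending_of_request hch
  have ha := (h.link _ _ hl).active hp
  rw [hch] at ha
  obtain ⟨⟨κ, hr, hκ, hm, -⟩, hA, hB, hC, hD⟩ := ha.recv_request
  have hm := hm (by norm_num)
  subst hm
  obtain ⟨hv, rfl⟩ : vars s' (.server i) = vars s (.server i) ∧
      L = [.send .reader (.value i (g.snap i))] := by
    have := hh.server
    rcases this with ⟨v, hv, h1⟩ | ⟨hv, h1⟩
    · have hvv := h.unique i κ _ _ hκ hv
      subst hvv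
      exact Prod.mk.inj h1
    · exact absurd hκ (hv _)
  have hvars : ∀ p', vars s' p' = vars s p' := by
    intro p'
    by_cases hp : p' = .server i
    · subst hp; exact hv
    · exact hh.vars_ne p' hp
  have hst : ∀ j, stored s' j = stored s j := fun j => stored_congr (hvars _)
  refine ⟨h.frame ?_ hvars ?_ rfl rfl rfl rfl, hh.que_self⟩
  · intro p' q' hl'
    have h2 : (q', p') ≠ (.reader, .server i) := fun hne => hl.asymm hl' (by
      cases hne; rfl)
    have hps := hl'.not_server i
    by_cases h1 : (p', q') = (.reader, .server i)
    · cases h1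
      have hP := (pending_congr (q := .server i) (hvars .reader)).2 hp
      refine ⟨fun _ => ?_, fun h' => absurd hP h', fun h' => absurd hP h'⟩
      rw [hh.out_ne hps, hh.out_self, hcf _ _ h2]
      refine Or.inr (Or.inr (Or.inl ⟨_, ?_, hA, hB, by rw [hC]; simp; rfl, hD⟩))
      refine ⟨κ, ?_, by rw [hst]; exact hκ, by norm_num, fun _ => rfl⟩
      simp only [Ghost.rounds, gstep, record, round] at hr ⊢
      simp [hr]
    · refine (h.link p' q' hl').handles_frame hl' hh (hcf _ _ h1) (hcf _ _ h2)
        (fun h' => absurd h' hps) ?_ (fun h' => absurd h' hps) (fun w' _ h' => by cases h')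
        rfl (fun _ => rfl) (fun j _ => (hst j).ge) ?_
      · rintro rfl
        rw [msgsTo_send_ne, msgsTo_nil]
        rintro rfl
        exact h1 rfl
      · rintro rfl
        exact ⟨rfl, record_ne (Ne.symm h1) (Ne.symm h2)⟩
  · intro p'
    by_cases hp : p' = .server i
    · subst hp; simp [hh.rsp_self]
    · exact hh.rsp_ne hp

/-- Assembling the invariant after a step of writer `w` that changes no history variable but those
of `w`. -/
theorem Invariant.of_writer {w : Fin l} {e L} (h : Invariant s g)
    (hh : Handles s s' (.writer w) e L)
    (hch : ∀ p q, IsLink p q → p ≠ .writer w →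
      ch s' p q = ch s p q ∧ ch s' q p = ch s q p)
    (hbusy : ∀ p, p ≠ .writer w → g'.busy p = g.busy p)
    (hdone : ∀ p, p ≠ .writer w → g'.done p = g.done p)
    (hcur : g'.cur = g.cur) (hsnap : g'.snap = g.snap)
    (hhist : ∀ i, g'.hist (.server i) = g.hist (.server i))
    (hlink : ∀ q, IsLink (.writer w) q → LinkInv s' g' (.writer w) q)
    (hctl : WriterCtl (stored s) (wkey s' w) (wv s' w).phase (g'.busy (.writer w))
      (rsp s' (.writer w)) (g'.done (.writer w)))
    (hz : (wv s w).z ≤ (wv s' w).z)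
    (hown : ∀ n u hu, g'.busy (.writer w) = some (n, .write u hu) →
      ∀ i v, (wkey s' w, v) ∈ stored s i → u i = some v) : Invariant s' g' := by
  have hst : ∀ j, stored s' j = stored s j := fun j => stored_congr (hh.vars_ne _ (by simp))
  have hst' : stored s' = stored s := funext hst
  have hw : ∀ w', w' ≠ w → wv s' w' = wv s w' := fun w' hw => hh.vars_ne (.writer w') (by simpa)
  have hk : ∀ w', w' ≠ w → wkey s' w' = wkey s w' := fun w' h => by rw [wkey, hw w' h]; rfl
  have hrd : rv s' = rv s := hh.vars_ne .reader (by simp)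
  refine ⟨fun p q hl => ?_, fun w' => ?_, ?_, ?_, ?_, ?_, ?_⟩
  · by_cases hp : p = .writer w
    · subst hp; exact hlink q hl
    · obtain ⟨hB, hD⟩ := hch p q hl hp
      refine (h.link p q hl).handles_frame hl hh hB hD (fun h' => absurd h' hp)
        (fun h' => absurd h' (hl.not_writer w)) (fun h' => absurd h' hp)
        (fun w' h1 h2 => absurd (h1.trans h2.symm) hp) (hbusy p hp) (fun _ => hdone p hp)
        (fun i _ => (hst i).ge) ?_
      rintro rfl
      cases hl with
      | reader_server i => exact ⟨hsnap, hhist i⟩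
  · by_cases hw' : w' = w
    · subst hw'; rw [hst']; exact hctl
    · have hne : (.writer w' : Proc k l) ≠ .writer w := by simpa
      rw [hst', hk w' hw', hw w' hw', hbusy _ hne, hdone _ hne, hh.rsp_ne hne]
      exact h.writer w'
  · rw [hsnap, hrd, hbusy _ (by simp), hh.rsp_ne (by simp)]
    exact h.reader
  · rw [hrd, hcur, hst']; exact h.list
  · rw [hst']; exact h.unique
  · intro i z w' v hv
    rw [hst] at hv
    have := h.bound i z w' v hv
    by_cases hw' : w' = w
    · subst hw'; exact this.trans hz
    · rwa [hw w' hw']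
  · intro w' n u hu hb i v hv
    rw [hst] at hv
    by_cases hw' : w' = w
    · subst hw'; exact hown n u hu hb i v hv
    · rw [hk w' hw'] at hv
      rw [hbusy _ (by simpa)] at hb
      exact h.own w' n u hu hb i v hv

/-- An acknowledgement in transit is the single message of a pending exchange, so it removes a
server that is really awaited. The second conclusion is the progress step for liveness. -/
theorem Invariant.recv_ack {w : Fin l} {i : Fin k} {m : Msg V l} {n : ℕ}
    (h : Invariant s g) (ht : (algorithmA l v₀).trans s (.recv (.server i) (.writer w) m) s') :
    Invariant s' (gstep g n (.recv (.server i) (.writer w) m)) ∧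
      ∃ κ u R, (wv s w).phase = .writeValue κ u R ∧ i ∈ R ∧
        (R.erase i = ∅ ∧ (wv s' w).phase = .informReader ∨
          (wv s' w).phase = .writeValue κ u (R.erase i)) := by
  obtain ⟨L, hh, hch, hcf⟩ := trans_recv ht
  have hl : IsLink (.writer w : Proc k l) (.server i) := .writer_server w i
  have hp := (h.link _ _ hl).pending_of_reply hch
  have ha := (h.link _ _ hl).active hp
  rw [hch] at ha
  obtain ⟨⟨n', u, hu, v, hb, hui, -, hm⟩, hA, hB, hC, hD⟩ := ha.recv_reply
  obtain ⟨hm, hv⟩ := hm (by norm_num)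
  subst hm
  have hg : gstep g n (.recv (.server i) (.writer w) (.ack : Msg V l)) = g := by
    simp [gstep, record]
  rw [hg]
  obtain ⟨u', R, hφ⟩ : ∃ u' R, (wv s w).phase = .writeValue (wkey s w) u' R := by
    have h1 := h.writer w
    simp only [Pending] at hp
    rcases hφ : (wv s w).phase with _ | ⟨κ, u', R⟩ | _
    · simp [hφ, unacked] at hp
    · rw [hφ] at h1
      exact ⟨u', R, by rw [h1.of_writeValue.1]⟩
    · simp [hφ, unacked] at hp
  have hctl := h.writer w
  rw [hφ] at hctl
  obtain ⟨-, hrsp, hdone, hR, ⟨n₁, hu₁, hb₁⟩, hall⟩ := hctl.of_writeValue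
  rw [hb] at hb₁
  cases hb₁
  have hi : i ∈ R := by simpa [Pending, hφ, unacked] using hp
  -- Nothing is in transit between `w` and the reader, so an inform-reader message emitted now
  -- starts that exchange in stage 0.
  have hidle := (h.link _ _ (.writer_reader w)).idle (by simp [Pending, hφ])
  have hnext := hh.writer
  simp only [writerNext, hφ] at hnext
  have hall' : ∀ j v', u j = some v' → j ∉ R.erase i → (wkey s w, v') ∈ stored s j := by
    intro j v' h1 h2
    by_cases hj : j = i
    · subst hj
      rw [hui] at h1
      cases h1
      exact hv
    · exact hall j v' h1 fun h3 => h2 (Finset.mem_erase.2 ⟨hj, h3⟩)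
  have hchs : ∀ p q, IsLink p q → p ≠ .writer w →
      ch s' p q = ch s p q ∧ ch s' q p = ch s q p := by
    intro p q hl' hp
    refine ⟨hcf _ _ ?_, hcf _ _ ?_⟩
    · rintro h1; cases h1; exact hl'.not_writer _ rfl
    · rintro h1; cases h1; exact hp rfl
  have hzs : (wv s' w).z = (wv s w).z := by
    split_ifs at hnext <;> rw [(Prod.mk.inj hnext).1]
  have hk : wkey s' w = wkey s w := by rw [wkey, hzs]; rfl
  have hmsg : ∀ j, msgsTo (.server j) L = [] := by
    intro j
    split_ifs at hnext <;> rw [(Prod.mk.inj hnext).2] <;> simp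
  have hrspL : respsOf L = [] := by
    split_ifs at hnext <;> rw [(Prod.mk.inj hnext).2] <;> simp
  -- Both branches are covered because `unacked` is empty in phase `informReader`.
  have hun : unacked (wv s' w).phase = R.erase i := by
    split_ifs at hnext with he <;> rw [(Prod.mk.inj hnext).1]
    · exact he.symm
    · rfl
  refine ⟨h.of_writer hh hchs (fun _ _ => rfl) (fun _ _ => rfl) rfl rfl (fun _ => rfl) ?_ ?_ hzs.ge ?_, ?_⟩
  · intro q hl'
    cases hl' with
    | writer_server _ j =>
      by_cases hj : j = i
      · subst hj
        have hP : ¬ Pending s' (.writer w) (.server j) := by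
          simp [Pending, hun]
        refine ⟨fun h' => absurd h' hP, fun _ => ?_, fun _ => trivial⟩
        rw [hh.out_self, hmsg, List.append_nil, hh.out_ne (by simp), hcf _ _ (by simp)]
        exact ⟨hA, hB, hC, hD⟩
      · refine (h.link _ _ (.writer_server w j)).handles_frame (.writer_server w j) hh
          (hcf _ _ (by simp)) (hcf _ _ (by simpa using hj)) (fun _ => hmsg j) (by simp) ?_ ?_ rfl
          (fun _ => rfl) (by simp) (by simp)
        · intro _
          simp only [Pending]
          rw [hun, hφ]
          simp [unacked, hj]
        · intro w' h1 _
          cases h1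
          exact hzs
    | writer_reader =>
      split_ifs at hnext with he <;> obtain ⟨h1, rfl⟩ := Prod.mk.inj hnext
      · have hP : Pending s' (.writer w) .reader := by simp [Pending, h1]
        refine ⟨fun _ => ?_, fun h' => absurd hP h', fun h' => absurd hP h'⟩
        rw [hh.out_self, hh.out_ne (by simp), hcf _ _ (by simp), hcf _ _ (by simp)]
        refine Or.inl ⟨.informReader (wkey s w) fun j => (u j).isSome, ?_, ?_, hidle.2⟩
        · exact ⟨n', u, hu, hb, fun _ => ⟨by rw [hk], hdone⟩, by norm_num⟩
        · rw [hidle.1]; simp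
      · have hP : ¬ Pending s' (.writer w) .reader := by simp [Pending, h1]
        refine ⟨fun h' => absurd h' hP, fun _ => ?_, fun _ => trivial⟩
        rw [hh.out_self, hh.out_ne (by simp), hcf _ _ (by simp), hcf _ _ (by simp)]
        simpa using hidle
  · rw [hk, hb, hdone, hh.rsp_self, hrspL, hrsp, List.append_nil]
    split_ifs at hnext with he <;> rw [(Prod.mk.inj hnext).1]
    · exact .informing n' u hu _ fun j v' h1 => hall' j v' h1 (by simp [he])
    · exact .writing n' u hu _ (Finset.nonempty_iff_ne_empty.2 he) hall'
  · rw [hk]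
    exact fun n u hu => h.own w n u hu
  · refine ⟨_, u, R, hφ, hi, ?_⟩
    split_ifs at hnext with he <;> rw [(Prod.mk.inj hnext).1]
    · exact Or.inl ⟨he, rfl⟩
    · exact Or.inr rfl

theorem Invariant.recv_ackTag {w : Fin l} {m : Msg V l} {n : ℕ}
    (h : Invariant s g) (ht : (algorithmA l v₀).trans s (.recv .reader (.writer w) m) s') :
    Invariant s' (gstep g n (.recv .reader (.writer w) m)) ∧ .resp .ok ∈ que s' (.writer w) := by
  obtain ⟨L, hh, hch, hcf⟩ := trans_recv ht
  have hl : IsLink (.writer w : Proc k l) .reader := .writer_reader w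
  have hp := (h.link _ _ hl).pending_of_reply hch
  have ha := (h.link _ _ hl).active hp
  rw [hch] at ha
  obtain ⟨⟨n', u, hu, hb, -, hm⟩, hA, hB, hC, hD⟩ := ha.recv_reply
  -- An exchange in stage 3 has passed the reader, so `done` is set, as the control state
  -- `responding` demands.
  obtain ⟨⟨t, hm⟩, hdone⟩ := hm (by norm_num)
  subst hm
  have hφ : (wv s w).phase = .informReader := hp
  have hctl := h.writer w
  rw [hφ] at hctl
  have hrsp := hctl.of_informReader.1
  have hnext := hh.writer
  simp only [writerNext, hφ] at hnext
  obtain ⟨hwv, rfl⟩ := Prod.mk.inj hnext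
  have hk : wkey s' w = wkey s w := by rw [wkey, hwv]; rfl
  have hg : gstep g n (.recv .reader (.writer w) (.ackTag t : Msg V l)) =
      { g with
        hist := Function.update g.hist (.writer w)
          (g.hist (.writer w) ++ [(n, .recv .reader (.writer w) (.ackTag t))]) } := by
    simp [gstep, record]
  rw [hg]
  refine ⟨h.of_writer hh ?_ (fun _ _ => rfl) (fun _ _ => rfl) rfl rfl
    (fun i => by simp) ?_ ?_ (by rw [hwv]) ?_, ?_⟩
  · intro p q hl' hp
    refine ⟨hcf _ _ ?_, hcf _ _ ?_⟩
    · rintro h1; cases h1; exact hl'.not_writer _ rfl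
    · rintro h1; cases h1; exact hp rfl
  · intro q hl'
    cases hl' with
    | writer_server _ j =>
      have h1 := (h.link _ _ (.writer_server w j)).idle (by simp [Pending, hφ, unacked])
      have hP : ¬ Pending s' (.writer w) (.server j) := by simp [Pending, hwv, unacked]
      refine ⟨fun h' => absurd h' hP, fun _ => ?_, fun _ => trivial⟩
      rw [hh.out_self, hh.out_ne (by simp), hcf _ _ (by simp), hcf _ _ (by simp)]
      simpa using h1
    | writer_reader =>
      have hP : ¬ Pending s' (.writer w) .reader := by simp [Pending, hwv]
      refine ⟨fun h' => absurd h' hP, fun _ => ?_, fun _ => trivial⟩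
      rw [hh.out_self, hh.out_ne (by simp), hcf _ _ (by simp)]
      simpa using ⟨hA, hB, hC, hD⟩
  · rw [hwv, hb, hh.rsp_self, hrsp]
    exact .responding n' u hu _ hdone
  · rw [hk]
    exact fun n u hu => h.own w n u hu
  · rw [hh.que_self]
    simp

/-- The value received is the snapshot of object `i` and completes its round. The second conclusion,
one missing value less or a response, is for liveness. -/
theorem Invariant.recv_value {i : Fin k} {m : Msg V l} {n : ℕ}
    (h : Invariant s g) (ht : (algorithmA l v₀).trans s (.recv (.server i) .reader m) s') :
    Invariant s' (gstep g n (.recv (.server i) .reader m)) ∧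
      ∃ I y, (rv s).phase = some (I, y) ∧ i ∈ I ∧ y i = none ∧
        ((∃ z, .resp z ∈ que s' .reader) ∨
          ∃ v, (rv s').phase = some (I, Function.update y i (some v))) := by
  obtain ⟨L, hh, hch, hcf⟩ := trans_recv ht
  have hl : IsLink (.reader : Proc k l) (.server i) := .reader_server i
  have hp := (h.link _ _ hl).pending_of_reply hch
  have ha := (h.link _ _ hl).active hp
  rw [hch] at ha
  obtain ⟨⟨κ, hr, hκ, -, hm⟩, hA, hB, hC, hD⟩ := ha.recv_reply
  have hm := hm (by norm_num)
  subst hm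
  obtain ⟨I, y, hφ, hi, hyi⟩ := hp
  have hctl := h.reader
  rw [hφ] at hctl
  obtain ⟨hrsp, -, hy, n', hI, hb⟩ := hctl.of_some
  set y' := Function.update y i (some (g.snap i)) with hy'
  have hy'i : y' i = some (g.snap i) := Function.update_self _ _ _
  have hy'j : ∀ j, j ≠ i → y' j = y j := fun j hj => Function.update_of_ne hj _ _
  have hy'2 : ∀ j, y' j = none ∨ j ∈ I ∧ y' j = some (g.snap j) := by
    intro j
    by_cases hj : j = i
    · subst hj; exact Or.inr ⟨hi, hy'i⟩
    · rw [hy'j j hj]; exact hy j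
  have hnext := hh.reader
  simp only [readerNext, hφ, hi, and_self, if_true] at hnext
  have hlist : (rv s').list = (rv s).list := by
    split_ifs at hnext <;> rw [(Prod.mk.inj hnext).1]
  have hmsg : ∀ q, msgsTo q L = [] := by
    intro q
    split_ifs at hnext <;> rw [(Prod.mk.inj hnext).2] <;> simp
  have hpend : ∀ j, Pending s' (.reader : Proc k l) (.server j) ↔ j ∈ I ∧ y' j = none := by
    intro j
    simp only [Pending]
    split_ifs at hnext with he <;> rw [(Prod.mk.inj hnext).1]
    · simp only [reduceCtorEq, false_and, exists_false, false_iff, not_and]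
      intro hj h0
      have := he j hj
      rw [← hy', h0] at this
      cases this
    · constructor
      · rintro ⟨I', y'', h1, h2, h3⟩
        cases h1
        exact ⟨h2, h3⟩
      · rintro ⟨h2, h3⟩
        exact ⟨I, y', rfl, h2, h3⟩
  have hst : ∀ j, stored s' j = stored s j := fun j => stored_congr (hh.vars_ne _ (by simp))
  have hst' : stored s' = stored s := funext hst
  have hw : ∀ w, wv s' w = wv s w := fun w => hh.vars_ne (.writer w) (by simp)
  have hk : ∀ w, wkey s' w = wkey s w := fun w => by rw [wkey, hw w]; rfl
  have hg : gstep g n (.recv (.server i) .reader (.value i (g.snap i))) =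
      { g with
        hist := Function.update g.hist (.server i)
          (g.hist (.server i) ++ [(n, .recv (.server i) .reader (.value i (g.snap i)))]) } := by
    simp [gstep, record]
  rw [hg]
  refine ⟨⟨fun p q hl' => ?_, fun w => ?_, ?_, ?_, ?_, ?_, ?_⟩, ?_⟩
  · have h2 : (p, q) ≠ (.server i, .reader) := by
      intro h1; cases h1; exact hl'.not_server i rfl
    by_cases h1 : (p, q) = (.reader, .server i)
    · cases h1
      have hP : ¬ Pending s' (.reader : Proc k l) (.server i) := by simp [hpend, hy'i]
      refine ⟨fun h' => absurd h' hP, fun _ => ?_, fun _ => ?_⟩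
      · rw [hh.out_self, hh.out_ne (by simp), hcf _ _ (by simp), hmsg]
        simpa using ⟨hA, hB, hC, hD⟩
      · rintro n₁ I₁ hI₁ hb₁
        have hb₁ : g.busy .reader = _ := hb₁
        rw [hb] at hb₁
        cases hb₁
        refine ⟨fun _ => ⟨κ, ?_⟩, fun h' => absurd hi h'⟩
        simp only [Ghost.rounds, round] at hr ⊢
        simp [hr]
    · have h3 : (q, p) ≠ (.server i, .reader) := by
        intro h3; cases h3; exact h1 rfl
      refine (h.link p q hl').handles_frame hl' hh (hcf _ _ h2) (hcf _ _ h3)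
        (fun _ => hmsg _) (fun _ => hmsg _) ?_ (fun w h1 h2 => by cases h2) rfl (fun _ => rfl)
        (fun j _ => (hst j).ge) ?_
      · rintro rfl
        cases hl' with
        | reader_server j =>
          have hj : j ≠ i := by rintro rfl; exact h1 rfl
          rw [hpend, hy'j j hj]
          simp only [Pending, hφ]
          constructor
          · rintro ⟨h2, h3⟩; exact ⟨I, y, rfl, h2, h3⟩
          · rintro ⟨I', y'', h1, h2, h3⟩
            cases h1
            exact ⟨h2, h3⟩
      · rintro rfl
        refine ⟨rfl, Function.update_of_ne ?_ _ _⟩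
        rintro rfl
        exact h1 rfl
  · rw [hst', hk, hw, hh.rsp_ne (by simp)]
    exact h.writer w
  · rw [hh.rsp_self, hrsp]
    change ReaderCtl g.snap _ (g.busy _) _
    rw [hb]
    split_ifs at hnext with he <;> obtain ⟨h1, rfl⟩ := Prod.mk.inj hnext <;> rw [h1]
    -- Each recorded value is the snapshot value of a requested object, and none is missing any
    -- more.
    · have : y' = fun j => if j ∈ I then some (g.snap j) else none := by
        funext j
        rcases hy'2 j with h0 | ⟨h2, h3⟩
        · have hj : j ∉ I := by
            intro hj
            have := he j hj
            rw [← hy', h0] at this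
            cases this
          rw [if_neg hj, h0]
        · rw [if_pos h2, h3]
      rw [← hy', this]
      exact .responding n' I hI
    · refine .reading n' I hI _ ?_ hy'2
      push Not at he
      obtain ⟨a, ha, h2⟩ := he
      exact ⟨a, ha, by simpa using h2⟩
  · rw [hlist, hst']; exact h.list
  · rw [hst']; exact h.unique
  · simp only [hst, hw]; exact h.bound
  · simp only [hst, hk]; exact h.own
  · refine ⟨I, y, hφ, hi, hyi, ?_⟩
    split_ifs at hnext with he <;> obtain ⟨h1, rfl⟩ := Prod.mk.inj hnext
    · exact Or.inl ⟨.vals y', by rw [hh.que_self]; simp [hy']⟩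
    · exact Or.inr ⟨_, by rw [h1]⟩

theorem filterMap_ite_eq {ι M : Type*} [DecidableEq ι] (f : ι → Option M) (i : ι) (L : List ι)
    (hL : L.Nodup) (hi : i ∈ L) :
    (L.filterMap fun j => if j = i then f j else none) = (f i).toList := by
  induction L with
  | nil => simp at hi
  | cons a L ih =>
    obtain ⟨ha, hL⟩ := List.nodup_cons.1 hL
    by_cases hai : a = i
    · subst hai
      have : (L.filterMap fun j => if j = a then f j else none) = [] := by
        rw [List.filterMap_eq_nil_iff]
        intro j hj
        rw [if_neg]
        rintro rfl
        exact ha hj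
      rw [List.filterMap_cons]
      rcases f a with _ | b <;> simp [this]
    · have hi : i ∈ L := by simpa [Ne.symm hai] using hi
      rw [List.filterMap_cons, if_neg hai]
      exact ih hL hi

/-- An invocation queues at most one request per server; this is what lets each exchange start in
stage 0 with a single message. -/
theorem msgsTo_scatter (f : Fin k → Option (Msg V l)) (i : Fin k) :
    msgsTo (.server i) ((List.finRange k).filterMap fun j =>
      (f j).map fun m => (.send (.server j) m : Output V l)) = (f i).toList := by
  rw [msgsTo, List.filterMap_filterMap, ← filterMap_ite_eq f i _ (List.nodup_finRange k)
    (List.mem_finRange i)]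
  congr 1
  funext j
  rcases f j with _ | m <;> simp

theorem msgsTo_scatter_ne {p : Proc k l} (f : Fin k → Option (Msg V l))
    (hp : ∀ i, p ≠ .server i) :
    msgsTo p ((List.finRange k).filterMap fun j =>
      (f j).map fun m => (.send (.server j) m : Output V l)) = [] := by
  rw [msgsTo, List.filterMap_filterMap, List.filterMap_eq_nil_iff]
  intro j _
  rcases f j with _ | m <;> simp [(hp j).symm]

theorem respsOf_scatter (f : Fin k → Option (Msg V l)) :
    respsOf ((List.finRange k).filterMap fun j =>
      (f j).map fun m => (.send (.server j) m : Output V l)) = [] := by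
  rw [respsOf, List.filterMap_filterMap, List.filterMap_eq_nil_iff]
  intro j _
  rcases f j with _ | m <;> simp

theorem Invariant.inv_write {w : Fin l} {u : ∀ i, Option (V i)} {hu} {n : ℕ}
    (h : Invariant s g) (ht : (algorithmA l v₀).trans s (.inv (.writer w) (.write u hu)) s')
    (hb : g.busy (.writer w) = none) :
    Invariant s' (gstep g n (.inv (.writer w) (.write u hu))) := by
  obtain ⟨-, ⟨L, hh⟩, hch⟩ := trans_inv ht
  have hctl := h.writer w
  rw [hb] at hctl
  obtain ⟨hφ, hrsp⟩ := hctl.of_none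
  have hnext := hh.writer
  simp only [writerNext, hφ] at hnext
  obtain ⟨hwv, hL⟩ := Prod.mk.inj hnext
  have hk : wkey s' w = ((wv s w).z + 1, some w) := by rw [wkey, hwv]
  rw [← hk] at hwv hL
  have hL' : L = (List.finRange k).filterMap fun j =>
      ((u j).map fun v => (.writeValue (wkey s' w) j v : Msg V l)).map fun m =>
        (.send (.server j) m : Output V l) := by
    rw [hL]
    simp [Function.comp_def]
  have hb' : (gstep g n (.inv (.writer w) (.write u hu))).busy (.writer w) =
      some (n, .write u hu) := Function.update_self _ _ _
  have hd' : (gstep g n (.inv (.writer w) (.write u hu))).done (.writer w) = none :=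
    Function.update_self _ _ _
  -- By `bound`, keys of `w` that are stored have numbers at most the old counter. With the fresh
  -- key, `own` holds vacuously.
  have hfresh : ∀ i v, (wkey s' w, v) ∉ stored s i := by
    intro i v hv
    rw [hk] at hv
    have := h.bound i _ w v hv
    omega
  have hun : unacked (wv s' w).phase = Finset.univ.filter fun i => (u i).isSome := by
    rw [hwv]; rfl
  refine h.of_writer hh (fun _ _ _ _ => by simp [hch]) (fun p hp => Function.update_of_ne hp _ _)
    (fun p hp => Function.update_of_ne hp _ _) rfl (by simp [gstep]) (by simp [gstep])
    ?_ ?_ (by rw [hwv]; simp) ?_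
  · intro q hl
    have hidle := (h.link _ _ hl).idle (by
      cases hl <;> simp [Pending, hφ, unacked])
    cases hl with
    | writer_server _ j =>
      have ho := hh.out_self (.server j)
      rw [hidle.1, List.nil_append, hL', msgsTo_scatter] at ho
      have ho' : out s' (.server j) (.writer w) = out s (.server j) (.writer w) :=
        hh.out_ne (by simp) _
      refine ⟨fun hp => ?_, fun hp => ?_, fun _ => trivial⟩
      · rw [ho, ho', hch]
        have hp : (u j).isSome := by simpa [Pending, hun] using hp
        obtain ⟨v, hv⟩ := Option.isSome_iff_exists.1 hp
        exact Or.inl ⟨.writeValue (wkey s' w) j v,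
          ⟨n, u, hu, v, hb', hv, fun _ => rfl, by norm_num⟩, by simp [hv], hidle.2⟩
      · rw [ho, ho', hch]
        have hp : u j = none := by simpa [Pending, hun] using hp
        exact ⟨by simp [hp], hidle.2⟩
    | writer_reader =>
      have hP : ¬ Pending s' (.writer w) .reader := by simp [Pending, hwv]
      refine ⟨fun hp => absurd hp hP, fun _ => ?_, fun _ => trivial⟩
      rw [hh.out_self, hh.out_ne (by simp), hch, hL', msgsTo_scatter_ne _ (by simp)]
      simpa using hidle
  · have hr : rsp s' (.writer w) = [] := by
      rw [hh.rsp_self, hrsp, hL', respsOf_scatter]; rfl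
    rw [hb', hd', hr, hwv]
    refine .writing n u hu _ ?_ ?_
    · obtain ⟨i, hi⟩ := hu
      exact ⟨i, by simpa using hi⟩
    · intro i v hi hni
      simp [hi] at hni
  · intro _ _ _ _ i v hv
    exact absurd hv (hfresh i v)

theorem Invariant.inv_read {I : Finset (Fin k)} {hI} {n : ℕ}
    (h : Invariant s g) (ht : (algorithmA l v₀).trans s (.inv .reader (.read I hI)) s')
    (hb : g.busy .reader = none) :
    Invariant s' (gstep g n (.inv .reader (.read I hI))) := by
  obtain ⟨-, ⟨L, hh⟩, hch⟩ := trans_inv ht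
  have hctl := h.reader
  rw [hb] at hctl
  obtain ⟨hφ, hrsp⟩ := hctl.of_none
  have hnext := hh.reader
  simp only [readerNext, hφ] at hnext
  obtain ⟨hrv, hL⟩ := Prod.mk.inj hnext
  have hL' : L = (List.finRange k).filterMap fun j =>
      (if j ∈ I then some (.readValue (latestKey (rv s).list j) : Msg V l) else none).map fun m =>
        (.send (.server j) m : Output V l) := by
    rw [hL, ← List.filterMap_eq_map, List.filterMap_filter]
    congr 1
    funext j
    by_cases hj : j ∈ I <;> simp [hj]
  have hb' : (gstep g n (.inv .reader (.read I hI))).busy .reader =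
      some (n, .read I hI) := by simp [gstep]
  have hst : ∀ j, stored s' j = stored s j := fun j => stored_congr (hh.vars_ne _ (by simp))
  have hst' : stored s' = stored s := funext hst
  have hw : ∀ w, wv s' w = wv s w := fun w => hh.vars_ne (.writer w) (by simp)
  have hk : ∀ w, wkey s' w = wkey s w := fun w => by rw [wkey, hw w]; rfl
  have hpend : ∀ j, Pending s' (.reader : Proc k l) (.server j) ↔ j ∈ I := by
    intro j
    simp only [Pending, hrv]
    constructor
    · rintro ⟨I', y'', h1, h2, h3⟩
      cases h1
      exact h2
    · intro h2
      exact ⟨I, _, rfl, h2, rfl⟩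
  have hbw : ∀ w, (gstep g n (.inv .reader (.read I hI))).busy (.writer w) =
      g.busy (.writer w) := fun w => by simp [gstep]
  have hdw : ∀ w, (gstep g n (.inv .reader (.read I hI))).done (.writer w) =
      g.done (.writer w) := fun w => by simp [gstep]
  refine ⟨fun p q hl => ?_, fun w => ?_, ?_, ?_, ?_, ?_, ?_⟩
  · by_cases hp : p = .reader
    · subst hp
      cases hl with
      | reader_server j =>
        have hidle := (h.link _ _ (.reader_server j)).idle (by simp [Pending, hφ])
        have ho := hh.out_self (.server j)
        rw [hidle.1, List.nil_append, hL', msgsTo_scatter] at ho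
        have ho' : out s' (.server j) .reader = out s (.server j) .reader :=
          hh.out_ne (by simp) _
        refine ⟨fun hp => ?_, fun hp => ?_, fun hp => ?_⟩
        · rw [ho, ho', hch]
          rw [hpend] at hp
          refine Or.inl ⟨.readValue (latestKey (rv s).list j),
            ⟨latestKey (rv s).list j, ?_, ?_, fun _ => rfl, by norm_num⟩, by simp [hp], hidle.2⟩
          · simp [Ghost.rounds, gstep]
          -- The requested key leads to `cur j` by `list`, and `cur j` is what this invocation
          -- freezes as the snapshot.
          · rw [hst]
            simpa [gstep] using h.list j
        · rw [ho, ho', hch]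
          rw [hpend] at hp
          exact ⟨by simp [hp], hidle.2⟩
        · rw [hpend] at hp
          intro n₁ I₁ hI₁ hb₁
          rw [hb'] at hb₁
          cases hb₁
          exact ⟨fun h' => absurd h' hp, fun _ => by simp [Ghost.rounds, gstep]⟩
    · refine (h.link p q hl).handles_frame hl hh (by rw [hch]) (by rw [hch])
        (fun h' => absurd h' hp) ?_ (fun h' => absurd h' hp) (fun w h1 h2 => by cases h2)
        (Function.update_of_ne hp _ _) (fun _ => Function.update_of_ne hp _ _)
        (fun j _ => (hst j).ge) (fun h' => absurd h' hp)
      rintro rfl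
      rw [hL', msgsTo_scatter_ne _ hl.not_server]
  · rw [hst', hk, hw, hbw, hdw, hh.rsp_ne (by simp)]
    exact h.writer w
  · rw [hb', hrv, hh.rsp_self, hrsp, hL', respsOf_scatter]
    exact .reading n I hI _ ⟨hI.choose, hI.choose_spec, rfl⟩ fun _ => Or.inl rfl
  · rw [hrv, hst']; exact h.list
  · rw [hst']; exact h.unique
  · simp only [hst, hw]; exact h.bound
  · simp only [hst, hk, hbw]; exact h.own

theorem Invariant.step {a : Act V l} {n : ℕ} (h : Invariant s g)
    (ht : (algorithmA l v₀).trans s a s') (hb : ∀ p x, a = .inv p x → g.busy p = none) :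
    Invariant s' (gstep g n a) := by
  cases a with
  | inv p x =>
    have hb' := hb p x rfl
    have hx := (trans_inv ht).1
    cases p <;> cases x <;> try exact hx.elim
    · exact h.inv_write ht hb'
    · exact h.inv_read ht hb'
  | resp p y => exact h.resp ht
  | send p q m => exact h.send ht
  | recv p q m =>
    by_cases h1 : IsLink p q
    · cases h1 with
      | writer_server w i => exact (h.recv_writeValue ht).1
      | writer_reader w => exact (h.recv_informReader ht).1
      | reader_server i => exact (h.recv_readValue ht).1
    · by_cases h2 : IsLink q p
      · cases h2 with
        | writer_server w i => exact (h.recv_ack ht).1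
        | writer_reader w => exact (h.recv_ackTag ht).1
        | reader_server i => exact (h.recv_value ht).1
      · exact h.recv_irrelevant ht h1 h2

variable (l v₀) in
/-- The initial values of the history variables. -/
def ghost₀ : Ghost V l := ⟨fun _ => none, fun _ => none, v₀, v₀, fun _ => []⟩

theorem Invariant.start (hs : s ∈ (algorithmA l v₀).start) : Invariant s (ghost₀ l v₀) := by
  have h : ∀ p, s (.proc p) = ((program v₀ p).init, []) := fun p => hs (.proc p)
  have hc : ∀ p q, ch s p q = 0 := fun p q => hs (.chan p q)
  have hv : ∀ p, vars s p = (program v₀ p).init := fun p => by rw [vars, h]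
  have hq : ∀ p, que s p = [] := fun p => by rw [que, h]
  have hr : ∀ p, rsp s p = [] := fun p => by rw [rsp, hq]; rfl
  have ho : ∀ p q, out s p q = [] := fun p q => by rw [out, hq]; rfl
  have hw : ∀ w, wv s w = ⟨0, .idle⟩ := fun w => hv (.writer w)
  have hrv : rv s = ⟨[(key0 l, fun _ => true)], none⟩ := hv .reader
  have hst : ∀ i, stored s i = {(key0 l, v₀ i)} := fun i => by rw [stored, hv]; rfl
  refine ⟨fun p q hl => ?_, fun w => ?_, ?_, ?_, ?_, ?_, ?_⟩
  · have hP : ¬ Pending s p q := by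
      cases hl <;> simp [Pending, hw, hrv, unacked]
    refine ⟨fun h => absurd h hP, fun _ => ⟨ho _ _, hc _ _, ho _ _, hc _ _⟩, fun _ => ?_⟩
    cases hl with
    | reader_server i => intro _ _ _ hb; cases hb
    | _ => trivial
  · rw [hw, hr]; exact .idle _
  · rw [hrv, hr]; exact .idle
  · intro i
    simp [hrv, hst, latestKey, ghost₀]
  · intro i κ v v' h1 h2
    rw [hst] at h1 h2
    exact (Prod.mk.inj h1).2.trans (Prod.mk.inj h2).2.symm
  · intro i z w v h1
    rw [hst] at h1
    cases h1
  · intro _ _ _ _ hb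
    cases hb

end Recv

/-! ### What the history variables say about the sequence of actions -/

section History

variable {k l : ℕ} {V : Fin k → Type u} {v₀ : ∀ i, V i}

/-- The history variables before the event `t`. -/
def ghost (v₀ : ∀ i, V i) (act : ℕ → Option (Act V l)) : ℕ → Ghost V l
  | 0 => ghost₀ l v₀
  | n + 1 => match act n with
    | none => ghost v₀ act n
    | some a => gstep (ghost v₀ act n) n a

variable {act : ℕ → Option (Act V l)}

theorem ghost_succ_none {t : ℕ} (h : act t = none) : ghost v₀ act (t + 1) = ghost v₀ act t := by
  simp only [ghost, h]

theorem ghost_succ {t : ℕ} {a} (h : act t = some a) :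
    ghost v₀ act (t + 1) = gstep (ghost v₀ act t) t a := by
  simp only [ghost, h]

theorem gstep_busy {g : Ghost V l} {n : ℕ} {a : Act V l} {p : Proc k l}
    (h1 : ∀ x, a ≠ .inv p x) (h2 : ∀ y, a ≠ .resp p y) : (gstep g n a).busy p = g.busy p := by
  unfold gstep
  split
  · refine Function.update_of_ne ?_ _ _
    rintro rfl; exact h1 _ rfl
  · refine Function.update_of_ne ?_ _ _
    rintro rfl; exact h2 _ rfl
  · rfl
  · rfl
  · rfl

theorem gstep_snap {g : Ghost V l} {n : ℕ} {a : Act V l}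
    (h1 : ∀ x, a ≠ .inv .reader x) : (gstep g n a).snap = g.snap := by
  unfold gstep
  split
  · refine if_neg ?_
    rintro rfl; exact h1 _ rfl
  all_goals rfl

theorem gstep_done {g : Ghost V l} {n : ℕ} {a : Act V l} {p : Proc k l}
    (h1 : ∀ x, a ≠ .inv p x) (h2 : ∀ κ b, a ≠ .recv p .reader (.informReader κ b)) :
    (gstep g n a).done p = g.done p := by
  unfold gstep
  split
  · refine Function.update_of_ne ?_ _ _
    rintro rfl; exact h1 _ rfl
  · rfl
  · rfl
  · refine Function.update_of_ne ?_ _ _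
    rintro rfl; exact h2 _ _ rfl
  · rfl

theorem gstep_cur {g : Ghost V l} {n : ℕ} {a : Act V l}
    (h : ∀ w κ b, a ≠ .recv (.writer w) .reader (.informReader κ b)) :
    (gstep g n a).cur = g.cur := by
  unfold gstep
  split
  case h_4 => exact absurd rfl (h _ _ _)
  all_goals rfl

theorem gstep_hist {g : Ghost V l} {n : ℕ} {a : Act V l} {i : Fin k}
    (h1 : ∀ x, a ≠ .inv .reader x) :
    IsReaderServerEvent i (some a) ∧
      (gstep g n a).hist (.server i) = g.hist (.server i) ++ [(n, a)] ∨
    ¬ IsReaderServerEvent i (some a) ∧ (gstep g n a).hist (.server i) = g.hist (.server i) := by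
  have key : ∀ (p q : Proc k l) (e : ℕ × Act V l),
      ((p = .reader ∧ q = .server i ∨ p = .server i ∧ q = .reader) ∧
        record g.hist p q e (.server i) = g.hist (.server i) ++ [e]) ∨
      (¬ (p = .reader ∧ q = .server i ∨ p = .server i ∧ q = .reader) ∧
        record g.hist p q e (.server i) = g.hist (.server i)) := by
    intro p q e
    by_cases h : p = .reader ∧ q = .server i ∨ p = .server i ∧ q = .reader
    · refine Or.inl ⟨h, ?_⟩
      rcases h with ⟨rfl, rfl⟩ | ⟨rfl, rfl⟩ <;> simp [record]
    · refine Or.inr ⟨h, record_ne ?_ ?_⟩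
      · rintro h'; cases h'; exact h (Or.inl ⟨rfl, rfl⟩)
      · rintro h'; cases h'; exact h (Or.inr ⟨rfl, rfl⟩)
  unfold gstep
  split
  · rename_i p x
    refine Or.inr ⟨?_, ?_⟩
    · simp [IsReaderServerEvent]
    · have : p ≠ .reader := by rintro rfl; exact h1 _ rfl
      simp [this]
  · exact Or.inr ⟨by simp [IsReaderServerEvent], rfl⟩
  · rename_i p q m
    rcases key p q (n, .send p q m) with ⟨h, h'⟩ | ⟨h, h'⟩
    · refine Or.inl ⟨?_, h'⟩
      rcases h with ⟨rfl, rfl⟩ | ⟨rfl, rfl⟩ <;> simp [IsReaderServerEvent]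
    · refine Or.inr ⟨?_, h'⟩
      simp only [IsReaderServerEvent, Option.some.injEq, Act.send.injEq, reduceCtorEq, false_or,
        or_false]
      rintro ⟨m', ⟨rfl, rfl, -⟩ | ⟨rfl, rfl, -⟩⟩
      · exact h (Or.inl ⟨rfl, rfl⟩)
      · exact h (Or.inr ⟨rfl, rfl⟩)
  · exact Or.inr ⟨by simp [IsReaderServerEvent], rfl⟩
  · rename_i p q m _
    rcases key p q (n, .recv p q m) with ⟨h, h'⟩ | ⟨h, h'⟩
    · refine Or.inl ⟨?_, h'⟩
      rcases h with ⟨rfl, rfl⟩ | ⟨rfl, rfl⟩ <;> simp [IsReaderServerEvent]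
    · refine Or.inr ⟨?_, h'⟩
      simp only [IsReaderServerEvent, Option.some.injEq, Act.recv.injEq, reduceCtorEq, false_or]
      rintro ⟨m', ⟨rfl, rfl, -⟩ | ⟨rfl, rfl, -⟩⟩
      · exact h (Or.inl ⟨rfl, rfl⟩)
      · exact h (Or.inr ⟨rfl, rfl⟩)

/-- The transaction in progress was invoked at position `n`, and since then its client had no
invocation and no response. -/
theorem of_busy {t n : ℕ} {p : Proc k l} {x : Inv V}
    (h : (ghost v₀ act t).busy p = some (n, x)) :
    n < t ∧ act n = some (.inv p x) ∧ ∀ j, n < j → j < t →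
      (∀ y, act j ≠ some (.resp p y)) ∧ ∀ x', act j ≠ some (.inv p x') := by
  induction t with
  | zero => cases h
  | succ t ih =>
    have step : (ghost v₀ act t).busy p = some (n, x) → (∀ y, act t ≠ some (.resp p y)) →
        (∀ x', act t ≠ some (.inv p x')) →
        n < t + 1 ∧ act n = some (.inv p x) ∧ ∀ j, n < j → j < t + 1 →
          (∀ y, act j ≠ some (.resp p y)) ∧ ∀ x', act j ≠ some (.inv p x') := by
      intro h h1 h2
      obtain ⟨h3, h4, h5⟩ := ih h
      refine ⟨by omega, h4, fun j hj hj' => ?_⟩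
      rcases Nat.lt_succ_iff_lt_or_eq.1 hj' with hj' | rfl
      · exact h5 j hj hj'
      · exact ⟨h1, h2⟩
    rcases ha : act t with _ | a
    · rw [ghost_succ_none ha] at h
      exact step h (by simp [ha]) (by simp [ha])
    · rw [ghost_succ ha] at h
      by_cases h1 : ∃ x, a = .inv p x
      · obtain ⟨x', rfl⟩ := h1
        simp only [gstep, Function.update_self, Option.some.injEq, Prod.mk.injEq] at h
        obtain ⟨rfl, rfl⟩ := h
        exact ⟨by omega, ha, fun j hj hj' => by omega⟩
      · by_cases h2 : ∃ y, a = .resp p y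
        · obtain ⟨y, rfl⟩ := h2
          simp [gstep] at h
        · push Not at h1 h2
          rw [gstep_busy h1 h2] at h
          refine step h ?_ ?_
          · intro y hy; rw [ha] at hy; exact h2 y (Option.some.inj hy)
          · intro y hy; rw [ha] at hy; exact h1 y (Option.some.inj hy)

/-- If no transaction is in progress, each earlier invocation has been answered. -/
theorem of_not_busy {t n : ℕ} {p : Proc k l} {x : Inv V}
    (h : (ghost v₀ act t).busy p = none) (hn : n < t) (hx : act n = some (.inv p x)) :
    ∃ j, n < j ∧ j < t ∧ ∃ y, act j = some (.resp p y) := by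
  induction t with
  | zero => omega
  | succ t ih =>
    rcases ha : act t with _ | a
    · rw [ghost_succ_none ha] at h
      have : n ≠ t := by rintro rfl; simp [ha] at hx
      obtain ⟨j, h1, h2, h3⟩ := ih h (by omega)
      exact ⟨j, h1, by omega, h3⟩
    · rw [ghost_succ ha] at h
      by_cases h1 : ∃ x, a = .inv p x
      · obtain ⟨x', rfl⟩ := h1
        simp [gstep] at h
      · have hnt : n ≠ t := by
          rintro rfl
          rw [ha] at hx
          exact h1 ⟨x, Option.some.inj hx⟩
        by_cases h2 : ∃ y, a = .resp p y
        · obtain ⟨y, rfl⟩ := h2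
          exact ⟨t, by omega, by omega, y, ha⟩
        · push Not at h1 h2
          rw [gstep_busy h1 h2] at h
          obtain ⟨j, h1, h2, h3⟩ := ih h (by omega)
          exact ⟨j, h1, by omega, h3⟩

/-- A transaction still in progress would have been answered by well-formedness, but `of_busy`
excludes a response since its invocation. -/
theorem WellFormed.not_busy (hwf : WellFormed act) {t : ℕ} {p : Proc k l} {x : Inv V}
    (hx : act t = some (.inv p x)) : (ghost v₀ act t).busy p = none := by
  rcases h : (ghost v₀ act t).busy p with _ | ⟨n, x'⟩
  · rfl
  · obtain ⟨h1, h2, h3⟩ := of_busy h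
    obtain ⟨m, hm, p', x'', y, h4, h5, h6, -⟩ := hwf n t p x' x h1 h2 hx
    rw [h2] at h4
    cases h4
    exact absurd h5 ((h3 m h6 hm).1 y)

/-- Some transaction is in progress by `of_not_busy`. If it was invoked after `n`, well-formedness
yields a response that `hr` excludes; if before, `of_busy` excludes the invocation at `n`. -/
theorem WellFormed.busy (hwf : WellFormed act) {t n : ℕ} {p : Proc k l} {x : Inv V}
    (hx : act n = some (.inv p x)) (hn : n < t)
    (hr : ∀ j, n < j → j < t → ∀ y, act j ≠ some (.resp p y)) :
    (ghost v₀ act t).busy p = some (n, x) := by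
  rcases h : (ghost v₀ act t).busy p with _ | ⟨n', x'⟩
  · obtain ⟨j, h1, h2, y, h3⟩ := of_not_busy h hn hx
    exact absurd h3 (hr j h1 h2 y)
  · obtain ⟨h1, h2, h3⟩ := of_busy h
    rcases lt_trichotomy n n' with hlt | rfl | hlt
    · obtain ⟨m, hm, p', x'', y, h4, h5, h6, -⟩ := hwf n n' p x x' hlt hx h2
      rw [hx] at h4
      cases h4
      exact absurd h5 (hr m h6 (by omega) y)
    · rw [hx] at h2
      cases h2
      rfl
    · exact absurd hx ((h3 n hlt hn).2 x)

theorem IsResponse.busy (hwf : WellFormed act) {n m : ℕ} {p : Proc k l} {x : Inv V}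
    (h : IsResponse act n m) (hx : act n = some (.inv p x)) :
    (ghost v₀ act m).busy p = some (n, x) ∧ ∃ y, act m = some (.resp p y) := by
  obtain ⟨p', x', y, h1, h2, h3, h4⟩ := h
  rw [hx] at h1
  cases h1
  exact ⟨hwf.busy hx h3 h4, y, h2⟩

theorem isResponse_of_busy {n m : ℕ} {p : Proc k l} {x : Inv V} {y}
    (h : (ghost v₀ act m).busy p = some (n, x)) (hy : act m = some (.resp p y)) :
    IsResponse act n m := by
  obtain ⟨h1, h2, h3⟩ := of_busy h
  exact ⟨p, x, y, h2, hy, h1, fun j hj hj' => (h3 j hj hj').1⟩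

theorem snap_of_busy {t n : ℕ} {x : Inv V} (h : (ghost v₀ act t).busy .reader = some (n, x)) :
    (ghost v₀ act t).snap = (ghost v₀ act n).cur := by
  induction t with
  | zero => cases h
  | succ t ih =>
    rcases ha : act t with _ | a
    · rw [ghost_succ_none ha] at h ⊢
      exact ih h
    · rw [ghost_succ ha] at h ⊢
      by_cases h1 : ∃ x, a = .inv .reader x
      · obtain ⟨x', rfl⟩ := h1
        simp only [gstep, Function.update_self, Option.some.injEq, Prod.mk.injEq] at h
        obtain ⟨rfl, rfl⟩ := h
        simp [gstep]
      · by_cases h2 : ∃ y, a = .resp .reader y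
        · obtain ⟨y, rfl⟩ := h2
          simp [gstep] at h
        · push Not at h1 h2
          rw [gstep_busy h1 h2] at h
          rw [gstep_snap h1]
          exact ih h

/-- An invocation resets `done`, so a value found during a transaction was set by that same
transaction. -/
theorem done_of_busy {t n e : ℕ} {p : Proc k l} {x : Inv V}
    (h : (ghost v₀ act t).busy p = some (n, x)) (hd : (ghost v₀ act t).done p = some e) :
    (∃ κ b, act e = some (.recv p .reader (.informReader κ b))) ∧
      (ghost v₀ act e).busy p = some (n, x) := by
  induction t with
  | zero => cases h
  | succ t ih =>
    rcases ha : act t with _ | a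
    · rw [ghost_succ_none ha] at h hd
      exact ih h hd
    · rw [ghost_succ ha] at h hd
      by_cases h1 : ∃ x, a = .inv p x
      · obtain ⟨x', rfl⟩ := h1
        simp [gstep] at hd
      · by_cases h2 : ∃ y, a = .resp p y
        · obtain ⟨y, rfl⟩ := h2
          simp [gstep] at h
        · push Not at h1 h2
          rw [gstep_busy h1 h2] at h
          by_cases h3 : ∃ κ b, a = .recv p .reader (.informReader κ b)
          · obtain ⟨κ, b, rfl⟩ := h3
            by_cases hp : ∃ w, p = .writer w
            · obtain ⟨w, rfl⟩ := hp
              simp only [gstep, Function.update_self, Option.some.injEq] at hd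
              subst hd
              exact ⟨⟨κ, b, ha⟩, h⟩
            · refine ih h ?_
              cases p with
              | writer w => exact absurd ⟨w, rfl⟩ hp
              | reader => simpa [gstep] using hd
              | server i => simpa [gstep] using hd
          · push Not at h3
            rw [gstep_done h1 h3] at hd
            exact ih h hd

/-- The history is cleared when a READ begins. Thus statements of the invariant about `rounds`
become statements about positions in the execution, in increasing order and with no event left out.
-/
theorem hist_of_busy {t n : ℕ} {x : Inv V} (i : Fin k)
    (h : (ghost v₀ act t).busy .reader = some (n, x)) :
    ((ghost v₀ act t).hist (.server i)).Pairwise (fun a b => a.1 < b.1) ∧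
      ∀ e a, (e, a) ∈ (ghost v₀ act t).hist (.server i) ↔
        n < e ∧ e < t ∧ act e = some a ∧ IsReaderServerEvent i (some a) := by
  induction t with
  | zero => cases h
  | succ t ih =>
    rcases ha : act t with _ | a
    · rw [ghost_succ_none ha] at h ⊢
      obtain ⟨h1, h2⟩ := ih h
      refine ⟨h1, fun e a => ?_⟩
      rw [h2]
      refine and_congr_right fun _ => ?_
      constructor
      · rintro ⟨h3, h4⟩; exact ⟨by omega, h4⟩
      · rintro ⟨h3, h4, h5⟩
        refine ⟨?_, h4, h5⟩
        rcases Nat.lt_succ_iff_lt_or_eq.1 h3 with h3 | rfl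
        · exact h3
        · rw [ha] at h4; cases h4
    · rw [ghost_succ ha] at h ⊢
      by_cases h1 : ∃ x, a = .inv .reader x
      · obtain ⟨x', rfl⟩ := h1
        simp only [gstep, Function.update_self, Option.some.injEq, Prod.mk.injEq] at h
        obtain ⟨rfl, rfl⟩ := h
        simp only [gstep, if_true, List.not_mem_nil, false_iff]
        exact ⟨List.Pairwise.nil, fun e a => by omega⟩
      · by_cases h2 : ∃ y, a = .resp .reader y
        · obtain ⟨y, rfl⟩ := h2
          simp [gstep] at h
        · push Not at h1 h2
          rw [gstep_busy h1 h2] at h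
          obtain ⟨h3, h4⟩ := ih h
          have hn := (of_busy h).1
          rcases gstep_hist (g := ghost v₀ act t) (n := t) (i := i) h1 with ⟨h5, h6⟩ | ⟨h5, h6⟩
          · rw [h6]
            refine ⟨?_, fun e b => ?_⟩
            · rw [List.pairwise_append]
              refine ⟨h3, List.pairwise_singleton _ _, ?_⟩
              rintro ⟨e, b⟩ hb c hc
              rw [List.mem_singleton] at hc
              subst hc
              exact ((h4 e b).1 hb).2.1
            · rw [List.mem_append, h4, List.mem_singleton, Prod.mk.injEq]
              constructor
              · rintro (⟨h7, h8, h9⟩ | ⟨rfl, rfl⟩)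
                · exact ⟨h7, by omega, h9⟩
                · exact ⟨hn, by omega, ha, h5⟩
              · rintro ⟨h7, h8, h9, h10⟩
                rcases Nat.lt_succ_iff_lt_or_eq.1 h8 with h8 | rfl
                · exact Or.inl ⟨h7, h8, h9, h10⟩
                · rw [ha] at h9
                  exact Or.inr ⟨rfl, (Option.some.inj h9).symm⟩
          · rw [h6]
            refine ⟨h3, fun e b => ?_⟩
            rw [h4]
            refine and_congr_right fun _ => ?_
            constructor
            · rintro ⟨h3, h4⟩; exact ⟨by omega, h4⟩
            · rintro ⟨h7, h8, h9⟩
              refine ⟨?_, h8, h9⟩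
              rcases Nat.lt_succ_iff_lt_or_eq.1 h7 with h7 | rfl
              · exact h7
              · rw [ha] at h8
                cases h8
                exact absurd h9 h5

end History

/-! ### The invariant along executions, and one round per object read -/

section Executions

variable {k l : ℕ} {V : Fin k → Type u} {v₀ : ∀ i, V i} {α : (algorithmA l v₀).Fragment}

theorem invariant (hα : α.IsExecution) (hwf : WellFormed α.act) (t : ℕ) :
    Invariant (α.state t) (ghost v₀ α.act t) := by
  induction t with
  | zero => exact Invariant.start hα
  | succ t ih =>
    rcases ha : α.act t with _ | a
    · rw [ghost_succ_none ha, (α.ended t ha).2]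
      exact ih
    · rw [ghost_succ ha]
      refine ih.step (α.step t a ha) ?_
      rintro p x rfl
      exact hwf.not_busy ha

/-- The invariant does not speak about responses of servers; this excludes them in `response_cases`.
-/
theorem rsp_server_eq_nil (hα : α.IsExecution) (i : Fin k) (t : ℕ) :
    rsp (α.state t) (.server i) = [] := by
  induction t with
  | zero =>
    have h : α.state 0 (.proc (.server i)) = (_, []) := hα (.proc (.server i))
    rw [rsp, que, h]
    rfl
  | succ t ih =>
    rcases ha : α.act t with _ | a
    · rw [(α.ended t ha).2]
      exact ih
    · have ht := α.step t a ha
      cases a with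
      | inv p x =>
        obtain ⟨hx, ⟨L, hh⟩, -⟩ := trans_inv ht
        rw [hh.rsp_ne]
        · exact ih
        · rintro rfl; cases x <;> exact hx
      | resp p y =>
        obtain ⟨he, -⟩ := trans_resp ht
        by_cases hp : .server i = p
        · subst hp
          rw [he.rsp_resp] at ih
          cases ih
        · rw [he.rsp_ne hp, ih]
      | send p q m => rw [(trans_send ht).1.rsp_send, ih]
      | recv p q m =>
        obtain ⟨L, hh, -⟩ := trans_recv ht
        by_cases hp : .server i = q
        · subst hp
          rw [hh.rsp_self, ih, List.nil_append]
          have := hh.server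
          unfold serverNext at this
          split at this
          · split at this
            · rw [(Prod.mk.inj this).2]; simp
            · rw [(Prod.mk.inj this).2]; simp
          · rcases this with ⟨v, -, h⟩ | ⟨-, h⟩ <;> rw [(Prod.mk.inj h).2] <;> simp
          · rw [(Prod.mk.inj this).2]; simp
        · rw [hh.rsp_ne hp, ih]

/-- A response, its transaction and the state of its client. -/
theorem response_cases (hα : α.IsExecution) (hwf : WellFormed α.act) {m : ℕ} {p : Proc k l} {y}
    (hy : α.act m = some (.resp p y)) :
    (∃ w n u hu, p = .writer w ∧ (ghost v₀ α.act m).busy p = some (n, .write u hu) ∧ y = .ok ∧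
      (ghost v₀ α.act m).done p ≠ none) ∨
    ∃ n I hI, p = .reader ∧ (ghost v₀ α.act m).busy p = some (n, .read I hI) ∧
      (rv (α.state m)).phase = none ∧
      y = .vals fun i => if i ∈ I then some ((ghost v₀ α.act m).snap i) else none := by
  have hr := (trans_resp (α.step m _ hy)).1.rsp_resp
  have hI := invariant hα hwf m
  cases p with
  | writer w =>
    have h := hI.writer w
    rw [hr] at h
    obtain ⟨-, -, h1, h2, n, u, hu, h3⟩ := h.of_cons
    exact Or.inl ⟨w, n, u, hu, rfl, h3, h1, h2⟩
  | reader =>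
    have h := hI.reader
    rw [hr] at h
    obtain ⟨h1, -, n, I, hI, h2, h3⟩ := h.of_cons
    exact Or.inr ⟨n, I, hI, rfl, h2, h1, h3⟩
  | server i =>
    rw [rsp_server_eq_nil hα] at hr
    cases hr

theorem response_answers (hα : α.IsExecution) (hwf : WellFormed α.act) {m : ℕ} {p : Proc k l} {y}
    (hy : α.act m = some (.resp p y)) : ∃ n, IsResponse α.act n m := by
  rcases response_cases hα hwf hy with ⟨w, n, u, hu, rfl, h, -⟩ | ⟨n, I, hI, rfl, h, -⟩
  · exact ⟨n, isResponse_of_busy h hy⟩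
  · exact ⟨n, isResponse_of_busy h hy⟩

/-- When the reader responds it awaits nothing, so all its exchanges are settled: the events
recorded with a server are exactly one round or none. -/
theorem oneResponse (hα : α.IsExecution) (hwf : WellFormed α.act) : OneResponse α.act := by
  intro n m I hI hx hres
  obtain ⟨hb, y, hy⟩ := hres.busy (v₀ := v₀) hwf hx
  rcases response_cases hα hwf hy with ⟨w, n, u, hu, h, -⟩ | ⟨n', I', hI', -, h, hφ, rfl⟩
  · cases h
  rw [hb] at h
  cases h
  refine ⟨_, hy, fun i => ?_⟩
  have hs := ((invariant hα hwf m).link _ _ (.reader_server i)).settled (by simp [Pending, hφ])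
    n I hI hb
  obtain ⟨hsort, hmem⟩ := hist_of_busy i hb
  refine ⟨fun hi => ?_, fun hi => ?_⟩
  · obtain ⟨κ, hκ⟩ := hs.1 hi
    rw [Ghost.rounds, round] at hκ
    generalize (ghost v₀ α.act m).hist (.server i) = H at hκ hsort hmem
    obtain ⟨⟨e₁, a₁⟩, H, rfl, ha₁, hκ⟩ := List.map_eq_cons_iff.1 hκ
    obtain ⟨⟨e₂, a₂⟩, H, rfl, ha₂, hκ⟩ := List.map_eq_cons_iff.1 hκ
    obtain ⟨⟨e₃, a₃⟩, H, rfl, ha₃, hκ⟩ := List.map_eq_cons_iff.1 hκ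
    obtain ⟨⟨e₄, a₄⟩, H, rfl, ha₄, hκ⟩ := List.map_eq_cons_iff.1 hκ
    obtain rfl := List.map_eq_nil_iff.1 hκ
    dsimp only at ha₁ ha₂ ha₃ ha₄
    subst ha₁ ha₂ ha₃ ha₄
    have h₁ := (hmem e₁ _).1 (.head _)
    have h₂ := (hmem e₂ _).1 (.tail _ (.head _))
    have h₃ := (hmem e₃ _).1 (.tail _ (.tail _ (.head _)))
    have h₄ := (hmem e₄ _).1 (.tail _ (.tail _ (.tail _ (.head _))))
    simp only [List.pairwise_cons, List.mem_cons, forall_eq_or_imp] at hsort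
    refine ⟨e₁, e₂, e₃, e₄, κ, _, h₁.1, hsort.1.1, hsort.2.1.1, hsort.2.2.1.1, h₄.2.1, h₁.2.2.1,
      h₂.2.2.1, h₃.2.2.1, h₄.2.2.1, by simp [hi], fun e he he' hev => ?_⟩
    rcases ha : α.act e with _ | a
    · rw [ha] at hev
      simp [IsReaderServerEvent] at hev
    · rw [ha] at hev
      have := (hmem e a).2 ⟨he, he', ha, hev⟩
      simp only [List.mem_cons, Prod.mk.injEq, List.not_mem_nil, or_false] at this
      tauto
  · refine ⟨by simp [hi], fun e he he' hev => ?_⟩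
    rcases ha : α.act e with _ | a
    · rw [ha] at hev
      simp [IsReaderServerEvent] at hev
    · rw [ha] at hev
      have := (hmem e a).2 ⟨he, he', ha, hev⟩
      have h0 : (ghost v₀ α.act m).hist (.server i) = [] := List.map_eq_nil_iff.1 (hs.2 hi)
      rw [h0] at this
      cases this

end Executions

/-! ### Strict serializability -/

section Serialization

variable {k l : ℕ} {V : Fin k → Type u} {v₀ : ∀ i, V i} {α : (algorithmA l v₀).Fragment}

variable (v₀) in
/-- The transaction that takes effect at the event `e`: a `READ` at its invocation, a `WRITE` when
the reader is informed of it. -/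
def effect (act : ℕ → Option (Act V l)) (e : ℕ) : Option ℕ :=
  match act e with
  | some (.inv .reader _) => some e
  | some (.recv (.writer w) .reader (.informReader _ _)) =>
    ((ghost v₀ act e).busy (.writer w)).map Prod.fst
  | _ => none

theorem effect_read {act : ℕ → Option (Act V l)} {e : ℕ} {x} (h : act e = some (.inv .reader x)) :
    effect v₀ act e = some e := by
  simp only [effect, h]

theorem effect_write {act : ℕ → Option (Act V l)} {e : ℕ} {w κ b}
    (h : act e = some (.recv (.writer w) .reader (.informReader κ b))) :
    effect v₀ act e = ((ghost v₀ act e).busy (.writer w)).map Prod.fst := by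
  simp only [effect, h]

theorem effect_cases {act : ℕ → Option (Act V l)} {e n : ℕ} (h : effect v₀ act e = some n) :
    (n = e ∧ ∃ x, act e = some (.inv .reader x)) ∨
    ∃ w κ b x, act e = some (.recv (.writer w) .reader (.informReader κ b)) ∧
      (ghost v₀ act e).busy (.writer w) = some (n, x) := by
  unfold effect at h
  split at h
  · rename_i x hx
    exact Or.inl ⟨(Option.some.inj h).symm, x, hx⟩
  · rename_i w κ b hx
    obtain ⟨⟨n', x⟩, h1, rfl⟩ := Option.map_eq_some_iff.1 h
    exact Or.inr ⟨w, κ, b, x, hx, h1⟩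
  · cases h

/-- The state of a writer when the reader is informed. -/
theorem Invariant.informed {s s' : (algorithmA l v₀).State} {g : Ghost V l} (h : Invariant s g)
    {w : Fin l} {m} (ht : (algorithmA l v₀).trans s (.recv (.writer w) .reader m) s') :
    ∃ n u hu, g.busy (.writer w) = some (n, .write u hu) ∧ g.done (.writer w) = none := by
  obtain ⟨L, hh, hch, hcf⟩ := trans_recv ht
  have hp := (h.link _ _ (.writer_reader w)).pending_of_request hch
  have ha := (h.link _ _ (.writer_reader w)).active hp
  rw [hch] at ha
  obtain ⟨⟨n', u, hu, hb, hm, -⟩, -⟩ := ha.recv_request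
  exact ⟨n', u, hu, hb, (hm (by norm_num)).2⟩

/-- A READ takes effect at its own invocation; a WRITE is still in progress when the reader is
informed, so its response cannot have come earlier. -/
theorem effect_lt_response {e n : ℕ} (h : effect v₀ α.act e = some n) :
    (∃ p x, α.act n = some (.inv p x)) ∧ n ≤ e ∧ ∀ m, IsResponse α.act n m → e < m := by
  rcases effect_cases h with ⟨rfl, x, hx⟩ | ⟨w, κ, b, x, hx, hb⟩
  · refine ⟨⟨_, x, hx⟩, le_rfl, ?_⟩
    rintro m ⟨p, x, y, -, -, h, -⟩
    exact h
  · obtain ⟨h1, h2, h3⟩ := of_busy hb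
    refine ⟨⟨_, x, h2⟩, h1.le, ?_⟩
    rintro m ⟨p, x', y, h4, h5, h6, -⟩
    rw [h2] at h4
    cases h4
    rcases lt_trichotomy m e with hm | rfl | hm
    · exact absurd h5 ((h3 m h6 hm).1 y)
    · rw [hx] at h5; cases h5
    · exact hm

theorem cur_of_effect_eq_none (hα : α.IsExecution) (hwf : WellFormed α.act) {e : ℕ}
    (h : effect v₀ α.act e = none) :
    (ghost v₀ α.act (e + 1)).cur = (ghost v₀ α.act e).cur := by
  rcases ha : α.act e with _ | a
  · rw [ghost_succ_none ha]
  · rw [ghost_succ ha]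
    refine gstep_cur ?_
    rintro w κ b rfl
    obtain ⟨n, u, hu, hb, -⟩ := (invariant hα hwf e).informed (α.step e _ ha)
    rw [effect_write ha, hb] at h
    cases h

/-- A READ returns the snapshot, which by `snap_of_busy` is `cur` at its invocation and hence at its
effect. For a WRITE, `gstep` applies the data type to `cur`, and the only response is `ok`. -/
theorem dataType_of_effect (hα : α.IsExecution) (hwf : WellFormed α.act) {e n : ℕ}
    (h : effect v₀ α.act e = some n) {p : Proc k l} {x : Inv V}
    (hx : α.act n = some (.inv p x)) :
    (ghost v₀ α.act (e + 1)).cur = (dataType x (ghost v₀ α.act e).cur).2 ∧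
    ∀ m y, IsResponse α.act n m → α.act m = some (.resp p y) →
      y = (dataType x (ghost v₀ α.act e).cur).1 := by
  rcases effect_cases h with ⟨rfl, x', hx'⟩ | ⟨w, κ, b, x', hx', hb⟩
  · rw [hx] at hx'
    cases hx'
    have hread : ∃ I hI, x = .read I hI := by
      have := (trans_inv (α.step n _ hx)).1
      cases x with
      | read I hI => exact ⟨I, hI, rfl⟩
      | write => exact this.elim
    obtain ⟨I, hI, rfl⟩ := hread
    refine ⟨?_, fun m y hres hy => ?_⟩
    · rw [ghost_succ hx, gstep_cur (by simp)]; rfl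
    · obtain ⟨hb, -⟩ := hres.busy (v₀ := v₀) hwf hx
      rcases response_cases hα hwf hy with ⟨w, n, u, hu, h, -⟩ | ⟨n', I', hI', -, h, hφ, rfl⟩
      · cases h
      · rw [hb] at h
        cases h
        rw [snap_of_busy hb]
        rfl
  · obtain ⟨h1, h2, h3⟩ := of_busy hb
    rw [hx] at h2
    cases h2
    obtain ⟨n', u, hu, hb', -⟩ := (invariant hα hwf e).informed (α.step e _ hx')
    rw [hb] at hb'
    cases hb'
    refine ⟨?_, fun m y hres hy => ?_⟩
    · rw [ghost_succ hx']
      simp only [gstep, hb]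
    · rcases response_cases hα hwf hy with ⟨w', n, u, hu, h, -, rfl, -⟩ | ⟨n', I', hI', h, -⟩
      · rfl
      · cases h

theorem effect_injective (hα : α.IsExecution) (hwf : WellFormed α.act) {e e' n : ℕ}
    (h : effect v₀ α.act e = some n) (h' : effect v₀ α.act e' = some n) : e = e' := by
  have key : ∀ {e e' : ℕ}, effect v₀ α.act e = some n → effect v₀ α.act e' = some n →
      ¬ e < e' := by
    intro e e' h h' hlt
    rcases effect_cases h with ⟨rfl, x, hx⟩ | ⟨w, κ, b, x, hx, hb⟩
    · rcases effect_cases h' with ⟨rfl, x', hx'⟩ | ⟨w', κ', b', x', hx', hb'⟩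
      · omega
      · have := (of_busy hb').2.1
        rw [hx] at this
        cases this
    · obtain ⟨h1, h2, -⟩ := of_busy hb
      rcases effect_cases h' with ⟨rfl, x', hx'⟩ | ⟨w', κ', b', x', hx', hb'⟩
      · rw [hx'] at h2
        cases h2
      · obtain ⟨-, h4, h5⟩ := of_busy hb'
        rw [h2] at h4
        cases h4
        -- Only an invocation at `w` resets `done`, and there is none while the same WRITE is in
        -- progress. But a message to inform the reader is received only with `done` unset, so it
        -- cannot arrive again at `e'`.
        have hdone : ∀ t, e < t → t ≤ e' → (ghost v₀ α.act t).done (.writer w) ≠ none := by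
          intro t ht
          induction t, ht using Nat.le_induction with
          | base =>
            intro _
            rw [ghost_succ hx]
            simp [gstep]
          | succ t ht ih =>
            intro hte
            have ih := ih (by omega)
            rcases ha : α.act t with _ | a
            · rwa [ghost_succ_none ha]
            · rw [ghost_succ ha]
              by_cases hi : ∃ κ b, a = .recv (.writer w) .reader (.informReader κ b)
              · obtain ⟨κ, b, rfl⟩ := hi
                simp [gstep]
              · push Not at hi
                rw [gstep_done ?_ hi]
                · exact ih
                · rintro y rfl
                  exact (h5 t (by omega) (by omega)).2 y ha
        obtain ⟨n', u, hu, -, hd⟩ := (invariant hα hwf e').informed (α.step e' _ hx')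
        exact hdone e' hlt le_rfl hd
  rcases lt_trichotomy e e' with hlt | rfl | hlt
  · exact absurd hlt (key h h')
  · rfl
  · exact absurd hlt (key h' h)

/-- A WRITE responds only with `done` set, and `done` is the position of its effect. -/
theorem exists_effect (hα : α.IsExecution) (hwf : WellFormed α.act) {n m : ℕ}
    (h : IsResponse α.act n m) : ∃ e, effect v₀ α.act e = some n := by
  obtain ⟨p, x, y, hx, hy, -⟩ := id h
  obtain ⟨hb, -⟩ := h.busy (v₀ := v₀) hwf hx
  rcases response_cases hα hwf hy with ⟨w', n', u, hu, rfl, h, -, hd⟩ | ⟨n', I', hI', rfl, h, -⟩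
  · obtain ⟨e, he⟩ := Option.ne_none_iff_exists'.1 hd
    obtain ⟨⟨κ, b, h1⟩, h2⟩ := done_of_busy hb he
    exact ⟨e, by rw [effect_write h1, h2]; rfl⟩
  · exact ⟨n, effect_read hx⟩

theorem strictlySerializable (hα : α.IsExecution) (hwf : WellFormed α.act) :
    StrictlySerializable v₀ α.act := by
  classical
  refine ⟨fun m p y => response_answers hα hwf, ?_⟩
  let E : ℕ → Prop := fun e => (effect v₀ α.act e).isSome
  -- For finite `E`, `Nat.nth E a` takes the default value 0 once the elements are exhausted;
  -- `Valid` ends the sequence there.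
  let Valid : ℕ → Prop := fun a => ∀ hf : (Set.ofPred E).Finite, a < hf.toFinset.card
  let order : ℕ → Option ℕ := fun a => if Valid a then effect v₀ α.act (Nat.nth E a) else none
  -- The serialization point is the effect, unique by `effect_injective`. The default 0 concerns
  -- transactions without effect, which `order` omits.
  let pt : ℕ → ℕ := fun n => if h : ∃ e, effect v₀ α.act e = some n then h.choose else 0
  let val : ℕ → ∀ i, V i := fun a => Nat.rec v₀ (fun a x => match order a with
    | some n => match α.act n with
      | some (.inv _ y) => (dataType y x).2
      | _ => x
    | none => x) a
  have hpt : ∀ e n, effect v₀ α.act e = some n → pt n = e := by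
    intro e n h
    have hex : ∃ e, effect v₀ α.act e = some n := ⟨e, h⟩
    have : pt n = hex.choose := dif_pos hex
    rw [this]
    exact effect_injective hα hwf hex.choose_spec h
  have hval : ∀ a, Valid a → E (Nat.nth E a) := fun a ha => Nat.nth_mem a ha
  have horder : ∀ a n, order a = some n →
      Valid a ∧ effect v₀ α.act (Nat.nth E a) = some n := by
    intro a n h
    by_cases ha : Valid a
    · exact ⟨ha, by simpa [order, ha] using h⟩
    · simp [order, ha] at h
  have hcount : ∀ e, E e → order (Nat.count E e) = effect v₀ α.act e := by
    intro e he
    have hv : Valid (Nat.count E e) := fun hf => Nat.count_lt_card hf he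
    simp only [order, if_pos hv, Nat.nth_count he]
  -- Running the serial order up to event `t` produces the history variable `cur` at `t`; this links
  -- the sequential run to the execution.
  have hcur : ∀ t, val (Nat.count E t) = (ghost v₀ α.act t).cur := by
    intro t
    induction t with
    | zero => rfl
    | succ t ih =>
      rw [Nat.count_succ]
      by_cases ht : E t
      · obtain ⟨n, hn⟩ := Option.isSome_iff_exists.1 ht
        obtain ⟨⟨p, x, hx⟩, -⟩ := effect_lt_response hn
        have h1 : val (Nat.count E t + 1) = (dataType x (val (Nat.count E t))).2 := by
          have : order (Nat.count E t) = some n := by rw [hcount t ht, hn]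
          simp only [val, this, hx]
        rw [if_pos ht, h1, ih, (dataType_of_effect hα hwf hn hx).1]
      · rw [if_neg ht, Nat.add_zero, ih, cur_of_effect_eq_none hα hwf]
        simpa [E] using ht
  refine ⟨order, pt, val, ?_, ?_, ?_, ?_, ?_, ?_, rfl, ?_⟩
  · intro a ha
    have hna : ¬ Valid a := by
      intro hv
      obtain ⟨n, hn⟩ := Option.isSome_iff_exists.1 (hval a hv)
      simp [order, hv, hn] at ha
    have : ¬ Valid (a + 1) := fun hv => hna fun hf => (Nat.lt_succ_self a).trans (hv hf)
    simp [order, this]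
  · intro a b n h1 h2
    obtain ⟨h3, h4⟩ := horder a n h1
    obtain ⟨h5, h6⟩ := horder b n h2
    have := effect_injective hα hwf h4 h6
    have h7 := congrArg (Nat.count E) this
    rwa [Nat.count_nth h3, Nat.count_nth h5] at h7
  · intro a n h
    exact (effect_lt_response (horder a n h).2).1
  · intro n m h
    obtain ⟨e, he⟩ := exists_effect hα hwf h
    exact ⟨Nat.count E e, by rw [hcount e (by simp [E, he]), he]⟩
  · intro a n h
    have he := (horder a n h).2
    rw [hpt _ _ he]
    exact (effect_lt_response he).2
  · intro a b n n' hab h1 h2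
    obtain ⟨h3, h4⟩ := horder a n h1
    obtain ⟨h5, h6⟩ := horder b n' h2
    rw [hpt _ _ h4, hpt _ _ h6]
    exact (Nat.nth_lt_nth' hab h5).le
  · intro a n p x h hx
    obtain ⟨h3, h4⟩ := horder a n h
    have h5 : val a = (ghost v₀ α.act (Nat.nth E a)).cur := by
      rw [← hcur, Nat.count_nth h3]
    rw [h5]
    refine ⟨?_, (dataType_of_effect hα hwf h4 hx).2⟩
    rw [← h5]
    simp only [val, h, hx]

end Serialization

/-! ### Liveness: fair queues and channels, replies, responses -/

/-- In a fair queue every element is eventually emitted. -/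
theorem eventually_emitted {O : Type*} {Q : ℕ → List O} {emit : ℕ → O → Prop}
    (hstep : ∀ n, (∃ o, Q n = o :: Q (n + 1) ∧ emit n o) ∨ ∃ L, Q (n + 1) = Q n ++ L)
    (hfair : ∀ n, ∃ m, n ≤ m ∧ ((∃ o, Q m = o :: Q (m + 1) ∧ emit m o) ∨ Q m = []))
    {o : O} {n : ℕ} (ho : o ∈ Q n) : ∃ m, n ≤ m ∧ emit m o := by
  -- Induction on the part `A` of the queue ahead of `o`, and inside it on the distance `d` to the
  -- next moment provided by fairness. Later outputs only lengthen `B`.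
  have key : ∀ (A : List O) (n : ℕ) (B : List O), Q n = A ++ o :: B → ∃ m, n ≤ m ∧ emit m o := by
    intro A
    induction A with
    | nil =>
      intro n B hn
      obtain ⟨m, hm, h⟩ := hfair n
      obtain ⟨d, rfl⟩ := Nat.exists_eq_add_of_le hm
      clear hm
      induction d generalizing n B with
      | zero =>
        rcases h with ⟨o', h1, h2⟩ | h
        · rw [Nat.add_zero, hn] at h1
          cases h1
          exact ⟨n, le_rfl, h2⟩
        · rw [Nat.add_zero, hn] at h
          cases h
      | succ d ih =>
        rcases hstep n with ⟨o', h1, h2⟩ | ⟨L, h1⟩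
        · rw [hn] at h1
          cases h1
          exact ⟨n, le_rfl, h2⟩
        · obtain ⟨m, h2, h3⟩ := ih (n + 1) (B ++ L) (by rw [h1, hn]; simp)
            (by rwa [Nat.add_right_comm, Nat.add_assoc])
          exact ⟨m, by omega, h3⟩
    | cons a A ihA =>
      intro n B hn
      obtain ⟨m, hm, h⟩ := hfair n
      obtain ⟨d, rfl⟩ := Nat.exists_eq_add_of_le hm
      clear hm
      induction d generalizing n B with
      | zero =>
        rcases h with ⟨o', h1, h2⟩ | h
        · rw [Nat.add_zero, hn] at h1
          injection h1 with _ h1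
          obtain ⟨m, h3, h4⟩ := ihA (n + 1) B h1.symm
          exact ⟨m, by omega, h4⟩
        · rw [Nat.add_zero, hn] at h
          cases h
      | succ d ih =>
        rcases hstep n with ⟨o', h1, h2⟩ | ⟨L, h1⟩
        · rw [hn] at h1
          injection h1 with _ h1
          obtain ⟨m, h3, h4⟩ := ihA (n + 1) B h1.symm
          exact ⟨m, by omega, h4⟩
        · obtain ⟨m, h2, h3⟩ := ih (n + 1) (B ++ L) (by rw [h1, hn]; simp)
            (by rwa [Nat.add_right_comm, Nat.add_assoc])
          exact ⟨m, by omega, h3⟩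
  obtain ⟨A, B, h⟩ := List.append_of_mem ho
  exact key A n B h

section Liveness

variable {k l : ℕ} {V : Fin k → Type u} {v₀ : ∀ i, V i} {α : (algorithmA l v₀).Fragment}
variable {s s' : (algorithmA l v₀).State}

/-- The action by which process `p` emits `o`. -/
def Output.act (p : Proc k l) : Output V l → Act V l
  | .send q m => .send p q m
  | .resp y => .resp p y

theorem automaton_step {P : Program V l} {p : Proc k l} {s s' : P.Vars × List (Output V l)}
    {a : Act V l} (h : (P.automaton p).trans s a s') :
    (∃ o, s.2 = o :: s'.2 ∧ a = Output.act p o) ∨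
      (a ∉ (P.automaton p).output ∧ ∃ L, s'.2 = s.2 ++ L) := by
  rcases h with ⟨x, -, rfl, r, -, rfl⟩ | ⟨q, m, rfl, r, -, rfl⟩ | ⟨q, m, rfl, -, h⟩ |
    ⟨y, rfl, -, h⟩
  · refine Or.inr ⟨?_, r.2, rfl⟩
    rintro (⟨q, m, h⟩ | ⟨y, h⟩) <;> cases h
  · refine Or.inr ⟨?_, r.2, rfl⟩
    rintro (⟨q, m, h⟩ | ⟨y, h⟩) <;> cases h
  · exact Or.inl ⟨_, h, rfl⟩
  · exact Or.inl ⟨_, h, rfl⟩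

theorem automaton_enabled {P : Program V l} {p : Proc k l} {s : P.Vars × List (Output V l)}
    {o : Output V l} {Q} (h : s.2 = o :: Q) :
    Output.act p o ∈ (P.automaton p).output ∧ ∃ s', (P.automaton p).trans s (Output.act p o) s' := by
  cases o with
  | send q m =>
    exact ⟨Or.inl ⟨q, m, rfl⟩, (s.1, Q), Or.inr (Or.inr (Or.inl ⟨q, m, rfl, rfl, h⟩))⟩
  | resp y => exact ⟨Or.inr ⟨y, rfl⟩, (s.1, Q), Or.inr (Or.inr (Or.inr ⟨y, rfl, rfl, h⟩))⟩

theorem que_step {a : Act V l} (h : (algorithmA l v₀).trans s a s') (p : Proc k l) :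
    (∃ o, que s p = o :: que s' p ∧ a = Output.act p o) ∨
      (a ∉ ((program v₀ p).automaton p).output ∧ ∃ L, que s' p = que s p ++ L) := by
  by_cases ha : a ∈ (component v₀ (.proc p)).sig
  · exact automaton_step ((h.2 (.proc p)).1 ha)
  · refine Or.inr ⟨fun h => ha (Or.inl (Or.inr h)), [], ?_⟩
    rw [que, (h.2 (.proc p)).2 ha, List.append_nil]; rfl

theorem emitted {T : Set (algorithmA l v₀).Task} (hf : α.FairOn T) {p : Proc k l}
    (hp : ⟨.proc p, PUnit.unit⟩ ∈ T) {o : Output V l} {n : ℕ} (ho : o ∈ que (α.state n) p) :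
    ∃ m, n ≤ m ∧ α.act m = some (Output.act p o) := by
  refine eventually_emitted (Q := fun n => que (α.state n) p)
    (emit := fun m o => α.act m = some (Output.act p o)) ?_ ?_ ho
  · intro n
    rcases ha : α.act n with _ | a
    · exact Or.inr ⟨[], by rw [(α.ended n ha).2, List.append_nil]⟩
    · rcases que_step (α.step n a ha) p with ⟨o, h1, rfl⟩ | ⟨-, h⟩
      · exact Or.inl ⟨o, h1, rfl⟩
      · exact Or.inr h
  · intro n
    obtain ⟨m, hm, h⟩ := hf _ hp n
    refine ⟨m, hm, ?_⟩
    rcases h with ⟨a, ha, h⟩ | h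
    · left
      rcases que_step (α.step m a h) p with ⟨o, h1, rfl⟩ | ⟨h2, -⟩
      · exact ⟨o, h1, h⟩
      · exact absurd ha h2
    -- The head of a nonempty queue would be enabled, also in the composition.
    · right
      by_contra hne
      obtain ⟨o, Q, hQ⟩ := List.exists_cons_of_ne_nil hne
      obtain ⟨h1, h2⟩ := automaton_enabled (p := p) hQ
      exact h ⟨_, h1, IOAutomaton.compose_enabled (component_compatible v₀) (i := .proc p) h1 h2⟩

/-- Every message is a task of its own. If `m` were never received, it would stay in transit and its
task would be enabled forever, against fairness. -/
theorem delivered {T : Set (algorithmA l v₀).Task} (hf : α.FairOn T) {p q : Proc k l}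
    {m : Msg V l} (hp : ⟨.chan p q, m⟩ ∈ T) {n : ℕ} (hm : m ∈ ch (α.state n) p q) :
    ∃ t, n ≤ t ∧ α.act t = some (.recv p q m) := by
  by_contra hno
  push Not at hno
  have hstay : ∀ t, n ≤ t → m ∈ ch (α.state t) p q := by
    intro t ht
    induction t, ht using Nat.le_induction with
    | base => exact hm
    | succ t ht ih =>
      rcases ha : α.act t with _ | a
      · rwa [(α.ended t ha).2]
      · have hstep := α.step t a ha
        cases a with
        | inv p' x => rwa [(trans_inv hstep).2.2]
        | resp p' y => rwa [(trans_resp hstep).2]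
        | send p' q' m' =>
          obtain ⟨-, h1, h2⟩ := trans_send hstep
          by_cases h : (p, q) = (p', q')
          · cases h
            rw [h1]
            exact Multiset.mem_cons_of_mem ih
          · rwa [h2 _ _ h]
        | recv p' q' m' =>
          obtain ⟨-, -, h1, h2⟩ := trans_recv hstep
          by_cases h : (p, q) = (p', q')
          · cases h
            rw [h1] at ih
            rcases Multiset.mem_cons.1 ih with rfl | h
            · exact absurd ha (hno t ht)
            · exact h
          · rwa [h2 _ _ h]
  obtain ⟨t, ht, h⟩ := hf _ hp n
  rcases h with ⟨a, ha, h⟩ | h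
  · cases (ha : a = _)
    exact hno t ht h
  · refine h ⟨.recv p q m, rfl, IOAutomaton.compose_enabled (component_compatible v₀)
      (i := .chan p q) ⟨m, rfl⟩ ?_⟩
    obtain ⟨D, hD⟩ := Multiset.exists_cons_of_mem (hstay t ht)
    exact ⟨D, Or.inr ⟨m, rfl, hD⟩⟩

theorem sent_delivered {T : Set (algorithmA l v₀).Task} (hf : α.FairOn T) {p q : Proc k l}
    (hp : ⟨.proc p, PUnit.unit⟩ ∈ T) (hpq : ∀ m, ⟨.chan p q, m⟩ ∈ T)
    {m : Msg V l} {n : ℕ} (hm : m ∈ out (α.state n) p q) :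
    ∃ t, n ≤ t ∧ α.act t = some (.recv p q m) := by
  obtain ⟨t, ht, h⟩ := emitted hf hp (mem_msgsTo.1 hm)
  have h1 := (trans_send (α.step t _ h)).2.1
  obtain ⟨t', ht', h'⟩ := delivered hf (hpq m) (n := t + 1) (by
    rw [h1]; exact Multiset.mem_cons_self _ _)
  exact ⟨t', by omega, h'⟩

/-- Every request is answered. -/
theorem replied (hα : α.IsExecution) (hwf : WellFormed α.act)
    {T : Set (algorithmA l v₀).Task} (hf : α.FairOn T) {p q : Proc k l} (hl : IsLink p q)
    (hp : ⟨.proc p, PUnit.unit⟩ ∈ T) (hq : ⟨.proc q, PUnit.unit⟩ ∈ T)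
    (hc : ∀ p q m, ⟨.chan p q, m⟩ ∈ T) {n : ℕ} (hn : Pending (α.state n) p q) :
    ∃ t m, n ≤ t ∧ α.act t = some (.recv q p m) := by
  have hreply : ∀ t m, n ≤ t → α.act t = some (.recv p q m) →
      ∃ t m, n ≤ t ∧ α.act t = some (.recv q p m) := by
    intro t m ht h
    have hI := invariant hα hwf t
    have hs := α.step t _ h
    have hne : out (α.state (t + 1)) q p ≠ [] := by
      cases hl with
      | writer_server w i => exact (hI.recv_writeValue (n := t) hs).2
      | writer_reader w => exact (hI.recv_informReader (n := t) hs).2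
      | reader_server i =>
        rw [out, (hI.recv_readValue (n := t) hs).2, msgsTo_append]
        simp
    obtain ⟨m', hm'⟩ := List.exists_mem_of_ne_nil _ hne
    obtain ⟨t', ht', h'⟩ := sent_delivered hf hq (hc q p) hm'
    exact ⟨t', m', by omega, h'⟩
  rcases ((invariant hα hwf n).link p q hl).active hn with ⟨m, -, hA, -⟩ | ⟨m, -, -, hB, -⟩ |
    ⟨m, -, -, -, hC, -⟩ | ⟨m, -, -, -, -, hD⟩
  · obtain ⟨t, ht, h⟩ := sent_delivered hf hp (hc p q) (m := m) (n := n) (by simp [hA])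
    exact hreply t m ht h
  · obtain ⟨t, ht, h⟩ := delivered hf (hc p q m) (n := n) (by simp [hB])
    exact hreply t m ht h
  · obtain ⟨t, ht, h⟩ := sent_delivered hf hq (hc q p) (m := m) (n := n) (by simp [hC])
    exact ⟨t, m, ht, h⟩
  · obtain ⟨t, ht, h⟩ := delivered hf (hc q p m) (n := n) (by simp [hD])
    exact ⟨t, m, ht, h⟩

theorem vars_step {a : Act V l} (h : (algorithmA l v₀).trans s a s') (p : Proc k l) :
    vars s' p = vars s p ∨ ∃ e L, Handles s s' p e L := by
  cases a with
  | inv p' x =>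
    obtain ⟨-, ⟨L, hh⟩, -⟩ := trans_inv h
    by_cases hp : p = p'
    · subst hp; exact Or.inr ⟨_, L, hh⟩
    · exact Or.inl (hh.vars_ne p hp)
  | resp p' y => exact Or.inl ((trans_resp h).1.vars_eq p)
  | send p' q m => exact Or.inl ((trans_send h).1.vars_eq p)
  | recv q p' m =>
    obtain ⟨L, hh, -⟩ := trans_recv h
    by_cases hp : p = p'
    · subst hp; exact Or.inr ⟨_, L, hh⟩
    · exact Or.inl (hh.vars_ne p hp)

theorem writerNext_writeValue {w : Fin l} {vs : WriterVars V l} {κ u R}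
    (h : vs.phase = .writeValue κ u R) (e : Input V l) :
    (writerNext w vs e).1.phase = .informReader ∨
      ∃ R' ⊆ R, (writerNext w vs e).1.phase = .writeValue κ u R' := by
  unfold writerNext
  split
  · rw [h]
    exact Or.inr ⟨R, subset_rfl, h⟩
  · rw [h]
    dsimp only
    split_ifs
    · exact Or.inl rfl
    · exact Or.inr ⟨_, Finset.erase_subset _ _, rfl⟩
  · rw [h]
    exact Or.inr ⟨R, subset_rfl, h⟩
  · exact Or.inr ⟨R, subset_rfl, h⟩

/-- While the reply of one server is on its way, acknowledgements of others may arrive. They can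
only shrink the awaited set or end the phase. -/
theorem writeValue_persists {w : Fin l} {κ u R} {t : ℕ}
    (h : (wv (α.state t) w).phase = .writeValue κ u R) {m : ℕ} (hm : t ≤ m) :
    (∃ j, t ≤ j ∧ (wv (α.state j) w).phase = .informReader) ∨
      ∃ R' ⊆ R, (wv (α.state m) w).phase = .writeValue κ u R' := by
  induction m, hm using Nat.le_induction with
  | base => exact Or.inr ⟨R, subset_rfl, h⟩
  | succ m hm ih =>
    rcases ih with ih | ⟨R', hR', ih⟩
    · exact Or.inl ih
    rcases ha : α.act m with _ | a
    · rw [(α.ended m ha).2]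
      exact Or.inr ⟨R', hR', ih⟩
    · rcases vars_step (α.step m a ha) (.writer w) with hv | ⟨e, L, hh⟩
      · rw [wv_congr hv]
        exact Or.inr ⟨R', hR', ih⟩
      · have h1 : (wv (α.state (m + 1)) w) = _ := (Prod.mk.inj hh.writer).1
        rcases writerNext_writeValue (w := w) ih e with h2 | ⟨R'', h2, h3⟩
        · exact Or.inl ⟨m + 1, by omega, by rw [h1]; exact h2⟩
        · exact Or.inr ⟨R'', h2.trans hR', by rw [h1]; exact h3⟩

/-- Strong induction on the number of missing acknowledgements: one of them arrives by `replied`,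
and its receipt strictly shrinks the awaited set. -/
theorem eventually_informReader (hα : α.IsExecution) (hwf : WellFormed α.act)
    {T : Set (algorithmA l v₀).Task} (hf : α.FairOn T) {w : Fin l}
    (hp : ⟨.proc (.writer w), PUnit.unit⟩ ∈ T)
    (hq : ∀ i, ⟨.proc (.server i), PUnit.unit⟩ ∈ T)
    (hc : ∀ p q m, ⟨.chan p q, m⟩ ∈ T) {t : ℕ} {κ u R}
    (h : (wv (α.state t) w).phase = .writeValue κ u R) :
    ∃ j, t ≤ j ∧ (wv (α.state j) w).phase = .informReader := by
  induction hR : R.card using Nat.strong_induction_on generalizing t R with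
  | _ c ih =>
  subst hR
  have hctl := (invariant hα hwf t).writer w
  rw [h] at hctl
  obtain ⟨i, hi⟩ := hctl.of_writeValue.2.2.2.1
  obtain ⟨m, msg, hm, hact⟩ := replied hα hwf hf (.writer_server w i) hp (hq i) hc (n := t)
    (by simpa [Pending, h, unacked] using hi)
  rcases writeValue_persists h hm with h1 | ⟨R', hR', h1⟩
  · exact h1
  obtain ⟨κ', u', R'', h2, h3, h4⟩ := ((invariant hα hwf m).recv_ack (n := m)
    (α.step m _ hact)).2
  rw [h1] at h2
  cases h2
  rcases h4 with ⟨-, h4⟩ | h4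
  · exact ⟨m + 1, by omega, h4⟩
  · have hlt : (R'.erase i).card < R.card :=
      (Finset.card_erase_lt_of_mem h3).trans_le (Finset.card_le_card hR')
    obtain ⟨j, hj, h5⟩ := ih _ hlt h4 rfl
    exact ⟨j, by omega, h5⟩

theorem writer_responds (hα : α.IsExecution) (hwf : WellFormed α.act)
    {T : Set (algorithmA l v₀).Task} (hf : α.FairOn T) {w : Fin l}
    (hp : ⟨.proc (.writer w), PUnit.unit⟩ ∈ T) (hr : ⟨.proc .reader, PUnit.unit⟩ ∈ T)
    (hq : ∀ i, ⟨.proc (.server i), PUnit.unit⟩ ∈ T)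
    (hc : ∀ p q m, ⟨.chan p q, m⟩ ∈ T) {t : ℕ}
    (h : (ghost v₀ α.act t).busy (.writer w) ≠ none) :
    ∃ m y, t ≤ m ∧ α.act m = some (.resp (.writer w) y) := by
  have hinf : ∀ j, t ≤ j → (wv (α.state j) w).phase = .informReader →
      ∃ m y, t ≤ m ∧ α.act m = some (.resp (.writer w) y) := by
    intro j hj hφ
    obtain ⟨m, msg, hm, hact⟩ := replied hα hwf hf (.writer_reader w) hp hr hc hφ
    have := ((invariant hα hwf m).recv_ackTag (n := m) (α.step m _ hact)).2
    obtain ⟨m', hm', h'⟩ := emitted hf hp this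
    exact ⟨m', _, by omega, h'⟩
  have hctl := (invariant hα hwf t).writer w
  rcases hφ : (wv (α.state t) w).phase with _ | ⟨κ, u, R⟩ | _
  · rw [hφ] at hctl
    rcases hrsp : rsp (α.state t) (.writer w) with _ | ⟨y, r⟩
    · rw [hrsp] at hctl
      generalize (ghost v₀ α.act t).busy (.writer w) = b at h hctl
      cases hctl
      exact absurd rfl h
    · have hy : y ∈ rsp (α.state t) (.writer w) := by simp [hrsp]
      obtain ⟨m, hm, h'⟩ := emitted hf hp (mem_respsOf.1 hy)
      exact ⟨m, y, hm, h'⟩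
  · obtain ⟨j, hj, hφ⟩ := eventually_informReader hα hwf hf hp hq hc hφ
    exact hinf j hj hφ
  · exact hinf t le_rfl hφ

theorem readerNext_reading {vs : ReaderVars V l} {I y} (h : vs.phase = some (I, y))
    (e : Input V l) : (∃ z, .resp z ∈ (readerNext vs e).2) ∨
      ∃ y', (readerNext vs e).1.phase = some (I, y') ∧ ∀ i, y' i = none → y i = none := by
  unfold readerNext
  split
  · rw [h]
    exact Or.inr ⟨y, h, fun _ => id⟩
  · rename_i i j v
    rw [h]
    dsimp only
    split_ifs
    · exact Or.inl ⟨_, List.mem_singleton_self _⟩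
    · refine Or.inr ⟨_, rfl, fun a ha => ?_⟩
      by_cases haj : a = j
      · subst haj
        simp at ha
      · rwa [Function.update_of_ne haj] at ha
    · exact Or.inr ⟨y, h, fun _ => id⟩
  · exact Or.inr ⟨y, h, fun _ => id⟩
  · exact Or.inr ⟨y, h, fun _ => id⟩

theorem reading_persists {I y} {t : ℕ} (h : (rv (α.state t)).phase = some (I, y)) {m : ℕ}
    (hm : t ≤ m) : (∃ j z, t ≤ j ∧ .resp z ∈ que (α.state j) .reader) ∨
      ∃ y', (rv (α.state m)).phase = some (I, y') ∧ ∀ i, y' i = none → y i = none := by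
  induction m, hm using Nat.le_induction with
  | base => exact Or.inr ⟨y, h, fun _ => id⟩
  | succ m hm ih =>
    rcases ih with ih | ⟨y', ih, hy'⟩
    · exact Or.inl ih
    rcases ha : α.act m with _ | a
    · rw [(α.ended m ha).2]
      exact Or.inr ⟨y', ih, hy'⟩
    · rcases vars_step (α.step m a ha) .reader with hv | ⟨e, L, hh⟩
      · have : rv (α.state (m + 1)) = rv (α.state m) := hv
        rw [this]
        exact Or.inr ⟨y', ih, hy'⟩
      · obtain ⟨h1, h2⟩ := Prod.mk.inj hh.reader
        rcases readerNext_reading ih e with ⟨z, h3⟩ | ⟨y'', h3, h4⟩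
        · refine Or.inl ⟨m + 1, z, by omega, ?_⟩
          rw [hh.que_self, h2]
          exact List.mem_append_right _ h3
        · exact Or.inr ⟨y'', by rw [h1]; exact h3, fun i hi => hy' i (h4 i hi)⟩

/-- The argument for writers again, now with the number of requested objects whose value is missing.
-/
theorem reader_eventually_responds (hα : α.IsExecution) (hwf : WellFormed α.act)
    {T : Set (algorithmA l v₀).Task} (hf : α.FairOn T)
    (hp : ⟨.proc .reader, PUnit.unit⟩ ∈ T)
    (hq : ∀ i, ⟨.proc (.server i), PUnit.unit⟩ ∈ T)
    (hc : ∀ p q m, ⟨.chan p q, m⟩ ∈ T) {t : ℕ} {I y}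
    (h : (rv (α.state t)).phase = some (I, y)) :
    ∃ j z, t ≤ j ∧ .resp z ∈ que (α.state j) .reader := by
  induction hR : (I.filter fun i => (y i).isNone).card using Nat.strong_induction_on
    generalizing t y with
  | _ c ih =>
  subst hR
  have hctl := (invariant hα hwf t).reader
  rw [h] at hctl
  obtain ⟨i, hi, hyi⟩ := hctl.of_some.2.1
  obtain ⟨m, msg, hm, hact⟩ := replied hα hwf hf (.reader_server i) hp (hq i) hc (n := t)
    ⟨I, y, h, hi, hyi⟩
  rcases reading_persists h hm with h1 | ⟨y', h1, hy'⟩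
  · exact h1
  obtain ⟨I', y'', h2, -, h3, h4⟩ := ((invariant hα hwf m).recv_value (n := m)
    (α.step m _ hact)).2
  rw [h1] at h2
  cases h2
  rcases h4 with ⟨z, h4⟩ | ⟨v, h4⟩
  · exact ⟨m + 1, z, by omega, h4⟩
  · have hlt : (I.filter fun a => (Function.update y' i (some v) a).isNone).card <
        (I.filter fun i => (y i).isNone).card := by
      refine Finset.card_lt_card ⟨?_, ?_⟩
      · intro a ha
        simp only [Finset.mem_filter, Option.isNone_iff_eq_none] at ha ⊢
        refine ⟨ha.1, hy' a ?_⟩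
        by_cases hai : a = i
        · subst hai; exact h3
        · rw [← ha.2, Function.update_of_ne hai]
      · intro hsub
        have := hsub (Finset.mem_filter.2 ⟨hi, by simp [hyi]⟩)
        simp at this
    obtain ⟨j, z, hj, h5⟩ := ih _ hlt h4 rfl
    exact ⟨j, z, by omega, h5⟩

theorem reader_responds (hα : α.IsExecution) (hwf : WellFormed α.act)
    {T : Set (algorithmA l v₀).Task} (hf : α.FairOn T)
    (hp : ⟨.proc .reader, PUnit.unit⟩ ∈ T)
    (hq : ∀ i, ⟨.proc (.server i), PUnit.unit⟩ ∈ T)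
    (hc : ∀ p q m, ⟨.chan p q, m⟩ ∈ T) {t : ℕ}
    (h : (ghost v₀ α.act t).busy .reader ≠ none) :
    ∃ m y, t ≤ m ∧ α.act m = some (.resp .reader y) := by
  obtain ⟨j, z, hj, hz⟩ : ∃ j z, t ≤ j ∧ .resp z ∈ que (α.state j) .reader := by
    have hctl := (invariant hα hwf t).reader
    rcases hφ : (rv (α.state t)).phase with _ | ⟨I, y⟩
    · rw [hφ] at hctl
      rcases hrsp : rsp (α.state t) .reader with _ | ⟨y, r⟩
      · rw [hrsp] at hctl
        generalize (ghost v₀ α.act t).busy .reader = b at h hctl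
        cases hctl
        exact absurd rfl h
      · have hy : y ∈ rsp (α.state t) .reader := by simp [hrsp]
        exact ⟨t, y, le_rfl, mem_respsOf.1 hy⟩
    · exact reader_eventually_responds hα hwf hf hp hq hc hφ
  obtain ⟨m, hm, h'⟩ := emitted hf hp hz
  exact ⟨m, z, by omega, h'⟩

variable (l v₀) in
-- Progress of `p` uses only the tasks of `p`, the reader, the servers and the channels, since no
-- process ever waits for another writer.
theorem waitFree : WaitFree l v₀ := by
  classical
  intro α hα hwf p hf n x hx
  have hb : (ghost v₀ α.act (n + 1)).busy p ≠ none := by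
    rw [ghost_succ hx]
    simp [gstep]
  have hex : ∃ m y, n + 1 ≤ m ∧ α.act m = some (.resp p y) := by
    cases p with
    | writer w =>
      refine writer_responds hα hwf hf ?_ ?_ ?_ ?_ hb
      · rintro w' h; cases h; rfl
      · rintro w' h; cases h
      · rintro i w' h; cases h
      · rintro p q m w' h; cases h
    | reader =>
      refine reader_responds hα hwf hf ?_ ?_ ?_ hb
      · rintro w' h; cases h
      · rintro i w' h; cases h
      · rintro p q m w' h; cases h
    | server i =>
      have := (trans_inv (α.step n _ hx)).1
      cases x <;> exact this.elim
  -- The least such position is taken because `IsResponse` requires the first response.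
  obtain ⟨y, h1, h2⟩ := Nat.find_spec hex
  refine ⟨Nat.find hex, p, x, y, hx, h2, h1, fun j hj hj' y' hy' => ?_⟩
  exact Nat.find_min hex hj' ⟨y', hj, hy'⟩

/-- The answer is already in the queue of the server just after the receipt, so fairness of this
queue alone suffices. -/
theorem nonBlocking (hα : α.IsExecution) (hwf : WellFormed α.act) : NonBlocking α := by
  intro i n κ hact γ hγ hfair _
  have hq := ((invariant hα hwf n).recv_readValue (n := n) (α.step n _ hact)).2
  have ho : (Output.send .reader (.value i ((ghost v₀ α.act n).snap i)) : Output V l) ∈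
      (γ.state 0).2 := by
    rw [hγ]
    change _ ∈ que (α.state (n + 1)) (.server i)
    rw [hq]
    simp
  suffices h : ∃ m, 0 ≤ m ∧ γ.act m = some (Output.act (.server i)
      (.send .reader (.value i ((ghost v₀ α.act n).snap i)))) by
    obtain ⟨m, -, h⟩ := h
    exact ⟨m, _, h⟩
  refine eventually_emitted (Q := fun n => (γ.state n).2)
    (emit := fun m o => γ.act m = some (Output.act (.server i) o)) ?_ ?_ ho
  · intro n
    rcases ha : γ.act n with _ | a
    · exact Or.inr ⟨[], by rw [(γ.ended n ha).2, List.append_nil]⟩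
    · rcases automaton_step (γ.step n a ha) with ⟨o, h1, rfl⟩ | ⟨-, h⟩
      · exact Or.inl ⟨o, h1, rfl⟩
      · exact Or.inr h
  · intro n
    obtain ⟨m, hm, h⟩ := hfair PUnit.unit trivial n
    refine ⟨m, hm, ?_⟩
    rcases h with ⟨a, ha, h⟩ | h
    · left
      rcases automaton_step (γ.step m a h) with ⟨o, h1, rfl⟩ | ⟨h2, -⟩
      · exact ⟨o, h1, h⟩
      · exact absurd ha h2
    · right
      by_contra hne
      obtain ⟨o, Q, hQ⟩ := List.exists_cons_of_ne_nil hne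
      obtain ⟨h1, h2⟩ := automaton_enabled (p := .server i) hQ
      exact h ⟨_, h1, h2⟩

end Liveness

/-! ### Fair continuations by termination -/

namespace IOAutomaton

/-- If each locally controlled action decreases a natural number, every state has a fair
continuation without input. -/
theorem exists_fair_fragment {Act : Type u} (A : IOAutomaton Act) (μ : A.State → ℕ)
    (hμ : ∀ s a s', a ∈ A.output ∪ A.internal → A.trans s a s' → μ s' < μ s) (s : A.State) :
    ∃ γ : A.Fragment, γ.state 0 = s ∧ γ.Fair ∧
      ∀ n a, γ.act n = some a → a ∈ A.output ∪ A.internal := by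
  classical
  let En : A.State → Prop := fun s => ∃ r : Act × A.State,
    r.1 ∈ A.output ∪ A.internal ∧ A.trans s r.1 r.2
  -- Any enabled locally controlled action is performed; if there is none, the fragment ends.
  let next : A.State → Option Act × A.State := fun s =>
    if h : En s then (some h.choose.1, h.choose.2) else (none, s)
  let st : ℕ → A.State := fun n => Nat.rec s (fun _ s => (next s).2) n
  have hst : ∀ n, st (n + 1) = (next (st n)).2 := fun n => rfl
  have hsome : ∀ s a, (next s).1 = some a →
      a ∈ A.output ∪ A.internal ∧ A.trans s a (next s).2 := by
    intro s a h
    by_cases hs : En s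
    · have hn : next s = (some hs.choose.1, hs.choose.2) := dif_pos hs
      rw [hn] at h ⊢
      cases h
      exact hs.choose_spec
    · have hn : next s = (none, s) := dif_neg hs
      rw [hn] at h
      cases h
  have hnone : ∀ s, (next s).1 = none → ¬ En s ∧ (next s).2 = s := by
    intro s h
    by_cases hs : En s
    · have hn : next s = (some hs.choose.1, hs.choose.2) := dif_pos hs
      rw [hn] at h
      cases h
    · have hn : next s = (none, s) := dif_neg hs
      exact ⟨hs, by rw [hn]⟩
  have hended : ∀ n, (next (st n)).1 = none →
      (next (st (n + 1))).1 = none ∧ st (n + 1) = st n := by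
    intro n h
    have h1 : st (n + 1) = st n := (hst n).trans (hnone _ h).2
    exact ⟨by rw [h1, h], h1⟩
  refine ⟨⟨st, fun n => (next (st n)).1, fun n a h => (hsome _ a h).2, hended⟩, rfl, ?_,
    fun n a h => (hsome _ a h).1⟩
  -- A run that never ends would lower `μ` infinitely often. Once it has ended no task is enabled,
  -- which is fairness of a finite fragment.
  obtain ⟨j, hj⟩ : ∃ j, (next (st j)).1 = none := by
    by_contra hno
    push Not at hno
    have hdec : ∀ j, μ (st j) + j ≤ μ s := by
      intro j
      induction j with
      | zero => exact le_rfl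
      | succ j ih =>
        obtain ⟨a, ha⟩ := Option.ne_none_iff_exists'.1 (hno j)
        obtain ⟨h1, h2⟩ := hsome _ a ha
        have := hμ _ _ _ h1 h2
        rw [hst]
        omega
    have := hdec (μ s + 1)
    omega
  have hquiet : ∀ m, j ≤ m → (next (st m)).1 = none := by
    intro m hm
    induction m, hm using Nat.le_induction with
    | base => exact hj
    | succ m _ ih => exact (hended m ih).1
  intro t _ n
  refine ⟨max n j, le_max_left _ _, Or.inr ?_⟩
  rintro ⟨a, ha, s', hs'⟩
  refine (hnone _ (hquiet (max n j) (le_max_right _ _))).1 ⟨(a, s'), ?_, hs'⟩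
  rw [← A.task_cover]
  exact Set.mem_iUnion.2 ⟨t, ha⟩

/-- The first `N` steps of `α`, the action `a`, and the fragment `γ`. -/
def Fragment.splice {Act : Type u} {A : IOAutomaton Act} (α γ : A.Fragment) (N : ℕ) (a : Act)
    (hN : ∀ j, j < N → (α.act j).isSome) (h : A.trans (α.state N) a (γ.state 0)) :
    A.Fragment where
  -- The action `a` occupies position `N` and leads to `γ.state 0`, so `γ` is shifted by `N + 1`.
  state j := if j ≤ N then α.state j else γ.state (j - (N + 1))
  act j := if j < N then α.act j else if j = N then some a else γ.act (j - (N + 1))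
  step n b hb := by
    rcases lt_trichotomy n N with hn | rfl | hn
    · rw [if_pos hn] at hb
      rw [if_pos hn.le, if_pos (by omega)]
      exact α.step n b hb
    · simp only [lt_irrefl, if_false, if_true, Option.some.injEq] at hb
      subst hb
      simpa using h
    · rw [if_neg (by omega), if_neg (by omega)] at hb
      rw [if_neg (by omega), if_neg (by omega), Nat.sub_add_comm (by omega)]
      exact γ.step _ b hb
  ended n hn := by
    rcases lt_trichotomy n N with hlt | rfl | hlt
    · rw [if_pos hlt] at hn
      have := hN n hlt
      rw [hn] at this
      cases this
    · simp at hn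
    · rw [if_neg (by omega), if_neg (by omega)] at hn
      obtain ⟨h1, h2⟩ := γ.ended _ hn
      rw [← Nat.sub_add_comm (by omega)] at h1 h2
      rw [if_neg (by omega), if_neg (by omega), if_neg (by omega), if_neg (by omega)]
      exact ⟨h1, h2⟩

theorem Fragment.Fair.splice {Act : Type u} {A : IOAutomaton Act} {α γ : A.Fragment} {N : ℕ}
    {a : Act} {hN : ∀ j, j < N → (α.act j).isSome} {h : A.trans (α.state N) a (γ.state 0)}
    (hγ : γ.Fair) : (α.splice γ N a hN h).Fair := by
  intro t ht n
  obtain ⟨m, hm, h1⟩ := hγ t ht n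
  refine ⟨m + (N + 1), by omega, ?_⟩
  have hs : (α.splice γ N a hN h).state (m + (N + 1)) = γ.state m := by
    simp only [Fragment.splice]
    rw [if_neg (by omega), Nat.add_sub_cancel]
  have ha : (α.splice γ N a hN h).act (m + (N + 1)) = γ.act m := by
    simp only [Fragment.splice]
    rw [if_neg (by omega), if_neg (by omega), Nat.add_sub_cancel]
  rwa [hs, ha]

end IOAutomaton

/-! ### A weight that bounds the remaining steps, and invocations at any time -/

section Termination

variable {k l : ℕ} {V : Fin k → Type u} {v₀ : ∀ i, V i}
variable {s s' : (algorithmA l v₀).State}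

instance : Fintype (Proc k l) :=
  Fintype.ofEquiv (Fin l ⊕ Unit ⊕ Fin k)
    { toFun := fun
        | .inl w => .writer w
        | .inr (.inl _) => .reader
        | .inr (.inr i) => .server i
      invFun := fun
        | .writer w => .inl w
        | .reader => .inr (.inl ())
        | .server i => .inr (.inr i)
      left_inv := by rintro (w | _ | i) <;> rfl
      right_inv := by rintro (w | _ | i) <;> rfl }

/-- A bound for the number of steps caused by a message in transit. -/
def Msg.weight : Msg V l → ℕ
  -- A request in transit pays for its receipt and for the sending and the receipt of its reply. A
  -- message still in a queue costs one more, for its own sending.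
  | .writeValue _ _ _ | .informReader _ _ | .readValue _ => 3
  | .ack | .ackTag _ | .value _ _ => 1

def Output.weight : Output V l → ℕ
  | .send _ m => m.weight + 1
  | .resp _ => 1

/-- The last acknowledgement, of weight 1, takes the phase from 5 to 1 and queues an inform-reader
message of weight 3 + 1, so one unit is lost in total. The remaining 1 pays for the response, like
the 1 for a READ in progress in `varsWeight`. -/
def WriterPhase.weight : WriterPhase V l → ℕ
  | .idle => 0
  | .writeValue _ _ _ => 5
  | .informReader => 1

variable (v₀) in
def varsWeight : ∀ p : Proc k l, (program (l := l) v₀ p).Vars → ℕ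
  | .writer _ => fun s => WriterPhase.weight (WriterVars.phase s)
  | .reader => fun s => if (ReaderVars.phase s).isSome then 1 else 0
  | .server _ => fun _ => 0

def queueWeight (Q : List (Output V l)) : ℕ := (Q.map Output.weight).sum

def procWeight (s : (algorithmA l v₀).State) (p : Proc k l) : ℕ :=
  varsWeight v₀ p (vars s p) + queueWeight (que s p)

def chWeight (s : (algorithmA l v₀).State) (c : Proc k l × Proc k l) : ℕ :=
  ((ch s c.1 c.2).map Msg.weight).sum

def weight (s : (algorithmA l v₀).State) : ℕ :=
  ∑ p : Proc k l, procWeight s p + ∑ c : Proc k l × Proc k l, chWeight s c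

theorem Msg.one_le_weight (m : Msg V l) : 1 ≤ m.weight := by
  cases m <;> simp [Msg.weight]

@[simp] theorem queueWeight_nil : queueWeight (V := V) (l := l) [] = 0 := rfl

@[simp] theorem queueWeight_cons (o : Output V l) (Q) :
    queueWeight (o :: Q) = o.weight + queueWeight Q := by
  simp [queueWeight]

@[simp] theorem queueWeight_append (Q Q' : List (Output V l)) :
    queueWeight (Q ++ Q') = queueWeight Q + queueWeight Q' := by
  simp [queueWeight]

theorem writerNext_weight (w : Fin l) (vs : WriterVars V l) (q : Proc k l) (m : Msg V l) :
    (writerNext w vs (.recv q m)).1.phase.weight + queueWeight (writerNext w vs (.recv q m)).2 + 1 ≤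
      vs.phase.weight + m.weight := by
  have h0 := m.one_le_weight
  obtain ⟨z, φ⟩ := vs
  unfold writerNext
  split
  · rename_i heq; cases heq
  · rename_i i heq
    cases heq
    cases φ with
    | writeValue κ u R =>
      dsimp only
      split_ifs <;> simp [WriterPhase.weight, Output.weight, Msg.weight]
    | _ => simp [Msg.weight]
  · rename_i i heq
    cases heq
    cases φ with
    | informReader => simp [WriterPhase.weight, Output.weight, Msg.weight]
    | _ => simp [Msg.weight]
  · simpa using h0

theorem readerNext_weight (vs : ReaderVars V l) (q : Proc k l) (m : Msg V l) :
    (if (readerNext vs (.recv q m)).1.phase.isSome then 1 else 0) +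
        queueWeight (readerNext vs (.recv q m)).2 + 1 ≤
      (if vs.phase.isSome then 1 else 0) + m.weight := by
  have h0 := m.one_le_weight
  obtain ⟨L, φ⟩ := vs
  unfold readerNext
  split
  · rename_i heq; cases heq
  · rename_i i j v heq
    cases heq
    cases φ with
    | some φ =>
      obtain ⟨I, y⟩ := φ
      dsimp only
      split_ifs <;> simp_all [Output.weight, Msg.weight]
    | none => simp [Msg.weight]
  · rename_i i j v heq
    cases heq
    simp [Output.weight, Msg.weight]
  · simpa using h0

theorem serverNext_weight (i : Fin k) (vs : ServerVars V l i) (q : Proc k l) (m : Msg V l)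
    (r) (hr : r ∈ serverNext i vs (.recv q m)) : queueWeight r.2 + 1 ≤ m.weight := by
  have h0 := m.one_le_weight
  unfold serverNext at hr
  split at hr
  · rename_i heq
    cases heq
    split at hr <;> cases hr <;> simp [Output.weight, Msg.weight]
  · rename_i heq
    cases heq
    rcases hr with ⟨v, -, rfl⟩ | ⟨-, rfl⟩ <;> simp [Output.weight, Msg.weight]
  · cases hr
    simpa using h0

theorem Handles.weight {p q : Proc k l} {m L} (h : Handles s s' q (.recv p m) L) :
    procWeight s' q + 1 ≤ procWeight s q + m.weight := by
  rw [procWeight, procWeight, h.que_self, queueWeight_append]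
  have : varsWeight v₀ q (vars s' q) + queueWeight L + 1 ≤
      varsWeight v₀ q (vars s q) + m.weight := by
    cases q with
    | writer w =>
      have := writerNext_weight w (wv s w) p m
      rw [← h.writer] at this
      exact this
    | reader =>
      have := readerNext_weight (rv s) p m
      rw [← h.reader] at this
      exact this
    | server i =>
      have := serverNext_weight i _ p m _ h.server
      simpa [varsWeight] using this
  omega

theorem sum_add_of_eq_off {ι : Type*} [Fintype ι] [DecidableEq ι] {f g : ι → ℕ} {i : ι}
    (h : ∀ j, j ≠ i → f j = g j) : ∑ j, f j + g i = ∑ j, g j + f i := by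
  have h1 : ∑ j ∈ Finset.univ.erase i, f j = ∑ j ∈ Finset.univ.erase i, g j :=
    Finset.sum_congr rfl fun j hj => h j (Finset.ne_of_mem_erase hj)
  have h2 : f i + ∑ j ∈ Finset.univ.erase i, f j = ∑ j, f j :=
    Finset.add_sum_erase _ f (Finset.mem_univ i)
  have h3 : g i + ∑ j ∈ Finset.univ.erase i, g j = ∑ j, g j :=
    Finset.add_sum_erase _ g (Finset.mem_univ i)
  omega

theorem Emits.weight {p : Proc k l} {o} (h : Emits s s' p o) :
    ∑ q : Proc k l, procWeight s q = ∑ q : Proc k l, procWeight s' q + o.weight := by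
  have h1 := sum_add_of_eq_off (f := procWeight s') (g := procWeight s) (i := p) (by
    intro q hq
    rw [procWeight, procWeight, h.vars_eq, h.que_ne q hq])
  have h2 : procWeight s p = procWeight s' p + o.weight := by
    rw [procWeight, procWeight, h.vars_eq, h.que_self, queueWeight_cons]
    omega
  omega

/-- Only invocations create work. Emitting moves a message to its channel at the cost of one unit,
and every handler of a message spends at least one unit more than it produces. -/
theorem weight_lt {a : Act V l} (h : (algorithmA l v₀).trans s a s')
    (ha : ∀ p x, a ≠ .inv p x) : weight s' < weight s := by
  cases a with
  | inv p x => exact absurd rfl (ha p x)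
  | resp p y =>
    obtain ⟨he, hch⟩ := trans_resp h
    have h1 := he.weight
    have h2 : chWeight s' = chWeight s := funext fun c => by rw [chWeight, hch]; rfl
    simp only [SNOW.weight, h2, h1, Output.weight]
    omega
  | send p q m =>
    obtain ⟨he, hch, hcf⟩ := trans_send h
    have h1 := he.weight
    have h2 := sum_add_of_eq_off (f := chWeight s') (g := chWeight s) (i := (p, q)) (by
      rintro ⟨p', q'⟩ hc
      rw [chWeight, hcf _ _ hc]; rfl)
    have h3 : chWeight s' (p, q) = chWeight s (p, q) + m.weight := by
      simp only [chWeight, hch, Multiset.map_cons, Multiset.sum_cons]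
      exact Nat.add_comm _ _
    simp only [SNOW.weight, h1, Output.weight]
    omega
  | recv p q m =>
    obtain ⟨L, hh, hch, hcf⟩ := trans_recv h
    have h1 := sum_add_of_eq_off (f := procWeight s') (g := procWeight s) (i := q) (by
      intro q' hq
      rw [procWeight, procWeight, hh.vars_ne q' hq, hh.que_ne q' hq])
    have h2 := sum_add_of_eq_off (f := chWeight s') (g := chWeight s) (i := (p, q)) (by
      rintro ⟨p', q'⟩ hc
      rw [chWeight, hcf _ _ hc]; rfl)
    have h3 : chWeight s (p, q) = chWeight s' (p, q) + m.weight := by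
      simp only [chWeight, hch, Multiset.map_cons, Multiset.sum_cons]
      exact Nat.add_comm _ _
    have h4 := hh.weight
    simp only [SNOW.weight]
    omega

theorem inv_not_mem_output (p : Proc k l) (x : Inv V) :
    (.inv p x : Act V l) ∉ (algorithmA l v₀).output ∪ (algorithmA l v₀).internal := by
  rintro (h | h) <;> obtain ⟨c, hc⟩ := Set.mem_iUnion.1 h <;> cases c
  · rcases hc with ⟨q, m, h⟩ | ⟨y, h⟩ <;> cases h
  · obtain ⟨m, h⟩ := hc
    cases h
  · exact hc
  · exact hc

theorem IsResponse.congr {act act' : ℕ → Option (Act V l)} {n m N : ℕ} (h : IsResponse act n m)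
    (hm : m < N) (hact : ∀ j, j < N → act' j = act j) : IsResponse act' n m := by
  obtain ⟨p, x, y, h1, h2, h3, h4⟩ := h
  refine ⟨p, x, y, ?_, ?_, h3, fun j hj hj' => ?_⟩
  · rw [hact n (by omega), h1]
  · rw [hact m hm, h2]
  · rw [hact j (by omega)]
    exact h4 j hj hj'

variable (l v₀) in
-- The invocation is an input and hence enabled. Afterwards the system runs without invocations
-- until it stops, so the only new condition for well-formedness concerns position `N`, where all
-- earlier transactions of `p` are complete.
theorem invocableAnytime : InvocableAnytime l v₀ := by
  intro α hα hwf N p x hx hN hresp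
  obtain ⟨s, hs⟩ := (algorithmA l v₀).input_enabled (α.state N) (.inv p x) (by
    refine ⟨Set.mem_iUnion.2 ⟨.proc p, Or.inl ⟨x, hx, rfl⟩⟩, fun h => ?_⟩
    exact inv_not_mem_output (v₀ := v₀) p x (Or.inl h))
  obtain ⟨γ, rfl, hfair, hγ⟩ := (algorithmA l v₀).exists_fair_fragment weight (by
    intro s a s' ha ht
    refine weight_lt ht ?_
    rintro p x rfl
    exact inv_not_mem_output p x ha) s
  have hlt : ∀ j, j < N → (α.splice γ N _ hN hs).act j = α.act j := fun j hj => if_pos hj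
  have heq : (α.splice γ N _ hN hs).act N = some (.inv p x) := by
    simp [IOAutomaton.Fragment.splice]
  have hgt : ∀ j, N < j → ∀ p x, (α.splice γ N _ hN hs).act j ≠ some (.inv p x) := by
    intro j hj p x h
    simp only [IOAutomaton.Fragment.splice] at h
    rw [if_neg (by omega), if_neg (by omega)] at h
    exact inv_not_mem_output p x (hγ _ _ h)
  have hst : ∀ j, j ≤ N → (α.splice γ N _ hN hs).state j = α.state j := fun j hj => if_pos hj
  refine ⟨α.splice γ N _ hN hs, ?_, ?_, hfair.splice, hlt, hst, heq⟩
  · rw [IOAutomaton.Fragment.IsExecution, hst 0 (Nat.zero_le _)]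
    exact hα
  · intro n n' p' y y' hn h h'
    rcases lt_trichotomy n' N with hn' | rfl | hn'
    · rw [hlt n (by omega)] at h
      rw [hlt n' hn'] at h'
      obtain ⟨m, hm, hr⟩ := hwf n n' p' y y' hn h h'
      exact ⟨m, hm, hr.congr (by omega) hlt⟩
    · rw [hlt n hn] at h
      rw [heq] at h'
      cases h'
      obtain ⟨m, hm, hr⟩ := hresp n y hn h
      exact ⟨m, hm, hr.congr hm hlt⟩
    · exact absurd h' (hgt n' hn' p' y')

end Termination

end SNOW

/-- Algorithm A with `l ≥ 1` writers, one reader and `k ≥ 1` servers is a wait-free implementation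
of the transaction data type over `k` objects: its well-formed fair executions satisfy S, N, O and
W, and all transactions complete. -/
theorem mainTheorem4 {k l : ℕ} (hk : 1 ≤ k) (hl : 1 ≤ l) (V : Fin k → Type*) (v₀ : ∀ i, V i) :
    (∀ α : (SNOW.algorithmA l v₀).Fragment,
      α.IsExecution → SNOW.WellFormed α.act → α.Fair →
        SNOW.StrictlySerializable v₀ α.act ∧
        SNOW.NonBlocking α ∧
        SNOW.OneResponse α.act ∧
        (∀ p, SNOW.CompletesAt p α.act)) ∧
    SNOW.InvocableAnytime l v₀ ∧
    SNOW.WaitFree l v₀ := by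
  refine ⟨fun α hα hwf hf => ⟨SNOW.strictlySerializable hα hwf, SNOW.nonBlocking hα hwf,
    SNOW.oneResponse hα hwf, fun p => ?_⟩, SNOW.invocableAnytime l v₀, SNOW.waitFree l v₀⟩
  exact SNOW.waitFree l v₀ α hα hwf p fun t _ => hf t trivial
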